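/- Let $a$ and $b$ be the standard generators of $\mathrm{PSL}_2(\mathbb{Z})=\langle a,b\mid a^2=b^3=1\rangle$ (the classes of $\begin{pmatrix}0&-1\\1&0\end{pmatrix}$ and $\begin{pmatrix}0&-1\\1&1\end{pmatrix}$). The Schreier graph of a subgroup $H\le \mathrm{PSL}_2(\mathbb{Z})$ has the right cosets $Hg$ as vertices, with an $x$-labeled edge from $Hg$ to $Hgx$ for every coset $Hg$ and $x\in\{a,b\}$. A word on $\{a,b,a^{-1},b^{-1}\}$ is geodesic if it is a shortest word representing its value. The Stallings graph $\Gamma(H)$ is the subgraph of the Schreier graph formed by the vertices and edges visited by the loops at the vertex $H$ that are labeled by the geodesic representatives of the elements of $H$; the size of $H$ is the number of vertices of $\Gamma(H)$. A finite $\{a,b\}$-labeled directed graph with base vertex $v_0$ is $\mathrm{PSL}_2(\mathbb{Z})$-reduced if it is connected; no two edges with the same label leave the same vertex or enter the same vertex; for every $a$-edge from $p$ to $q$ there is an $a$-edge from $q$ to $p$; for all $b$-edges from $p$ to $q$ and from $q$ to $r$ there is a $b$-edge from $r$ to $p$; and every vertex except possibly $v_0$ is adjacent to an $a$-edge and to a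 $b$-edge. A graph is $\mathrm{PSL}_2(\mathbb{Z})$-cyclically reduced if it is $\mathrm{PSL}_2(\mathbb{Z})$-reduced for every choice of base vertex. For $n\ge 1$, let $\mathcal{S}_n$ be the set of finitely generated subgroups of $\mathrm{PSL}_2(\mathbb{Z})$ of size $n$ whose Stallings graph is $\mathrm{PSL}_2(\mathbb{Z})$-cyclically reduced. Theorem. For every $n\ge1$ the set $\mathcal{S}_n$ is finite and nonempty, and each $H\in\mathcal{S}_n$ has a unique isomorphism type, that is, there is a unique triple $(\ell_2,\ell_3,r)\in\mathbb{N}^3$ such that $H$ is isomorphic to the free product of $\ell_2$ copies of $\mathbb{Z}/2$, $\ell_3$ copies of $\mathbb{Z}/3$ and a free group of rank $r$. With respect to the uniform distribution on $\mathcal{S}_n$, as $n\to\infty$, $$\mathbb{E}[\ell_2]=n^{1/2}+o(n^{1/2}),\qquad \mathbb{E}[\ell_3]=n^{1/3}+o(n^{1/3}),\qquad \mathbb{E}[r]=\frac n6-\frac13 n^{2/3}+o(n^{2/3}).$$ -/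

import Mathlib

open Filter Asymptotics

noncomputable section

namespace ModularSubgroups

/-- The modular group `PSL₂(ℤ) = SL₂(ℤ) / {±1}`. -/
abbrev PSL2Z : Type := Matrix.ProjectiveSpecialLinearGroup (Fin 2) ℤ

/-- The alphabet `A = {a, b}`. -/
inductive Gen : Type
  | a : Gen
  | b : Gen

/-- The standard generators of `PSL₂(ℤ) = ⟨a, b ∣ a² = b³ = 1⟩`: `a` is the class of
`S = (0, -1; 1, 0)`, of order `2`, and `b` is the class of `S * T = (0, -1; 1, 1)`,
of order `3`. -/
def genVal : Gen → PSL2Z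
  | Gen.a => QuotientGroup.mk ModularGroup.S
  | Gen.b => QuotientGroup.mk (ModularGroup.S * ModularGroup.T)

/-- A letter of `A ⊔ A⁻¹`: `(x, true)` is `x` and `(x, false)` is the formal inverse `x⁻¹`. -/
abbrev Letter : Type := Gen × Bool

/-- The element of `PSL₂(ℤ)` represented by a letter. -/
def letterVal : Letter → PSL2Z
  | (x, true) => genVal x
  | (x, false) => (genVal x)⁻¹

/-- Words on `A ⊔ A⁻¹`. -/
abbrev Word : Type := List Letter

/-- The element of `PSL₂(ℤ)` represented by a word. -/
def wordVal (w : Word) : PSL2Z := (w.map letterVal).prod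

/-- A word is geodesic if it is a shortest word representing its value. -/
def IsGeodesic (w : Word) : Prop :=
  ∀ w' : Word, wordVal w' = wordVal w → w.length ≤ w'.length

/-- Directed graphs with vertices in `V` and edges labeled by `A`; `edge x p q` says that there is
an `x`-labeled edge from `p` to `q`. -/
structure LabeledGraph (V : Type*) where
  verts : Set V
  edge : Gen → V → V → Prop
  source_mem : ∀ {x p q}, edge x p q → p ∈ verts
  target_mem : ∀ {x p q}, edge x p q → q ∈ verts

namespace LabeledGraph

variable {V : Type*}

/-- Any two vertices are joined by a path in which edges may be followed in both directions. -/
def Connected (Γ : LabeledGraph V) : Prop :=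
  ∀ p ∈ Γ.verts, ∀ q ∈ Γ.verts,
    Relation.ReflTransGen (fun s t => ∃ x, Γ.edge x s t ∨ Γ.edge x t s) p q

/-- No two edges out of (resp. into) the same vertex have the same label. -/
def FreelyReduced (Γ : LabeledGraph V) : Prop :=
  (∀ x p q r, Γ.edge x p q → Γ.edge x p r → q = r) ∧
  (∀ x p q r, Γ.edge x q p → Γ.edge x r p → q = r)

/-- The vertex `p` is adjacent to an `x`-labeled edge. -/
def Touches (Γ : LabeledGraph V) (x : Gen) (p : V) : Prop :=
  ∃ q, Γ.edge x p q ∨ Γ.edge x q p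

/-- The graph `Γ`, rooted at `v₀`, is `PSL₂(ℤ)`-reduced. -/
structure IsReduced (Γ : LabeledGraph V) (v₀ : V) : Prop where
  finite : Γ.verts.Finite
  root_mem : v₀ ∈ Γ.verts
  connected : Γ.Connected
  freelyReduced : Γ.FreelyReduced
  a_symm : ∀ p q, Γ.edge Gen.a p q → Γ.edge Gen.a q p
  b_triangle : ∀ p q r, Γ.edge Gen.b p q → Γ.edge Gen.b q r → Γ.edge Gen.b r p
  touches : ∀ p ∈ Γ.verts, p ≠ v₀ → ∀ x, Γ.Touches x p

/-- The (unrooted) graph `Γ` is `PSL₂(ℤ)`-cyclically reduced: it is `PSL₂(ℤ)`-reduced for every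
choice of a base vertex. -/
def IsCyclicallyReduced (Γ : LabeledGraph V) : Prop :=
  ∀ v ∈ Γ.verts, Γ.IsReduced v

end LabeledGraph

/-- The right cosets `H g`, that is, the vertices of the Schreier graph of `H`. -/
abbrev RightCoset (H : Subgroup PSL2Z) : Type := Quotient (QuotientGroup.rightRel H)

/-- The right coset `H g`. -/
def coset (H : Subgroup PSL2Z) (g : PSL2Z) : RightCoset H :=
  Quotient.mk (QuotientGroup.rightRel H) g

/-- The word `w` is a geodesic representative of an element of `H`, i.e. a geodesic word that
labels a loop at the vertex `H` of the Schreier graph. -/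
def IsGeodesicLoop (H : Subgroup PSL2Z) (w : Word) : Prop :=
  IsGeodesic w ∧ wordVal w ∈ H

/-- The Stallings graph of `H`: the subgraph of the Schreier graph of `H` (with vertices the right
cosets and an `x`-edge from `H g` to `H g x` for each `g` and each `x ∈ A`) that consists of the
vertices and edges visited by the loops at `H` labeled by the geodesic representatives of the
elements of `H`. Reading `x⁻¹` at `H g` follows backwards the `x`-edge from `H g x⁻¹` to `H g`. -/
def stallingsGraph (H : Subgroup PSL2Z) : LabeledGraph (RightCoset H) where
  verts := {p | ∃ u v : Word, IsGeodesicLoop H (u ++ v) ∧ p = coset H (wordVal u)}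
  edge x p q :=
    (∃ u v : Word, IsGeodesicLoop H (u ++ (x, true) :: v) ∧
      p = coset H (wordVal u) ∧ q = coset H (wordVal u * genVal x)) ∨
    (∃ u v : Word, IsGeodesicLoop H (u ++ (x, false) :: v) ∧
      q = coset H (wordVal u) ∧ p = coset H (wordVal u * (genVal x)⁻¹))
  source_mem := by
    rintro x p q (⟨u, v, h, hp, -⟩ | ⟨u, v, h, -, hp⟩)
    · exact ⟨u, _, h, hp⟩
    · exact ⟨u ++ [(x, false)], v, by simpa using h, by simp [hp, wordVal, letterVal]⟩
  target_mem := by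
    rintro x p q (⟨u, v, h, -, hq⟩ | ⟨u, v, h, hq, -⟩)
    · exact ⟨u ++ [(x, true)], v, by simpa using h, by simp [hq, wordVal, letterVal]⟩
    · exact ⟨u, _, h, hq⟩

/-- The finitely generated subgroups of `PSL₂(ℤ)` of size `n` (i.e. whose Stallings graph has `n`
vertices) whose Stallings graph is `PSL₂(ℤ)`-cyclically reduced. -/
def cyclicallyReducedSubgroups (n : ℕ) : Set (Subgroup PSL2Z) :=
  {H | H.FG ∧ (stallingsGraph H).verts.Finite ∧ (stallingsGraph H).verts.ncard = n ∧
    (stallingsGraph H).IsCyclicallyReduced}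

/-- The free product of `t.1` copies of `ℤ/2`, `t.2.1` copies of `ℤ/3` and a free group of
rank `t.2.2`. -/
abbrev FreeProductOfType (t : ℕ × ℕ × ℕ) : Type :=
  Monoid.Coprod (Monoid.CoprodI fun _ : Fin t.1 => Multiplicative (ZMod 2))
    (Monoid.Coprod (Monoid.CoprodI fun _ : Fin t.2.1 => Multiplicative (ZMod 3))
      (FreeGroup (Fin t.2.2)))

/-- The triple `t = (ℓ₂, ℓ₃, r)` is an isomorphism type of `H`. -/
def HasIsoType (H : Subgroup PSL2Z) (t : ℕ × ℕ × ℕ) : Prop :=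
  Nonempty (H ≃* FreeProductOfType t)

open Classical in
/-- The isomorphism type `(ℓ₂, ℓ₃, r)` of `H` (with value `(0, 0, 0)` if there is none). -/
def isoType (H : Subgroup PSL2Z) : ℕ × ℕ × ℕ :=
  if h : ∃ t, HasIsoType H t then h.choose else (0, 0, 0)

/-- The expected value of `f` on the set of size `n` cyclically reduced subgroups, with the uniform
distribution. -/
def expectedValue (n : ℕ) (f : Subgroup PSL2Z → ℕ) : ℝ :=
  (∑ᶠ H ∈ cyclicallyReducedSubgroups n, (f H : ℝ)) / ((cyclicallyReducedSubgroups n).ncard : ℝ)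

end ModularSubgroups

end

/-! For `n ≥ 2` a subgroup in `cyclicallyReducedSubgroups n` is encoded by a finite connected graph
with a base point, in which the `a`-edges form loops and two-element matchings and the `b`-edges
form loops, isolated edges and directed triangles (`Good`, `Full`, `Conn`). Ping-pong on the signs
of matrix entries shows that the geodesic words are those whose letters alternate in type, unique up
to the signs of the `a`-letters (`Reduced.wordEquiv`, `isGeodesic_iff_reduced`). Hence group
elements can be read in such a graph without ambiguity. By finiteness every edge lies on an
alternating loop at the base point, so the graph is the whole Stallings graph of the group of its
loops (`Good.exists_isStallings`). Each subgroup comes from the same number of labeled structures on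
`Fin n` (`card_fiber`), so an average over subgroups is an average over connected labeled structures
(`expectedValue_eq`).

The isomorphism type is read off a graph of groups (`Good.hasIsoType`). Its vertices are the `a`-
and `b`-components, its edges are the `n` points, and the vertex groups are `ℤ/2` at `a`-loops,
`ℤ/3` at `b`-loops and trivial elsewhere. So `ℓ₂` and `ℓ₃` count loops and `r` is the cycle rank `n
+ 1 - #components`. Counting components turns this into `r = n/6 + 1 - ℓ₂/2 - 2ℓ₃/3 - s/3`, where
`s` is the number of isolated `b`-edges (`isoType_loopSubgroup`). Uniqueness follows by counting
homomorphisms to cyclic groups of orders 2, 3 and 5 (`HasIsoType.unique`).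

Without connectedness the `a`-part and the `b`-part are independent. If `p n` counts the parts of
one label, the mean number of loops is `y n = n * p (n - 1) / p n`, and the mean of `s` is `y n * y
(n - 1)` for the label `b`. The recurrences for `p` give `y n ~ n^(1/2)` for `a` and `y n ~ n^(1/3)`
for `b`, so the mean of `s` is of order `n^(2/3)` and dominates the correction to `n/6`.

Finally, connectedness is negligible. The number of structures divided by `n!` has consecutive
ratios (index `n - 1` over index `n`) asymptotic to `n^(-1/6)`, which forces the proportion of
disconnected structures to `0` (`tendsto_disconnectedRatio`). Second moments and Cauchy–Schwarz
transfer the means to connected structures (`tendsto_average`). -/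

noncomputable section

namespace ModularSubgroups

/-! ### Normal forms in the modular group by ping-pong. -/

/-- The other generator. -/
def Gen.other : Gen → Gen
  | Gen.a => Gen.b
  | Gen.b => Gen.a

instance : DecidableEq Gen := fun x y => by
  cases x <;> cases y <;> first | exact isTrue rfl | exact isFalse (by simp)

instance : Fintype Gen := ⟨{Gen.a, Gen.b}, fun x => by cases x <;> simp⟩

@[simp] lemma Gen.other_other (x : Gen) : x.other.other = x := by cases x <;> rfl

lemma Gen.eq_other_of_ne {x y : Gen} (h : x ≠ y) : x = y.other := by
  cases x <;> cases y <;> simp_all [Gen.other]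

lemma mk_eq_one_of_eq_neg_one {M : Matrix.SpecialLinearGroup (Fin 2) ℤ} (h : M = -1) :
    (QuotientGroup.mk M : PSL2Z) = 1 := by
  rw [QuotientGroup.eq_one_iff, Matrix.SpecialLinearGroup.mem_center_iff]
  refine ⟨-1, by simp, ?_⟩
  subst h
  ext i j; fin_cases i <;> fin_cases j <;> simp

lemma eq_or_eq_neg_of_mk_eq {M N : Matrix.SpecialLinearGroup (Fin 2) ℤ}
    (h : (QuotientGroup.mk M : PSL2Z) = QuotientGroup.mk N) : N = M ∨ N = -M := by
  rw [QuotientGroup.eq, Matrix.SpecialLinearGroup.mem_center_iff] at h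
  obtain ⟨r, hr, h⟩ := h
  have hN : N = M * (M⁻¹ * N) := by group
  have hr' : r = 1 ∨ r = -1 := by simpa using hr
  rw [hN]
  rcases hr' with rfl | rfl
  · left
    have : M⁻¹ * N = 1 := by
      apply Subtype.ext; rw [← h]; simp
    rw [this, mul_one]
  · right
    have : M⁻¹ * N = -1 := by
      apply Subtype.ext; rw [← h]; simp
    rw [this, mul_neg, mul_one]

@[simp] lemma genVal_a_mul_self : genVal Gen.a * genVal Gen.a = 1 := by
  refine mk_eq_one_of_eq_neg_one (M := ModularGroup.S * ModularGroup.S) ?_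
  apply Subtype.ext
  simp only [Matrix.SpecialLinearGroup.coe_mul, ModularGroup.coe_S, 
    Matrix.SpecialLinearGroup.coe_neg, Matrix.SpecialLinearGroup.coe_one]
  decide

lemma genVal_b_mul_mul : genVal Gen.b * (genVal Gen.b * genVal Gen.b) = 1 := by
  refine mk_eq_one_of_eq_neg_one (M := (ModularGroup.S * ModularGroup.T) *
    ((ModularGroup.S * ModularGroup.T) * (ModularGroup.S * ModularGroup.T))) ?_
  apply Subtype.ext
  simp only [Matrix.SpecialLinearGroup.coe_mul, ModularGroup.coe_S, ModularGroup.coe_T,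
    Matrix.SpecialLinearGroup.coe_neg, Matrix.SpecialLinearGroup.coe_one]
  decide

/-- The inverse of a letter. -/
def linv (l : Letter) : Letter := (l.1, !l.2)

@[simp] lemma linv_fst (l : Letter) : (linv l).1 = l.1 := rfl

@[simp] lemma linv_linv (l : Letter) : linv (linv l) = l := by simp [linv]

@[simp] lemma letterVal_linv (l : Letter) : letterVal (linv l) = (letterVal l)⁻¹ := by
  rcases l with ⟨x, _ | _⟩ <;> simp [linv, letterVal]

/-- The inverse of a word. -/
def winv (w : Word) : Word := (w.map linv).reverse

@[simp] lemma wordVal_nil : wordVal [] = 1 := rfl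

@[simp] lemma wordVal_cons (l : Letter) (w : Word) : wordVal (l :: w) = letterVal l * wordVal w := by
  simp [wordVal]

@[simp] lemma wordVal_append (u v : Word) : wordVal (u ++ v) = wordVal u * wordVal v := by
  simp [wordVal]

@[simp] lemma winv_nil : winv [] = [] := rfl

lemma winv_cons (l : Letter) (w : Word) : winv (l :: w) = winv w ++ [linv l] := by
  simp [winv]

@[simp] lemma wordVal_winv (w : Word) : wordVal (winv w) = (wordVal w)⁻¹ := by
  induction w with
  | nil => simp
  | cons l w ih => simp [winv_cons, ih]

lemma letterVal_a_mul {l m : Letter} (hl : l.1 = Gen.a) (hm : m.1 = Gen.a) :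
    letterVal l * letterVal m = 1 := by
  have h : (genVal Gen.a)⁻¹ = genVal Gen.a := inv_eq_of_mul_eq_one_left genVal_a_mul_self
  rcases l with ⟨x, _ | _⟩ <;> rcases m with ⟨y, _ | _⟩ <;> dsimp at hl hm <;> subst hl hm <;>
    simp [letterVal, h]

lemma letterVal_b_mul_self {l : Letter} (hl : l.1 = Gen.b) :
    letterVal l * letterVal l = letterVal (linv l) := by
  have h := genVal_b_mul_mul
  rw [letterVal_linv, eq_inv_iff_mul_eq_one]
  rcases l with ⟨x, _ | _⟩ <;> dsimp at hl <;> subst hl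
  · have := congrArg (·⁻¹) h
    simpa [letterVal, mul_assoc] using this
  · simpa [letterVal, mul_assoc] using h

/-- `S` and `T` generate `SL₂(ℤ)`, and `T` is `a⁻¹ b` in the quotient. -/
lemma exists_wordVal_eq (g : PSL2Z) : ∃ w, wordVal w = g := by
  let R : Subgroup PSL2Z :=
    { carrier := {g | ∃ w, wordVal w = g}
      mul_mem' := by
        rintro _ _ ⟨u, rfl⟩ ⟨v, rfl⟩; exact ⟨u ++ v, by simp⟩
      one_mem' := ⟨[], rfl⟩
      inv_mem' := by rintro _ ⟨u, rfl⟩; exact ⟨winv u, by simp⟩ }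
  have hS : (QuotientGroup.mk ModularGroup.S : PSL2Z) ∈ R := ⟨[(Gen.a, true)], by simp [letterVal, genVal]⟩
  have hT : (QuotientGroup.mk ModularGroup.T : PSL2Z) ∈ R :=
    ⟨[(Gen.a, false), (Gen.b, true)], by simp [letterVal, genVal]⟩
  have hle : Subgroup.closure {ModularGroup.S, ModularGroup.T} ≤
      R.comap (QuotientGroup.mk' _) := by
    rw [Subgroup.closure_le]
    rintro x (rfl | rfl)
    · exact hS
    · exact hT
  rw [SpecialLinearGroup.SL2Z_generators] at hle
  obtain ⟨M, rfl⟩ := QuotientGroup.mk_surjective g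
  exact hle (Subgroup.mem_top M)

/-- `Alt x w y`: the types of the letters of `w` alternate, the first letter has type `x` and the
next letter to be appended would have type `y`. -/
def Alt : Gen → Word → Gen → Prop
  | x, [], y => x = y
  | x, l :: w, y => l.1 = x ∧ Alt x.other w y

lemma Alt.append {x y z : Gen} {u v : Word} (hu : Alt x u y) (hv : Alt y v z) :
    Alt x (u ++ v) z := by
  induction u generalizing x with
  | nil => cases hu; exact hv
  | cons l u ih => exact ⟨hu.1, ih hu.2⟩

lemma alt_append {x z : Gen} {u v : Word} :
    Alt x (u ++ v) z ↔ ∃ y, Alt x u y ∧ Alt y v z := by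
  refine ⟨fun h => ?_, fun ⟨y, hu, hv⟩ => hu.append hv⟩
  induction u generalizing x with
  | nil => exact ⟨x, rfl, h⟩
  | cons l u ih =>
    obtain ⟨y, h1, h2⟩ := ih h.2
    exact ⟨y, ⟨h.1, h1⟩, h2⟩

lemma alt_singleton (l : Letter) : Alt l.1 [l] l.1.other := ⟨rfl, rfl⟩

lemma Alt.winv {x y : Gen} {w : Word} (h : Alt x w y) : Alt y.other (winv w) x.other := by
  induction w generalizing x with
  | nil => cases h; rfl
  | cons l w ih =>
    rw [winv_cons]
    refine (ih h.2).append ?_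
    obtain rfl := h.1
    simpa using alt_singleton (linv l)

/-- A word is reduced if the types of its letters alternate. -/
def Reduced (w : Word) : Prop := ∃ x y, Alt x w y

lemma reduced_nil : Reduced [] := ⟨Gen.a, Gen.a, rfl⟩

/-- The regions used for playing ping-pong. -/
def Region : Gen → Set PSL2Z
  | Gen.a => {g | ∃ M : Matrix.SpecialLinearGroup (Fin 2) ℤ,
      QuotientGroup.mk M = g ∧ M 0 0 * M 1 0 < 0}
  | Gen.b => {g | ∃ M : Matrix.SpecialLinearGroup (Fin 2) ℤ,
      QuotientGroup.mk M = g ∧ 0 < M 0 0 * M 1 0}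

lemma region_nonempty (x : Gen) : (Region x).Nonempty := by
  cases x
  · exact ⟨_, ⟨!![1, 0; -1, 1], by simp⟩, rfl, by simp⟩
  · exact ⟨_, ⟨!![1, 0; 1, 1], by simp⟩, rfl, by simp⟩

lemma disjoint_region {x y : Gen} {g : PSL2Z} (hx : g ∈ Region x) (hy : g ∈ Region y) : x = y := by
  have key : g ∈ Region Gen.a → g ∈ Region Gen.b → False := by
    rintro ⟨M, rfl, hM⟩ ⟨N, hN, hN'⟩
    rcases eq_or_eq_neg_of_mk_eq hN with rfl | rfl
    · linarith
    · simp at hM; linarith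
  cases x <;> cases y <;> first | rfl | exact (key hx hy).elim | exact (key hy hx).elim

/-- On a first column `(x, y)` the product `x * y` becomes `-xy` under `a^±1`, `-xy - y²` under `b`
and `-xy - x²` under `b⁻¹`. So `a` exchanges the signs, and both powers of `b` send positive
products to negative ones. -/
lemma letterVal_mul_mem_region (l : Letter) {g : PSL2Z} (hg : g ∈ Region l.1) :
    letterVal l * g ∈ Region l.1.other := by
  rcases l with ⟨_ | _, _ | _⟩ <;> obtain ⟨M, rfl, hM⟩ := hg
  · refine ⟨ModularGroup.S⁻¹ * M, rfl, ?_⟩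
    simp [Matrix.mul_apply, Fin.sum_univ_two, Matrix.adjugate_fin_two, ModularGroup.coe_S]
    nlinarith
  · refine ⟨ModularGroup.S * M, rfl, ?_⟩
    simp [Matrix.mul_apply, Fin.sum_univ_two, ModularGroup.coe_S]
    nlinarith
  · refine ⟨(ModularGroup.S * ModularGroup.T)⁻¹ * M, rfl, ?_⟩
    simp [Matrix.mul_apply, Fin.sum_univ_two, Matrix.adjugate_fin_two, ModularGroup.coe_S, ModularGroup.coe_T]
    nlinarith [sq_nonneg (M 0 0), sq_nonneg (M 1 0)]
  · refine ⟨(ModularGroup.S * ModularGroup.T) * M, rfl, ?_⟩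
    simp [Matrix.mul_apply, Fin.sum_univ_two, ModularGroup.coe_S, ModularGroup.coe_T]
    nlinarith [sq_nonneg (M 0 0), sq_nonneg (M 1 0)]

lemma Alt.wordVal_mul_mem_region {x y : Gen} {w : Word} (h : Alt x w y) {g : PSL2Z}
    (hg : g ∈ Region y.other) : wordVal w * g ∈ Region x.other := by
  induction w generalizing x with
  | nil => cases h; simpa using hg
  | cons l w ih =>
    obtain ⟨rfl, h⟩ := h
    rw [wordVal_cons, mul_assoc]
    exact letterVal_mul_mem_region l (by simpa using ih h)

/-- Ping-pong alone does not exclude a word that starts with `a` and ends with `b^±1`, since it maps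
a region to itself. If such a word `u m` were trivial, then `u m⁻¹ = m⁻² = m`. But the alternating
word `u m⁻¹` keeps `Region Gen.b`, whereas `m` sends it to `Region Gen.a`. -/
lemma Alt.wordVal_ne_one_of_a {w : Word} (hw : w ≠ []) (h : Alt Gen.a w Gen.a) :
    wordVal w ≠ 1 := by
  intro h1
  obtain ⟨u, m, rfl⟩ := (List.eq_nil_or_concat' w).resolve_left hw
  obtain ⟨y, hu, hm⟩ := alt_append.1 h
  obtain ⟨hm1, hm2⟩ := hm
  have hmb : m.1 = Gen.b := by
    cases y
    · cases hm2
    · exact hm1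
  have h' : Alt Gen.a (u ++ [linv m]) Gen.a := hu.append ⟨hm1, hm2⟩
  obtain ⟨g, hg⟩ := region_nonempty Gen.b
  have e : wordVal (u ++ [linv m]) = letterVal m := by
    have h2 := letterVal_b_mul_self (l := linv m) hmb
    rw [linv_linv] at h2
    rw [← h2, wordVal_append]
    congr 1
    · rw [letterVal_linv]
      exact eq_inv_of_mul_eq_one_left (by simpa using h1)
    · simp
  have h3 := h'.wordVal_mul_mem_region (g := g) hg
  rw [e] at h3
  have h4 := letterVal_mul_mem_region m (g := g) (by rwa [hmb])
  rw [hmb] at h4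
  exact absurd (disjoint_region h3 h4) (by simp [Gen.other])

/-- Disjointness of the regions forces the first and last letters to have different types. Passing
to the inverse if necessary, the word starts with `a`. -/
lemma Reduced.wordVal_ne_one {w : Word} (hw : w ≠ []) (h : Reduced w) : wordVal w ≠ 1 := by
  intro h1
  obtain ⟨x, y, h⟩ := h
  obtain ⟨g, hg⟩ := region_nonempty y.other
  have h2 := h.wordVal_mul_mem_region hg
  rw [h1, one_mul] at h2
  have hxy := congrArg Gen.other (disjoint_region h2 hg)
  simp only [Gen.other_other] at hxy
  subst hxy
  cases x
  · exact h.wordVal_ne_one_of_a hw h1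
  · exact h.winv.wordVal_ne_one_of_a (by simpa [ModularSubgroups.winv] using hw) (by simp [h1])

lemma letterVal_eq_of_a {l m : Letter} (hl : l.1 = Gen.a) (hm : m.1 = Gen.a) :
    letterVal l = letterVal m :=
  mul_right_cancel ((letterVal_a_mul hl hm).trans (letterVal_a_mul hm hm).symm)

lemma letter_eq_or_eq_linv {l m : Letter} (h : l.1 = m.1) : l = m ∨ l = linv m := by
  rcases l with ⟨x, _ | _⟩ <;> rcases m with ⟨y, _ | _⟩ <;> simp_all [linv]

lemma gen_eq_a_or_b (x : Gen) : x = Gen.a ∨ x = Gen.b := by cases x <;> simp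

/-- Two words are equal up to the signs of the letters of type `a`. -/
def WordEquiv : Word → Word → Prop :=
  List.Forall₂ fun l m => l.1 = m.1 ∧ (l.1 = Gen.a ∨ l = m)

/-- If the first letters represent different elements, then `u` and `v` combine into a nonempty
reduced word of value `1`, which is impossible. Signs of `a`-letters are invisible because `a =
a⁻¹`. -/
lemma Reduced.wordEquiv {u v : Word} (hu : Reduced u) (hv : Reduced v)
    (h : wordVal u = wordVal v) : WordEquiv u v := by
  induction u generalizing v with
  | nil =>
    cases v with
    | nil => exact List.Forall₂.nil
    | cons m v => exact (hv.wordVal_ne_one (by simp) h.symm).elim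
  | cons l u ih =>
    cases v with
    | nil => exact (hu.wordVal_ne_one (by simp) h).elim
    | cons m v =>
      obtain ⟨x, y, rfl, hu'⟩ := hu
      obtain ⟨z, t, rfl, hv'⟩ := hv
      by_cases hlm : l.1 = m.1
      · have key : (l.1 = Gen.a ∨ l = m) ∨ (l.1 = Gen.b ∧ l = linv m) := by
          rcases gen_eq_a_or_b l.1 with ha | hb
          · exact Or.inl (Or.inl ha)
          · rcases letter_eq_or_eq_linv hlm with e | e
            · exact Or.inl (Or.inr e)
            · exact Or.inr ⟨hb, e⟩
        rcases key with key | ⟨hb, rfl⟩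
        · refine List.Forall₂.cons ⟨hlm, key⟩ (ih ⟨_, _, hu'⟩ ⟨_, _, hv'⟩ ?_)
          have hl : letterVal l = letterVal m := by
            rcases key with ha | rfl
            · exact letterVal_eq_of_a ha (hlm ▸ ha)
            · rfl
          rw [wordVal_cons, wordVal_cons, hl] at h
          exact mul_left_cancel h
        · exfalso
          -- Here `m⁻¹ u = m v`, and `m⁻² = m` turns this into `v⁻¹ m u = 1`.
          have hred : Reduced (winv v ++ m :: u) :=
            ⟨_, _, hv'.winv.append (by simpa using ⟨rfl, hu'⟩)⟩
          refine hred.wordVal_ne_one (by simp) ?_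
          have hb' : (linv m).1 = Gen.b := hb
          have h2 := letterVal_b_mul_self hb'
          rw [linv_linv] at h2
          rw [wordVal_cons, wordVal_cons] at h
          rw [wordVal_append, wordVal_winv, wordVal_cons, ← h2, mul_assoc, h, letterVal_linv]
          group
      · exfalso
        have hred : Reduced (winv (m :: v) ++ l :: u) := by
          refine ⟨_, y, (show Alt m.1 (m :: v) t from ⟨rfl, hv'⟩).winv.append ⟨?_, ?_⟩⟩
          · exact Gen.eq_other_of_ne hlm
          · rwa [← Gen.eq_other_of_ne hlm]
        exact hred.wordVal_ne_one (by simp) (by simp [← h])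

lemma WordEquiv.length_eq {u v : Word} (h : WordEquiv u v) : u.length = v.length :=
  List.Forall₂.length_eq h

/-! ### Reading words in labeled graphs. -/

section Reads

variable {V : Type*}

/-- Families of labeled edges that are deterministic, codeterministic, and closed under the
relations `a² = 1` and `b³ = 1`. -/
structure Good (E : Gen → V → V → Prop) : Prop where
  det : ∀ {x p q r}, E x p q → E x p r → q = r
  codet : ∀ {x p q r}, E x q p → E x r p → q = r
  a_symm : ∀ {p q}, E Gen.a p q → E Gen.a q p
  b_triangle : ∀ {p q r}, E Gen.b p q → E Gen.b q r → E Gen.b r p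

/-- Following a letter. -/
def LStep (E : Gen → V → V → Prop) (l : Letter) (p q : V) : Prop :=
  if l.2 then E l.1 p q else E l.1 q p

@[simp] lemma lStep_true (E : Gen → V → V → Prop) (x : Gen) (p q : V) :
    LStep E (x, true) p q ↔ E x p q := by simp [LStep]

@[simp] lemma lStep_false (E : Gen → V → V → Prop) (x : Gen) (p q : V) :
    LStep E (x, false) p q ↔ E x q p := by simp [LStep]

lemma lStep_linv {E : Gen → V → V → Prop} {l : Letter} {p q : V} :
    LStep E (linv l) p q ↔ LStep E l q p := by
  rcases l with ⟨x, _ | _⟩ <;> simp [linv]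

/-- The word `w` can be read from `p` to `q`. -/
def Reads (E : Gen → V → V → Prop) : Word → V → V → Prop
  | [], p, q => p = q
  | l :: w, p, q => ∃ r, LStep E l p r ∧ Reads E w r q

variable {E : Gen → V → V → Prop}

lemma reads_singleton {l : Letter} {p q : V} : Reads E [l] p q ↔ LStep E l p q := by
  simp [Reads]

lemma reads_append {u v : Word} {p q : V} :
    Reads E (u ++ v) p q ↔ ∃ r, Reads E u p r ∧ Reads E v r q := by
  induction u generalizing p with
  | nil => simp [Reads]
  | cons l u ih => simp only [List.cons_append, Reads, ih]; tauto

lemma Reads.winv {w : Word} {p q : V} (h : Reads E w p q) : Reads E (winv w) q p := by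
  induction w generalizing p with
  | nil => exact Eq.symm h
  | cons l w ih =>
    obtain ⟨r, h1, h2⟩ := h
    rw [winv_cons, reads_append]
    exact ⟨r, ih h2, reads_singleton.2 (lStep_linv.2 h1)⟩

namespace Good

lemma lStep_det (hE : Good E) {l : Letter} {p q r : V} (h : LStep E l p q) (h' : LStep E l p r) :
    q = r := by
  rcases l with ⟨x, _ | _⟩
  · simp only [lStep_false] at h h'; exact hE.codet h h'
  · simp only [lStep_true] at h h'; exact hE.det h h'

lemma reads_det (hE : Good E) {w : Word} {p q r : V} (h : Reads E w p q) (h' : Reads E w p r) :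
    q = r := by
  induction w generalizing p with
  | nil => exact (Eq.symm h).trans h'
  | cons l w ih =>
    obtain ⟨s, h1, h2⟩ := h
    obtain ⟨s', h1', h2'⟩ := h'
    obtain rfl := hE.lStep_det h1 h1'
    exact ih h2 h2'

lemma lStep_a (hE : Good E) {l m : Letter} (hl : l.1 = Gen.a) (hm : m.1 = Gen.a) {p q : V}
    (h : LStep E l p q) : LStep E m p q := by
  rcases l with ⟨x, _ | _⟩ <;> rcases m with ⟨y, _ | _⟩ <;> dsimp at hl hm <;> subst hl hm <;>
    simp only [lStep_false, lStep_true] at h ⊢ <;> first | exact h | exact hE.a_symm h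

lemma lStep_b (hE : Good E) {l : Letter} (hl : l.1 = Gen.b) {p q r : V}
    (h : LStep E l p q) (h' : LStep E l q r) : LStep E (linv l) p r := by
  rcases l with ⟨x, _ | _⟩ <;> dsimp at hl <;> subst hl <;>
    simp only [linv, lStep_false, lStep_true, Bool.not_true, Bool.not_false] at h h' ⊢
  · exact hE.b_triangle h' h
  · exact hE.b_triangle h h'

lemma reads_wordEquiv (hE : Good E) {u v : Word} (h : WordEquiv u v) {p q : V}
    (hu : Reads E u p q) : Reads E v p q := by
  induction h generalizing p with
  | nil => exact hu
  | cons h _ ih =>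
    obtain ⟨r, h1, h2⟩ := hu
    refine ⟨r, ?_, ih h2⟩
    rcases h with ⟨h, ha | rfl⟩
    · exact hE.lStep_a ha (h ▸ ha) h1
    · exact h1

/-- The rewritings that reduce a word are `a^±1 a^±1 → 1`, `b^±1 b^∓1 → 1` and `b^±1 b^±1 → b^∓1`.
The axioms of `Good` say that each of them can be followed in the graph between the same endpoints,
and each shortens the word. -/
lemma exists_reduced (hE : Good E) {w : Word} {p q : V} (h : Reads E w p q) :
    ∃ w', Reduced w' ∧ wordVal w' = wordVal w ∧ Reads E w' p q ∧
      (w' = w ∨ w'.length < w.length) := by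
  induction w generalizing p with
  | nil => exact ⟨[], reduced_nil, rfl, h, Or.inl rfl⟩
  | cons l w ih =>
    obtain ⟨r, h1, h2⟩ := h
    obtain ⟨w', hw', hval, hr, hlen⟩ := ih h2
    have hlen' : w'.length ≤ w.length := by rcases hlen with rfl | h <;> omega
    cases w' with
    | nil =>
      refine ⟨[l], ⟨_, _, alt_singleton l⟩, by simp [← hval], ⟨r, h1, hr⟩, ?_⟩
      rcases hlen with h | h
      · left; rw [h]
      · right; simpa using h
    | cons m w' =>
      obtain ⟨s, h3, h4⟩ := hr
      obtain ⟨x, y, rfl, halt⟩ := hw'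
      by_cases hlm : l.1 = m.1
      · have hcancel : letterVal l * letterVal m = 1 → s = p → ∃ w', Reduced w' ∧
            wordVal w' = wordVal (l :: w) ∧ Reads E w' p q ∧
            (w' = l :: w ∨ w'.length < (l :: w).length) := by
          rintro e rfl
          refine ⟨w', ⟨_, _, halt⟩, ?_, h4, Or.inr ?_⟩
          · rw [wordVal_cons, ← hval, wordVal_cons, ← mul_assoc, e, one_mul]
          · simp only [List.length_cons] at hlen' ⊢; omega
        rcases gen_eq_a_or_b l.1 with ha | hb
        · exact hcancel (letterVal_a_mul ha (hlm ▸ ha)) (hE.lStep_det h3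
            (lStep_linv.1 (hE.lStep_a (by exact ha) (by exact hlm ▸ ha) h1)))
        · rcases letter_eq_or_eq_linv hlm with rfl | rfl
          · refine ⟨linv l :: w', ⟨l.1, y, rfl, halt⟩, ?_, ⟨s, hE.lStep_b hb h1 h3, h4⟩, Or.inr ?_⟩
            · rw [wordVal_cons, wordVal_cons, ← hval, wordVal_cons, ← mul_assoc,
                letterVal_b_mul_self hb]
            · simp only [List.length_cons] at hlen' ⊢; omega
          · exact hcancel (by simp) (hE.lStep_det h3 (lStep_linv.1 h1))
      · refine ⟨l :: m :: w', ⟨l.1, y, rfl, ?_, ?_⟩, by simp [← hval], ⟨r, h1, s, h3, h4⟩, ?_⟩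
        · exact Gen.eq_other_of_ne (Ne.symm hlm)
        · rwa [← Gen.eq_other_of_ne (Ne.symm hlm)]
        · rcases hlen with h | h
          · left; rw [h]
          · right; simpa using h

lemma reads_of_reduced (hE : Good E) {u v : Word} {p q : V} (hu : Reads E u p q)
    (hv : Reduced v) (h : wordVal u = wordVal v) : Reads E v p q := by
  obtain ⟨u', h1, h2, h3, -⟩ := hE.exists_reduced hu
  exact hE.reads_wordEquiv (h1.wordEquiv hv (h2.trans h)) h3

/-- The endpoint of a path depends only on its origin and on the group element read, because both
words reduce to equivalent reduced words. This is what makes `Path` single-valued. -/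
lemma eq_of_reads (hE : Good E) {u v : Word} {p q r : V} (hu : Reads E u p q)
    (hv : Reads E v p r) (h : wordVal u = wordVal v) : q = r := by
  obtain ⟨v', h1, h2, h3, -⟩ := hE.exists_reduced hv
  exact hE.reads_det (hE.reads_of_reduced hu h1 (h.trans h2.symm)) h3

end Good

end Reads

/-- Every word is readable in the graph with one vertex and all loops, so `Good.exists_reduced`
applies there. -/
lemma exists_reduced_wordVal (w : Word) :
    ∃ w', Reduced w' ∧ wordVal w' = wordVal w ∧ (w' = w ∨ w'.length < w.length) := by
  have hE : Good (fun (_ : Gen) (_ _ : Unit) => True) :=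
    ⟨fun _ _ => rfl, fun _ _ => rfl, fun _ => trivial, fun _ _ => trivial⟩
  have hr : Reads (fun (_ : Gen) (_ _ : Unit) => True) w () () := by
    induction w with
    | nil => rfl
    | cons l w ih => exact ⟨(), by simp [LStep], ih⟩
  obtain ⟨w', h1, h2, -, h3⟩ := hE.exists_reduced hr
  exact ⟨w', h1, h2, h3⟩

lemma isGeodesic_iff_reduced {w : Word} : IsGeodesic w ↔ Reduced w := by
  constructor
  · intro h
    obtain ⟨w', h1, h2, rfl | h3⟩ := exists_reduced_wordVal w
    · exact h1
    · exact absurd (h w' h2) (by omega)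
  · intro h v hv
    obtain ⟨v', h1, h2, h3⟩ := exists_reduced_wordVal v
    have := (h.wordEquiv h1 (hv.symm.trans h2.symm)).length_eq
    rcases h3 with rfl | h3 <;> omega

/-! ### Groups of loops and alternating walks. -/

section Paths

variable {V : Type*} {E : Gen → V → V → Prop}

/-- The group element `g` labels a path from `p` to `q`. -/
def Path (E : Gen → V → V → Prop) (g : PSL2Z) (p q : V) : Prop :=
  ∃ w, wordVal w = g ∧ Reads E w p q

lemma Path.refl (E : Gen → V → V → Prop) (p : V) : Path E 1 p p := ⟨[], rfl, rfl⟩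

lemma Path.mul {g h : PSL2Z} {p q r : V} (hg : Path E g p q) (hh : Path E h q r) :
    Path E (g * h) p r := by
  obtain ⟨u, rfl, hu⟩ := hg
  obtain ⟨v, rfl, hv⟩ := hh
  exact ⟨u ++ v, by simp, reads_append.2 ⟨q, hu, hv⟩⟩

lemma Path.inv {g : PSL2Z} {p q : V} (hg : Path E g p q) : Path E g⁻¹ q p := by
  obtain ⟨u, rfl, hu⟩ := hg
  exact ⟨winv u, by simp, hu.winv⟩

lemma Path.of_edge {x : Gen} {p q : V} (h : E x p q) : Path E (genVal x) p q :=
  ⟨[(x, true)], by simp [letterVal], by simpa [Reads] using h⟩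

lemma Path.eq (hE : Good E) {g : PSL2Z} {p q r : V} (h : Path E g p q) (h' : Path E g p r) :
    q = r := by
  obtain ⟨u, hu, hu'⟩ := h
  obtain ⟨v, hv, hv'⟩ := h'
  exact hE.eq_of_reads hu' hv' (hu.trans hv.symm)

/-- The subgroup of the elements that label a loop at `v`. -/
def loopSubgroup (E : Gen → V → V → Prop) (v : V) : Subgroup PSL2Z where
  carrier := {g | Path E g v v}
  mul_mem' := Path.mul
  one_mem' := Path.refl E v
  inv_mem' := Path.inv

lemma mem_loopSubgroup {v : V} {g : PSL2Z} : g ∈ loopSubgroup E v ↔ Path E g v v := Iff.rfl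

/-- Adjacency through an edge of any label, in any direction. -/
def Adj (E : Gen → V → V → Prop) (p q : V) : Prop := ∃ x, E x p q ∨ E x q p

/-- Any two vertices are joined by a path. -/
def Conn (E : Gen → V → V → Prop) : Prop := ∀ p q, Relation.ReflTransGen (Adj E) p q

/-- Every vertex is adjacent to an edge of each label. -/
def Full (E : Gen → V → V → Prop) : Prop := ∀ x p, ∃ q, E x p q ∨ E x q p

lemma Adj.exists_path {p q : V} (h : Adj E p q) : ∃ g, Path E g p q := by
  obtain ⟨x, h | h⟩ := h
  · exact ⟨_, Path.of_edge h⟩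
  · exact ⟨_, (Path.of_edge h).inv⟩

lemma Conn.exists_path (h : Conn E) (p q : V) : ∃ g, Path E g p q := by
  induction h p q with
  | refl => exact ⟨1, Path.refl E p⟩
  | tail _ h1 ih =>
    obtain ⟨g, hg⟩ := ih
    obtain ⟨k, hk⟩ := h1.exists_path
    exact ⟨_, hg.mul hk⟩

/-- Schreier's argument: with `g p` labeling a path from `v` to `p`, a loop is a product of elements
`g p * x * (g q)⁻¹` over the edges that it follows. -/
lemma loopSubgroup_fg [Finite V] (hE : Conn E) (v : V) : (loopSubgroup E v).FG := by
  choose g hg using hE.exists_path v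
  rw [Subgroup.fg_iff]
  let T : Set PSL2Z := (Set.range fun t : Gen × V × V => g t.2.1 * genVal t.1 * (g t.2.2)⁻¹) ∩
    loopSubgroup E v
  -- The chosen `g v` need not be `1`. It labels a loop, and is added so that the conjugation by it
  -- can be undone.
  let T' : Set PSL2Z := insert (g v) T
  have hT' : T'.Finite := ((Set.finite_range _).inter_of_left _).insert _
  refine ⟨T', le_antisymm ?_ ?_, hT'⟩
  · rw [Subgroup.closure_le]
    rintro x (rfl | hx)
    · exact hg v
    · exact hx.2
  · have hgen : ∀ x p q, E x p q → g p * genVal x * (g q)⁻¹ ∈ Subgroup.closure T' := by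
      intro x p q h
      refine Subgroup.subset_closure (Or.inr ⟨⟨(x, p, q), rfl⟩, ?_⟩)
      exact ((hg p).mul (Path.of_edge h)).mul (hg q).inv
    have key : ∀ w p, Reads E w p v → g p * wordVal w * (g v)⁻¹ ∈ Subgroup.closure T' := by
      intro w
      induction w with
      | nil => rintro p rfl; simp
      | cons l w ih =>
        rintro p ⟨r, h1, h2⟩
        have h3 : g p * letterVal l * (g r)⁻¹ ∈ Subgroup.closure T' := by
          rcases l with ⟨x, _ | _⟩
          · have := inv_mem (hgen x r p (by simpa using h1))
            simpa [letterVal, mul_assoc] using this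
          · exact hgen x p r (by simpa using h1)
        simpa [mul_assoc] using mul_mem h3 (ih r h2)
    rintro x ⟨w, rfl, hw⟩
    have hv : g v ∈ Subgroup.closure T' := Subgroup.subset_closure (Or.inl rfl)
    simpa [mul_assoc] using mul_mem (mul_mem (inv_mem hv) (key w v hw)) hv

/-- Moves between pairs of a vertex and the type of the next letter to be read. -/
def Step (E : Gen → V → V → Prop) (s t : V × Gen) : Prop :=
  t.2 = s.2.other ∧ (E s.2 s.1 t.1 ∨ E s.2 t.1 s.1)

/-- The reversed edges. -/
def rev (E : Gen → V → V → Prop) : Gen → V → V → Prop := fun x p q => E x q p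

lemma Good.rev (hE : Good E) : Good (rev E) :=
  ⟨hE.codet, hE.det, hE.a_symm, fun h1 h2 => hE.b_triangle h2 h1⟩

lemma Full.rev (hE : Full E) : Full (rev E) := fun x p => by
  obtain ⟨q, h⟩ := hE x p
  exact ⟨q, h.symm⟩

lemma step_rev : Step (rev E) = Step E := by
  ext s t
  simp only [Step, rev, or_comm]

/-- Two consecutive edges with the same label close up into a cycle. -/
lemma Good.no_fork (hE : Good E) {x : Gen} {p q r : V} (h : E x p r) (h' : E x r q) :
    ∃ s, E x q s := by
  cases x
  · exact ⟨r, hE.a_symm h'⟩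
  · exact ⟨p, hE.b_triangle h h'⟩

/-- Reading the prescribed type forwards when possible and backwards otherwise defines a self-map of
`V × Gen`. It is injective, hence a permutation of a finite set, and the orbit of `(p, x)` passes
through `(q, x.other)` and returns to `(p, x)`. -/
lemma Good.exists_return_of_edge [Finite V] (hE : Good E) (hF : Full E) {x : Gen} {p q : V}
    (h : E x p q) : Relation.ReflTransGen (Step E) (q, x.other) (p, x) := by
  have hnext : ∀ s : V × Gen, ∃ t : V × Gen, t.2 = s.2.other ∧
      (E s.2 s.1 t.1 ∨ ((¬ ∃ r, E s.2 s.1 r) ∧ E s.2 t.1 s.1)) := by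
    rintro ⟨p, x⟩
    by_cases hp : ∃ r, E x p r
    · obtain ⟨r, hr⟩ := hp
      exact ⟨(r, x.other), rfl, Or.inl hr⟩
    · obtain ⟨r, hr | hr⟩ := hF x p
      · exact absurd ⟨r, hr⟩ hp
      · exact ⟨(r, x.other), rfl, Or.inr ⟨hp, hr⟩⟩
  choose f hf1 hf2 using hnext
  have hstep : ∀ s, Step E s (f s) := fun s => ⟨hf1 s, (hf2 s).imp_right And.right⟩
  have hinj : Function.Injective f := by
    rintro ⟨p, x⟩ ⟨q, y⟩ hpq
    have hxy : x = y := by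
      have := (hf1 (p, x)).symm.trans ((congrArg Prod.snd hpq).trans (hf1 (q, y)))
      simpa using congrArg Gen.other this
    subst hxy
    have h1 := hf2 (p, x)
    have h2 := hf2 (q, x)
    rw [hpq] at h1
    dsimp only at h1 h2
    congr 1
    rcases h1 with h1 | ⟨h1, h1'⟩ <;> rcases h2 with h2 | ⟨h2, h2'⟩
    · exact hE.codet h1 h2
    · exact absurd (hE.no_fork h1 h2') h2
    · exact absurd (hE.no_fork h2 h1') h1
    · exact hE.det h1' h2'
  have hfp : f (p, x) = (q, x.other) := by
    refine Prod.ext ?_ (hf1 _)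
    rcases hf2 (p, x) with h1 | ⟨h1, -⟩
    · exact hE.det h1 h
    · exact absurd ⟨q, h⟩ h1
  have hiter : ∀ k s, Relation.ReflTransGen (Step E) s (f^[k] s) := by
    intro k
    induction k with
    | zero => intro s; exact .refl
    | succ k ih => intro s; exact .head (hstep s) (ih (f s))
  let π : Equiv.Perm (V × Gen) := Equiv.ofBijective f (Finite.injective_iff_bijective.1 hinj)
  obtain ⟨k, hk⟩ : ∃ k, orderOf π = k + 1 := ⟨orderOf π - 1, by have := orderOf_pos π; omega⟩
  have h1 : f^[k + 1] (p, x) = (p, x) := by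
    have h2 : (π ^ (k + 1)) (p, x) = (p, x) := by rw [← hk, pow_orderOf_eq_one]; rfl
    rwa [← Equiv.Perm.iterate_eq_pow] at h2
  rw [Function.iterate_succ_apply, hfp] at h1
  have := hiter k (q, x.other)
  rwa [h1] at this

/-- This differs from walking backwards, which exchanges the types of the two ends (`reach_flip`).
Here each step is undone by an alternating walk that closes it up. -/
lemma Good.reach_symm [Finite V] (hE : Good E) (hF : Full E) {s t : V × Gen}
    (h : Relation.ReflTransGen (Step E) s t) : Relation.ReflTransGen (Step E) t s := by
  induction h with
  | refl => exact .refl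
  | @tail t u _ h1 ih =>
    refine .trans ?_ ih
    rcases t with ⟨p, x⟩
    rcases u with ⟨q, y⟩
    obtain ⟨h2, h1⟩ := h1
    dsimp only at h2 h1
    subst h2
    rcases h1 with h1 | h1
    · exact hE.exists_return_of_edge hF h1
    · rw [← step_rev]
      exact hE.rev.exists_return_of_edge hF.rev h1

lemma reach_flip {s t : V × Gen} (h : Relation.ReflTransGen (Step E) s t) :
    Relation.ReflTransGen (Step E) (t.1, t.2.other) (s.1, s.2.other) := by
  induction h with
  | refl => exact .refl
  | @tail t u _ h1 ih =>
    refine .head ⟨?_, ?_⟩ ih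
    · simp [h1.1]
    · rw [h1.1, Gen.other_other]; exact h1.2.symm

/-- Combining `reach_flip` with `Good.reach_symm` changes both the initial and the final type of an
alternating walk. So the type required at the end never obstructs extending a walk along the next
edge of a connecting path. -/
lemma Good.exists_reach [Finite V] (hE : Good E) (hF : Full E) (hC : Conn E) (v p : V) (x : Gen) :
    ∃ y, Relation.ReflTransGen (Step E) (v, y) (p, x) := by
  have hflip : ∀ {p x}, (∃ y, Relation.ReflTransGen (Step E) (v, y) (p, x)) →
      ∃ y, Relation.ReflTransGen (Step E) (v, y) (p, x.other) := by
    rintro p x ⟨y, h⟩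
    exact ⟨y.other, hE.reach_symm hF (reach_flip h)⟩
  have hall : ∀ {p x}, (∃ y, Relation.ReflTransGen (Step E) (v, y) (p, x)) →
      ∀ z, ∃ y, Relation.ReflTransGen (Step E) (v, y) (p, z) := by
    intro p x h z
    by_cases hz : z = x
    · exact hz ▸ h
    · rw [Gen.eq_other_of_ne hz]; exact hflip h
  revert x
  induction hC v p with
  | refl => exact fun x => ⟨x, .refl⟩
  | @tail q r _ h1 ih =>
    obtain ⟨z, hz⟩ := h1
    refine hall (x := z.other) ?_
    obtain ⟨y, hy⟩ := ih z
    exact ⟨y, hy.tail ⟨rfl, hz⟩⟩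

lemma exists_alt_of_reach {s t : V × Gen} (h : Relation.ReflTransGen (Step E) s t) :
    ∃ w, Alt s.2 w t.2 ∧ Reads E w s.1 t.1 := by
  induction h with
  | refl => exact ⟨[], rfl, rfl⟩
  | @tail t u _ h1 ih =>
    obtain ⟨w, hw, hr⟩ := ih
    obtain ⟨l, hl, hl'⟩ : ∃ l : Letter, l.1 = t.2 ∧ LStep E l t.1 u.1 := by
      rcases h1.2 with h2 | h2
      · exact ⟨(t.2, true), rfl, by simpa using h2⟩
      · exact ⟨(t.2, false), rfl, by simpa using h2⟩
    refine ⟨w ++ [l], hw.append ⟨hl, h1.1.symm⟩, reads_append.2 ⟨_, hr, reads_singleton.2 hl'⟩⟩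

lemma reach_of_alt {w : Word} {x y : Gen} {p q : V} (h : Alt x w y) (hr : Reads E w p q) :
    Relation.ReflTransGen (Step E) (p, x) (q, y) := by
  induction w generalizing x p with
  | nil => cases h; cases hr; exact .refl
  | cons l w ih =>
    obtain ⟨r, h1, h2⟩ := hr
    obtain ⟨rfl, h⟩ := h
    refine .head ⟨rfl, ?_⟩ (ih h h2)
    rcases l with ⟨x, _ | _⟩
    · right; simpa using h1
    · left; simpa using h1

end Paths

/-! ### A graph is the Stallings graph of the group of its loops. -/

section Cosets

variable {H : Subgroup PSL2Z}

lemma coset_eq_iff {g h : PSL2Z} : coset H g = coset H h ↔ h * g⁻¹ ∈ H := by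
  unfold coset
  rw [Quotient.eq, QuotientGroup.rightRel_apply]

lemma coset_mul_right {g h : PSL2Z} (k : PSL2Z) (e : coset H g = coset H h) :
    coset H (g * k) = coset H (h * k) := by
  rw [coset_eq_iff] at e ⊢
  simpa [mul_assoc] using e

lemma coset_eq_one_iff {g : PSL2Z} : coset H g = coset H 1 ↔ g ∈ H := by
  rw [coset_eq_iff, one_mul, inv_mem_iff]

lemma isGeodesicLoop_iff {w : Word} : IsGeodesicLoop H w ↔ Reduced w ∧ wordVal w ∈ H := by
  rw [IsGeodesicLoop, isGeodesic_iff_reduced]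

lemma root_mem_stallingsGraph (H : Subgroup PSL2Z) : coset H 1 ∈ (stallingsGraph H).verts :=
  ⟨[], [], isGeodesicLoop_iff.2 ⟨reduced_nil, one_mem H⟩, rfl⟩

lemma coset_of_stallings_edge {x : Gen} {p q : RightCoset H} (h : (stallingsGraph H).edge x p q) :
    ∃ g, p = coset H g ∧ q = coset H (g * genVal x) := by
  rcases h with ⟨u, v, -, hp, hq⟩ | ⟨u, v, -, hq, hp⟩
  · exact ⟨_, hp, hq⟩
  · exact ⟨_, hp, by simpa using hq⟩

/-- The Stallings graph is a subgraph of the Schreier graph, where reading a word is right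
multiplication by its value. -/
lemma coset_of_reads {w : Word} {q : RightCoset H} {g : PSL2Z}
    (h : Reads (stallingsGraph H).edge w (coset H g) q) : q = coset H (g * wordVal w) := by
  induction w generalizing g with
  | nil => simpa [Reads] using h.symm
  | cons l w ih =>
    obtain ⟨r, h1, h2⟩ := h
    have hr : r = coset H (g * letterVal l) := by
      rcases l with ⟨x, _ | _⟩
      · obtain ⟨k, hk1, hk2⟩ := coset_of_stallings_edge ((lStep_false _ _ _ _).1 h1)
        rw [hk1]
        simpa [letterVal] using (coset_mul_right (genVal x)⁻¹ hk2).symm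
      · obtain ⟨k, hk1, hk2⟩ := coset_of_stallings_edge ((lStep_true _ _ _ _).1 h1)
        rw [hk2]
        exact (coset_mul_right (genVal x) hk1).symm
    subst hr
    rw [ih h2, wordVal_cons, mul_assoc]

lemma reads_stallings {u v : Word} (h : IsGeodesicLoop H (u ++ v)) :
    Reads (stallingsGraph H).edge v (coset H (wordVal u)) (coset H (wordVal (u ++ v))) := by
  induction v generalizing u with
  | nil => simp [Reads]
  | cons l v ih =>
    refine ⟨coset H (wordVal (u ++ [l])), ?_, ?_⟩
    · rcases l with ⟨x, _ | _⟩
      · rw [lStep_false]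
        exact Or.inr ⟨u, v, h, rfl, by simp [letterVal]⟩
      · rw [lStep_true]
        exact Or.inl ⟨u, v, h, rfl, by simp [letterVal]⟩
    · have := ih (u := u ++ [l]) (by simpa using h)
      simpa using this

/-- A map identifies the edges `E` on `V`, rooted at `v`, with the Stallings graph of `H`. -/
structure IsStallings {V : Type*} (E : Gen → V → V → Prop) (v : V) (H : Subgroup PSL2Z)
    (e : V → RightCoset H) : Prop where
  inj : Function.Injective e
  range : Set.range e = (stallingsGraph H).verts
  root : e v = coset H 1
  edge : ∀ x p q, (stallingsGraph H).edge x (e p) (e q) ↔ E x p q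

variable {V : Type*} {E : Gen → V → V → Prop} {v : V} {e : V → RightCoset H}

lemma IsStallings.reads (h : IsStallings E v H e) {w : Word} {p : V} {c : RightCoset H} :
    Reads (stallingsGraph H).edge w (e p) c ↔ ∃ q, e q = c ∧ Reads E w p q := by
  have hl : ∀ l p q, LStep (stallingsGraph H).edge l (e p) (e q) ↔ LStep E l p q := by
    rintro ⟨x, _ | _⟩ p q <;> simp [h.edge]
  induction w generalizing p with
  | nil =>
    constructor
    · rintro rfl; exact ⟨p, rfl, rfl⟩
    · rintro ⟨q, rfl, rfl⟩; rfl
  | cons l w ih =>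
    constructor
    · rintro ⟨r, h1, h2⟩
      have hr : r ∈ (stallingsGraph H).verts := by
        rcases l with ⟨x, _ | _⟩
        · exact (stallingsGraph H).source_mem ((lStep_false _ _ _ _).1 h1)
        · exact (stallingsGraph H).target_mem ((lStep_true _ _ _ _).1 h1)
      rw [← h.range] at hr
      obtain ⟨r, rfl⟩ := hr
      obtain ⟨q, hq, hr⟩ := ih.1 h2
      exact ⟨q, hq, r, (hl _ _ _).1 h1, hr⟩
    · rintro ⟨q, hq, r, h1, h2⟩
      exact ⟨e r, (hl _ _ _).2 h1, ih.2 ⟨q, hq, h2⟩⟩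

/-- A loop at the root fixes the coset `H`, so its value lies in `H`. Conversely an element of `H`
has a reduced, hence geodesic, representative, whose loop is in the Stallings graph by construction.
-/
lemma IsStallings.loopSubgroup_eq (h : IsStallings E v H e) : loopSubgroup E v = H := by
  ext g
  rw [mem_loopSubgroup]
  constructor
  · rintro ⟨w, rfl, hw⟩
    have h1 : Reads (stallingsGraph H).edge w (e v) (e v) := h.reads.2 ⟨v, rfl, hw⟩
    rw [h.root] at h1
    have h2 := coset_of_reads h1
    rw [one_mul] at h2
    exact coset_eq_one_iff.1 h2.symm
  · intro hg
    obtain ⟨w, rfl⟩ := exists_wordVal_eq g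
    obtain ⟨w', h1, h2, -⟩ := exists_reduced_wordVal w
    have hloop : IsGeodesicLoop H ([] ++ w') := isGeodesicLoop_iff.2 ⟨h1, by simpa [h2] using hg⟩
    have h3 := reads_stallings hloop
    have h4 : coset H (wordVal ([] ++ w')) = e v := by
      rw [h.root]; exact coset_eq_one_iff.2 hloop.2
    rw [h4, wordVal_nil, ← h.root, h.reads] at h3
    obtain ⟨q, hq, hr⟩ := h3
    obtain rfl := h.inj hq
    exact ⟨w', h2, hr⟩

lemma IsStallings.coset_eq (h : IsStallings E v H e) {g : PSL2Z} {p : V} (hp : Path E g v p) :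
    e p = coset H g := by
  obtain ⟨w, rfl, hw⟩ := hp
  have h1 : Reads (stallingsGraph H).edge w (e v) (e p) := h.reads.2 ⟨p, rfl, hw⟩
  rw [h.root] at h1
  simpa using coset_of_reads h1

/-- A finite connected structure is the Stallings graph of the group of its loops. -/
theorem Good.exists_isStallings [Finite V] (hE : Good E) (hF : Full E) (hC : Conn E) (v : V) :
    ∃ e, IsStallings E v (loopSubgroup E v) e := by
  choose g hg using hC.exists_path v
  set H := loopSubgroup E v
  have hcos : ∀ {k p}, Path E k v p → coset H (g p) = coset H k := fun {k p} hk =>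
    coset_eq_iff.2 (mem_loopSubgroup.2 (hk.mul (hg p).inv))
  have hinj : ∀ {k k' p q}, Path E k v p → Path E k' v q → coset H k = coset H k' → p = q := by
    intro k k' p q hk hk' h
    rw [coset_eq_iff, mem_loopSubgroup] at h
    have h2 := h.mul hk
    simp only [inv_mul_cancel_right] at h2
    exact h2.eq hE hk'
  -- A geodesic representative is reduced, so it can be read in `E` even if membership in the group
  -- of loops was witnessed by another word.
  have hread : ∀ {u w}, IsGeodesicLoop H (u ++ w) →
      ∃ p, Reads E u v p ∧ Reads E w p v := by
    intro u w h
    rw [isGeodesicLoop_iff] at h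
    obtain ⟨w', h1, h2⟩ := h.2
    exact reads_append.1 (hE.reads_of_reduced h2 h.1 h1)
  -- Any alternating walk from `v` extends to an alternating loop at `v`, by symmetry of alternating
  -- reachability. This is where finiteness and fullness enter.
  have hext : ∀ {u p y x}, Alt y u x → Reads E u v p → ∃ w, Alt x w y ∧ Reads E w p v := by
    intro u p y x h1 h2
    exact exists_alt_of_reach (hE.reach_symm hF (reach_of_alt h1 h2))
  have hloop : ∀ {u w p x y}, Alt y u x → Reads E u v p → Alt x w y → Reads E w p v →
      IsGeodesicLoop H (u ++ w) := fun h1 h2 h3 h4 =>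
    isGeodesicLoop_iff.2 ⟨⟨_, _, h1.append h3⟩, _, rfl, reads_append.2 ⟨_, h2, h4⟩⟩
  have hexist : ∀ p x, ∃ y u, Alt y u x ∧ Reads E u v p := by
    intro p x
    obtain ⟨y, hy⟩ := hE.exists_reach hF hC v p x
    obtain ⟨u, hu⟩ := exists_alt_of_reach hy
    exact ⟨y, u, hu⟩
  refine ⟨fun p => coset H (g p), fun p q h => hinj (hg p) (hg q) h, ?_, hcos (Path.refl E v), ?_⟩
  · ext c
    constructor
    · rintro ⟨p, rfl⟩
      obtain ⟨y, u, h1, h2⟩ := hexist p Gen.a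
      obtain ⟨w, h3, h4⟩ := hext h1 h2
      exact ⟨u, w, hloop h1 h2 h3 h4, hcos ⟨u, rfl, h2⟩⟩
    · rintro ⟨u, w, h, rfl⟩
      obtain ⟨p, hp, -⟩ := hread h
      exact ⟨p, hcos ⟨u, rfl, hp⟩⟩
  · intro x p q
    constructor
    · rintro (⟨u, w, h, hp, hq⟩ | ⟨u, w, h, hq, hp⟩)
      · obtain ⟨p', h1, q', h2, -⟩ := hread h
        rw [lStep_true] at h2
        obtain rfl := hinj (hg p) ⟨u, rfl, h1⟩ hp
        obtain rfl := hinj (hg q) (Path.mul ⟨u, rfl, h1⟩ (Path.of_edge h2)) hq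
        exact h2
      · obtain ⟨q', h1, p', h2, -⟩ := hread h
        rw [lStep_false] at h2
        obtain rfl := hinj (hg q) ⟨u, rfl, h1⟩ hq
        obtain rfl := hinj (hg p) (Path.mul ⟨u, rfl, h1⟩ (Path.of_edge h2).inv) hp
        exact h2
    · intro h
      -- The walk to `p` is chosen so that its next letter has type `x`. The given edge then
      -- continues it without breaking the alternation.
      obtain ⟨y, u, h1, h2⟩ := hexist p x
      have h1' : Alt y (u ++ [(x, true)]) x.other := h1.append ⟨rfl, rfl⟩
      have h2' : Reads E (u ++ [(x, true)]) v q :=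
        reads_append.2 ⟨p, h2, reads_singleton.2 ((lStep_true _ _ _ _).2 h)⟩
      obtain ⟨w, h3, h4⟩ := hext h1' h2'
      refine Or.inl ⟨u, w, ?_, hcos ⟨u, rfl, h2⟩, ?_⟩
      · simpa using hloop h1' h2' h3 h4
      · exact hcos (Path.mul ⟨u, rfl, h2⟩ (Path.of_edge h))

end Cosets

/-! ### From subgroups to labeled connected structures. -/

section Stallings

variable {V : Type*} {E : Gen → V → V → Prop} {v : V} {H : Subgroup PSL2Z} {e : V → RightCoset H}

lemma IsStallings.exists_of_edge (h : IsStallings E v H e) {x : Gen} {c d : RightCoset H}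
    (hcd : (stallingsGraph H).edge x c d) : ∃ p q, e p = c ∧ e q = d ∧ E x p q := by
  have hc := (stallingsGraph H).source_mem hcd
  have hd := (stallingsGraph H).target_mem hcd
  rw [← h.range] at hc hd
  obtain ⟨p, rfl⟩ := hc
  obtain ⟨q, rfl⟩ := hd
  exact ⟨p, q, rfl, rfl, (h.edge _ _ _).1 hcd⟩

lemma IsStallings.isCyclicallyReduced [Finite V] (h : IsStallings E v H e) (hE : Good E)
    (hF : Full E) (hC : Conn E) : (stallingsGraph H).IsCyclicallyReduced := by
  intro c hc
  refine ⟨?_, hc, ?_, ⟨?_, ?_⟩, ?_, ?_, ?_⟩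
  · rw [← h.range]; exact Set.finite_range e
  · intro p hp q hq
    rw [← h.range] at hp hq
    obtain ⟨p, rfl⟩ := hp
    obtain ⟨q, rfl⟩ := hq
    refine Relation.ReflTransGen.lift e (fun a b hab => ?_) _ _ (hC p q)
    obtain ⟨x, hx⟩ := hab
    exact ⟨x, by simpa only [h.edge] using hx⟩
  · intro x c d d' h1 h2
    obtain ⟨p, q, rfl, rfl, h3⟩ := h.exists_of_edge h1
    obtain ⟨p', q', h4, rfl, h5⟩ := h.exists_of_edge h2
    obtain rfl := h.inj h4
    rw [hE.det h3 h5]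
  · intro x c d d' h1 h2
    obtain ⟨p, q, rfl, rfl, h3⟩ := h.exists_of_edge h1
    obtain ⟨p', q', rfl, h4, h5⟩ := h.exists_of_edge h2
    obtain rfl := h.inj h4
    rw [hE.codet h3 h5]
  · intro c d h1
    obtain ⟨p, q, rfl, rfl, h3⟩ := h.exists_of_edge h1
    exact (h.edge _ _ _).2 (hE.a_symm h3)
  · intro c d d' h1 h2
    obtain ⟨p, q, rfl, rfl, h3⟩ := h.exists_of_edge h1
    obtain ⟨p', q', h4, rfl, h5⟩ := h.exists_of_edge h2
    obtain rfl := h.inj h4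
    exact (h.edge _ _ _).2 (hE.b_triangle h3 h5)
  · intro d hd _ x
    rw [← h.range] at hd
    obtain ⟨p, rfl⟩ := hd
    obtain ⟨q, hq⟩ := hF x p
    exact ⟨e q, by simpa only [h.edge] using hq⟩

/-- The group of the loops of a structure on `n` points is in `𝒮ₙ`. -/
lemma loopSubgroup_mem [Fintype V] (hE : Good E) (hF : Full E) (hC : Conn E) (v : V) :
    loopSubgroup E v ∈ cyclicallyReducedSubgroups (Fintype.card V) := by
  obtain ⟨e, he⟩ := hE.exists_isStallings hF hC v
  refine ⟨loopSubgroup_fg hC v, ?_, ?_, he.isCyclicallyReduced hE hF hC⟩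
  · rw [← he.range]; exact Set.finite_range e
  · rw [← he.range, ← Set.image_univ, Set.ncard_image_of_injective _ he.inj, Set.ncard_univ,
      Nat.card_eq_fintype_card]

-- Numberings send `0` to the base coset, so that the subgroup is recovered as the group of the
-- loops at `0`.
open Classical in
lemma exists_numbering {n : ℕ} [NeZero n] (hH : H ∈ cyclicallyReducedSubgroups n) :
    ∃ e : Fin n → RightCoset H, Function.Injective e ∧
      Set.range e = (stallingsGraph H).verts ∧ e 0 = coset H 1 := by
  obtain ⟨-, hfin, hcard, -⟩ := hH
  have := hfin.fintype
  have hc : Fintype.card (stallingsGraph H).verts = n := by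
    rw [← hcard, Set.ncard_eq_toFinset_card', Set.toFinset_card]
  let e := (Fintype.equivFinOfCardEq hc).symm
  let r : (stallingsGraph H).verts := ⟨coset H 1, root_mem_stallingsGraph H⟩
  let e' : Fin n ≃ (stallingsGraph H).verts := e.trans (Equiv.swap (e 0) r)
  refine ⟨fun i => e' i, Subtype.val_injective.comp e'.injective, ?_, ?_⟩
  · rw [Set.range_comp' Subtype.val, e'.range_eq_univ]; simp
  · simp [e', r]

/-- The graph on `V` obtained from the Stallings graph by pulling back. -/
def pullback (e : V → RightCoset H) : Gen → V → V → Prop :=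
  fun x p q => (stallingsGraph H).edge x (e p) (e q)

lemma isStallings_pullback (hinj : Function.Injective e)
    (hrange : Set.range e = (stallingsGraph H).verts) (hroot : e v = coset H 1) :
    IsStallings (pullback e) v H e := ⟨hinj, hrange, hroot, fun _ _ _ => Iff.rfl⟩

lemma IsStallings.good (h : IsStallings E v H e) (hr : (stallingsGraph H).IsReduced (coset H 1)) :
    Good E where
  det h1 h2 := h.inj (hr.freelyReduced.1 _ _ _ _ ((h.edge _ _ _).2 h1) ((h.edge _ _ _).2 h2))
  codet h1 h2 := h.inj (hr.freelyReduced.2 _ _ _ _ ((h.edge _ _ _).2 h1) ((h.edge _ _ _).2 h2))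
  a_symm h1 := (h.edge _ _ _).1 (hr.a_symm _ _ ((h.edge _ _ _).2 h1))
  b_triangle h1 h2 := (h.edge _ _ _).1
    (hr.b_triangle _ _ _ ((h.edge _ _ _).2 h1) ((h.edge _ _ _).2 h2))

lemma IsStallings.conn (h : IsStallings E v H e) (hr : (stallingsGraph H).IsReduced (coset H 1)) :
    Conn E := by
  intro p q
  have hmem : ∀ p, e p ∈ (stallingsGraph H).verts := fun p => h.range ▸ Set.mem_range_self p
  have key : ∀ c, Relation.ReflTransGen
      (fun s t => ∃ x, (stallingsGraph H).edge x s t ∨ (stallingsGraph H).edge x t s) (e p) c →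
      ∃ q, e q = c ∧ Relation.ReflTransGen (Adj E) p q := by
    intro c hc
    induction hc with
    | refl => exact ⟨p, rfl, .refl⟩
    | @tail c d _ h1 ih =>
      obtain ⟨q, rfl, hq⟩ := ih
      obtain ⟨x, h1 | h1⟩ := h1
      · obtain ⟨q', r, h2, rfl, h3⟩ := h.exists_of_edge h1
        obtain rfl := h.inj h2
        exact ⟨r, rfl, hq.tail ⟨x, Or.inl h3⟩⟩
      · obtain ⟨r, q', rfl, h2, h3⟩ := h.exists_of_edge h1
        obtain rfl := h.inj h2
        exact ⟨r, rfl, hq.tail ⟨x, Or.inr h3⟩⟩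
  obtain ⟨q', h1, h2⟩ := key _ (hr.connected _ (hmem p) _ (hmem q))
  obtain rfl := h.inj h1
  exact h2

/-- The reducedness condition exempts the base vertex, so for each `p` it is applied with another
vertex as base. With a single vertex nothing would be imposed, which is why the averages are
compared only for `n ≥ 2`. -/
lemma IsStallings.full [Nontrivial V] (h : IsStallings E v H e)
    (hr : (stallingsGraph H).IsCyclicallyReduced) : Full E := by
  intro x p
  have hmem : ∀ p, e p ∈ (stallingsGraph H).verts := fun p => h.range ▸ Set.mem_range_self p
  obtain ⟨q, hq⟩ := exists_ne p
  obtain ⟨c, hc⟩ := (hr _ (hmem q)).touches _ (hmem p) (fun h1 => hq (h.inj h1).symm) x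
  rcases hc with hc | hc
  · obtain ⟨p', q', h1, -, h2⟩ := h.exists_of_edge hc
    obtain rfl := h.inj h1
    exact ⟨q', Or.inl h2⟩
  · obtain ⟨q', p', -, h1, h2⟩ := h.exists_of_edge hc
    obtain rfl := h.inj h1
    exact ⟨q', Or.inr h2⟩

lemma exists_isStallings_of_mem {n : ℕ} [NeZero n] (hH : H ∈ cyclicallyReducedSubgroups n) :
    ∃ (E : Gen → Fin n → Fin n → Prop) (e : Fin n → RightCoset H),
      IsStallings E 0 H e ∧ Good E ∧ Conn E := by
  obtain ⟨e, h1, h2, h3⟩ := exists_numbering hH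
  have h := isStallings_pullback h1 h2 h3
  have hr := hH.2.2.2 _ (root_mem_stallingsGraph H)
  exact ⟨_, e, h, h.good hr, h.conn hr⟩

lemma finite_cyclicallyReducedSubgroups {n : ℕ} (hn : 1 ≤ n) :
    (cyclicallyReducedSubgroups n).Finite := by
  have : NeZero n := ⟨by omega⟩
  refine (Set.finite_range fun E : Gen → Fin n → Fin n → Prop => loopSubgroup E 0).subset ?_
  intro H hH
  obtain ⟨E, e, h, -, -⟩ := exists_isStallings_of_mem hH
  exact ⟨E, h.loopSubgroup_eq⟩

open Classical in
/-- The connected structures on a finite set. -/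
def connStructures (V : Type*) [Fintype V] : Finset (Gen → V → V → Prop) :=
  Finset.univ.filter fun E => Good E ∧ Full E ∧ Conn E

lemma mem_connStructures [Fintype V] : E ∈ connStructures V ↔ Good E ∧ Full E ∧ Conn E := by
  simp [connStructures]

-- The structures giving `H` are the numberings of its Stallings graph that fix the root. Distinct
-- numberings give distinct structures, since a vertex is determined by any element labeling a path
-- to it from the root: a rooted graph has no nontrivial automorphism.
open Classical in
lemma card_fiber {n : ℕ} (hn : 2 ≤ n) [NeZero n] (hH : H ∈ cyclicallyReducedSubgroups n) :
    ((connStructures (Fin n)).filter fun E => loopSubgroup E 0 = H).card =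
      Fintype.card {σ : Equiv.Perm (Fin n) // σ 0 = 0} := by
  have : Nontrivial (Fin n) := Fin.nontrivial_iff_two_le.2 hn
  obtain ⟨e, h1, h2, h3⟩ := exists_numbering hH
  have hr := hH.2.2.2 _ (root_mem_stallingsGraph H)
  have hσ : ∀ σ : {σ : Equiv.Perm (Fin n) // σ 0 = 0},
      IsStallings (pullback (e ∘ σ.1)) 0 H (e ∘ σ.1) := fun σ =>
    isStallings_pullback (h1.comp σ.1.injective)
      (by rw [Set.range_comp, σ.1.range_eq_univ, Set.image_univ, h2])
      (by simp [σ.2, h3])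
  rw [← Finset.card_univ]
  symm
  refine Finset.card_bij (fun σ _ => pullback (e ∘ σ.1)) ?_ ?_ ?_
  · intro σ _
    rw [Finset.mem_filter, mem_connStructures]
    exact ⟨⟨(hσ σ).good hr, (hσ σ).full hH.2.2.2, (hσ σ).conn hr⟩, (hσ σ).loopSubgroup_eq⟩
  · intro σ _ τ _ h
    apply Subtype.ext
    ext1 p
    obtain ⟨g, hg⟩ := ((hσ σ).conn hr).exists_path 0 p
    have h4 := (hσ σ).coset_eq hg
    rw [h] at hg
    have h5 := (hσ τ).coset_eq hg
    exact h1 (h4.trans h5.symm)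
  · intro E hE
    rw [Finset.mem_filter, mem_connStructures] at hE
    obtain ⟨⟨hG, hF, hC⟩, rfl⟩ := hE
    obtain ⟨e', he'⟩ := hG.exists_isStallings hF hC 0
    have hex : ∀ p, ∃ q, e q = e' p := fun p => by
      have : e' p ∈ Set.range e := by rw [h2, ← he'.range]; exact Set.mem_range_self p
      exact this
    choose s hs using hex
    have hsinj : Function.Injective s := fun p q hpq => he'.inj (by rw [← hs, ← hs, hpq])
    refine ⟨⟨Equiv.ofBijective s (Finite.injective_iff_bijective.1 hsinj), ?_⟩,
      Finset.mem_univ _, ?_⟩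
    · exact h1 (by rw [Equiv.ofBijective_apply, hs, he'.root, h3])
    · funext x p q
      simp only [pullback, Function.comp_apply, Equiv.ofBijective_apply, hs]
      exact propext (he'.edge x p q)

/-- The expected value of `f` on `𝒮ₙ` is an average over the connected structures. -/
theorem expectedValue_eq {n : ℕ} (hn : 2 ≤ n) [NeZero n] (f : Subgroup PSL2Z → ℕ) :
    expectedValue n f = (∑ E ∈ connStructures (Fin n), (f (loopSubgroup E 0) : ℝ)) /
      ((connStructures (Fin n)).card : ℝ) := by
  classical
  have : Nontrivial (Fin n) := Fin.nontrivial_iff_two_le.2 hn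
  set Φ : (Gen → Fin n → Fin n → Prop) → Subgroup PSL2Z := fun E => loopSubgroup E 0 with hΦ
  have hS : cyclicallyReducedSubgroups n = ↑((connStructures (Fin n)).image Φ) := by
    ext H
    rw [Finset.coe_image, Set.mem_image]
    constructor
    · intro hH
      obtain ⟨E, e, h, h1, h2⟩ := exists_isStallings_of_mem hH
      exact ⟨E, mem_connStructures.2 ⟨h1, h.full hH.2.2.2, h2⟩, h.loopSubgroup_eq⟩
    · rintro ⟨E, hE, rfl⟩
      obtain ⟨h1, h2, h3⟩ := mem_connStructures.1 hE
      simpa using loopSubgroup_mem h1 h2 h3 (0 : Fin n)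
  -- All fibers of the map from structures to subgroups have this size, which therefore cancels in
  -- the quotient.
  set c := Fintype.card {σ : Equiv.Perm (Fin n) // σ 0 = 0} with hc
  have hc0 : (c : ℝ) ≠ 0 := by
    have : Nonempty {σ : Equiv.Perm (Fin n) // σ 0 = 0} := ⟨⟨1, rfl⟩⟩
    exact_mod_cast Fintype.card_ne_zero
  have hfib : ∀ H ∈ (connStructures (Fin n)).image Φ,
      ((connStructures (Fin n)).filter fun E => Φ E = H).card = c := fun H hH =>
    card_fiber hn (hS ▸ Finset.mem_coe.2 hH)
  have hsum : ∑ E ∈ connStructures (Fin n), (f (Φ E) : ℝ) =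
      c * ∑ H ∈ (connStructures (Fin n)).image Φ, (f H : ℝ) := by
    rw [Finset.sum_comp (fun H => (f H : ℝ)) Φ, Finset.mul_sum]
    exact Finset.sum_congr rfl fun H hH => by rw [hfib H hH, nsmul_eq_mul]
  have hcard : ((connStructures (Fin n)).card : ℝ) =
      c * ((connStructures (Fin n)).image Φ).card := by
    rw [Finset.card_eq_sum_card_image Φ, Finset.sum_congr rfl hfib]
    simp [mul_comm]
  rw [hsum, hcard, mul_div_mul_left _ _ hc0, expectedValue, hS, finsum_mem_coe_finset,
    Set.ncard_coe_finset]

/-- A structure on a segment: `a` matches `2i` with `2i+1`, and `b`-edges join `2i+1` to `2i+2`. -/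
def segment (n : ℕ) : Gen → Fin n → Fin n → Prop
  | Gen.a => fun p q => p.1 / 2 = q.1 / 2 ∧ (p.1 ≠ q.1 ∨ p.1 % 2 = 0 ∧ p.1 + 1 = n)
  | Gen.b => fun p q => (p.1 = q.1 ∧ (p.1 = 0 ∨ p.1 % 2 = 1 ∧ p.1 + 1 = n)) ∨
      (p.1 % 2 = 1 ∧ q.1 = p.1 + 1)

lemma segment_mem (n : ℕ) : segment n ∈ connStructures (Fin n) := by
  rw [mem_connStructures]
  refine ⟨⟨?_, ?_, ?_, ?_⟩, ?_, ?_⟩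
  · rintro (_ | _) p q r h1 h2 <;> simp only [segment, Fin.ext_iff] at h1 h2 ⊢ <;> omega
  · rintro (_ | _) p q r h1 h2 <;> simp only [segment, Fin.ext_iff] at h1 h2 ⊢ <;> omega
  · rintro p q h1; simp only [segment] at h1 ⊢; omega
  · rintro p q r h1 h2; simp only [segment] at h1 h2 ⊢; omega
  · rintro (_ | _) ⟨p, hp⟩ <;> simp only [segment]
    · rcases Nat.mod_two_eq_zero_or_one p with h | h
      · by_cases h' : p + 1 = n
        · exact ⟨⟨p, hp⟩, by dsimp only; omega⟩
        · exact ⟨⟨p + 1, by omega⟩, by dsimp only; omega⟩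
      · exact ⟨⟨p - 1, by omega⟩, by dsimp only; omega⟩
    · rcases Nat.mod_two_eq_zero_or_one p with h | h
      · by_cases h' : p = 0
        · exact ⟨⟨p, hp⟩, by dsimp only; omega⟩
        · exact ⟨⟨p - 1, by omega⟩, by dsimp only; omega⟩
      · by_cases h' : p + 1 = n
        · exact ⟨⟨p, hp⟩, by dsimp only; omega⟩
        · exact ⟨⟨p + 1, by omega⟩, by dsimp only; omega⟩
  · have hsymm : Std.Symm (Adj (segment n)) := ⟨by
      rintro p q ⟨x, h⟩; exact ⟨x, h.symm⟩⟩
    have key : ∀ k (hk : k < n), Relation.ReflTransGen (Adj (segment n)) ⟨0, by omega⟩ ⟨k, hk⟩ := by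
      intro k
      induction k with
      | zero => intro hk; exact .refl
      | succ k ih =>
        intro hk
        refine (ih (by omega)).tail ?_
        rcases Nat.mod_two_eq_zero_or_one k with h | h
        · exact ⟨Gen.a, Or.inl (by simp only [segment]; omega)⟩
        · exact ⟨Gen.b, Or.inl (Or.inr ⟨h, rfl⟩)⟩
    intro p q
    exact (Relation.ReflTransGen.stdSymm.symm _ _ (key p.1 p.2)).trans (key q.1 q.2)

lemma nonempty_cyclicallyReducedSubgroups {n : ℕ} (hn : 1 ≤ n) :
    (cyclicallyReducedSubgroups n).Nonempty := by
  have : NeZero n := ⟨by omega⟩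
  obtain ⟨h1, h2, h3⟩ := mem_connStructures.1 (segment_mem n)
  exact ⟨_, by simpa using loopSubgroup_mem h1 h2 h3 (0 : Fin n)⟩

end Stallings

/-! ### Free products of cyclic groups and uniqueness of the isomorphism type. -/

section FreeProduct

variable {K : Type*} [Group K]

/-- The homomorphism from the cyclic group of order `m` that maps the generator to `k`. -/
def cyclicHom (m : ℕ) (k : K) (hk : k ^ m = 1) : Multiplicative (ZMod m) →* K :=
  AddMonoidHom.toMultiplicativeLeft
    (ZMod.lift m ⟨zmultiplesHom (Additive K) (Additive.ofMul k), by
      simpa [← ofMul_pow] using hk⟩)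

@[simp] lemma cyclicHom_apply (m : ℕ) (k : K) (hk : k ^ m = 1) :
    cyclicHom m k hk (Multiplicative.ofAdd 1) = k := by
  have := ZMod.lift_coe m ⟨zmultiplesHom (Additive K) (Additive.ofMul k), by
      simpa [← ofMul_pow] using hk⟩ 1
  simp only [Int.cast_one] at this
  simp [cyclicHom, this]

lemma cyclicHom_ext {m : ℕ} {f g : Multiplicative (ZMod m) →* K}
    (h : f (Multiplicative.ofAdd 1) = g (Multiplicative.ofAdd 1)) : f = g := by
  refine MonoidHom.ext fun x => ?_
  obtain ⟨z, hz⟩ := ZMod.intCast_surjective (Multiplicative.toAdd x)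
  have hx : x = Multiplicative.ofAdd (1 : ZMod m) ^ z := by
    rw [← ofAdd_zsmul, zsmul_one, hz, ofAdd_toAdd]
  rw [hx, map_zpow, map_zpow, h]

variable {t : ℕ × ℕ × ℕ}

lemma isUnit_coprodI {m k : ℕ} (x : Monoid.CoprodI fun _ : Fin m => Multiplicative (ZMod k)) :
    IsUnit x := by
  induction x using Monoid.CoprodI.induction_on with
  | one => exact isUnit_one
  | of i y => exact (Group.isUnit y).map _
  | mul x y hx hy => exact hx.mul hy

/-- The free product is a monoid coproduct of groups. It is generated by units, which allows adding
inverses to its given multiplication without changing it. -/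
lemma isUnit_freeProduct (x : FreeProductOfType t) : IsUnit x := by
  induction x using Monoid.Coprod.induction_on with
  | inl x => exact (isUnit_coprodI x).map _
  | inr x =>
    refine IsUnit.map _ ?_
    induction x using Monoid.Coprod.induction_on with
    | inl x => exact (isUnit_coprodI x).map _
    | inr x => exact (Group.isUnit x).map _
    | mul x y hx hy => exact hx.mul hy
  | mul x y hx hy => exact hx.mul hy

instance : Group (FreeProductOfType t) where
  inv x := ((isUnit_freeProduct x).unit⁻¹ : (FreeProductOfType t)ˣ)
  inv_mul_cancel x := (isUnit_freeProduct x).val_inv_mul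

/-- The generators of order `2`. -/
def gen₂ (t : ℕ × ℕ × ℕ) (i : Fin t.1) : FreeProductOfType t :=
  Monoid.Coprod.inl (Monoid.CoprodI.of (M := fun _ : Fin t.1 => Multiplicative (ZMod 2)) (i := i)
    (Multiplicative.ofAdd 1))

/-- The generators of order `3`. -/
def gen₃ (t : ℕ × ℕ × ℕ) (i : Fin t.2.1) : FreeProductOfType t :=
  Monoid.Coprod.inr (Monoid.Coprod.inl (Monoid.CoprodI.of
    (M := fun _ : Fin t.2.1 => Multiplicative (ZMod 3)) (i := i) (Multiplicative.ofAdd 1)))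

/-- The free generators. -/
def genFree (t : ℕ × ℕ × ℕ) (i : Fin t.2.2) : FreeProductOfType t :=
  Monoid.Coprod.inr (Monoid.Coprod.inr (FreeGroup.of i))

lemma gen₂_sq (i : Fin t.1) : gen₂ t i ^ 2 = 1 := by
  rw [gen₂, ← map_pow, ← map_pow, ← ofAdd_nsmul]
  have : (2 : ℕ) • (1 : ZMod 2) = 0 := by decide
  rw [this, ofAdd_zero, map_one, map_one]

lemma gen₃_cube (i : Fin t.2.1) : gen₃ t i ^ 3 = 1 := by
  rw [gen₃, ← map_pow, ← map_pow, ← map_pow, ← ofAdd_nsmul]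
  have : (3 : ℕ) • (1 : ZMod 3) = 0 := by decide
  rw [this, ofAdd_zero, map_one, map_one, map_one]

lemma exists_lift (S : Fin t.1 → K) (U : Fin t.2.1 → K) (F : Fin t.2.2 → K)
    (hS : ∀ i, S i ^ 2 = 1) (hU : ∀ i, U i ^ 3 = 1) :
    ∃ f : FreeProductOfType t →* K,
      (∀ i, f (gen₂ t i) = S i) ∧ (∀ i, f (gen₃ t i) = U i) ∧ ∀ i, f (genFree t i) = F i := by
  refine ⟨Monoid.Coprod.lift (Monoid.CoprodI.lift fun i => cyclicHom 2 (S i) (hS i))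
    (Monoid.Coprod.lift (Monoid.CoprodI.lift fun i => cyclicHom 3 (U i) (hU i))
      (FreeGroup.lift F)), fun i => ?_, fun i => ?_, fun i => ?_⟩
  · simp [gen₂]
  · simp [gen₃]
  · simp [genFree]

lemma freeProduct_hom_ext {f g : FreeProductOfType t →* K}
    (h₂ : ∀ i, f (gen₂ t i) = g (gen₂ t i)) (h₃ : ∀ i, f (gen₃ t i) = g (gen₃ t i))
    (hF : ∀ i, f (genFree t i) = g (genFree t i)) : f = g := by
  refine Monoid.Coprod.hom_ext ?_ (Monoid.Coprod.hom_ext ?_ ?_)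
  · exact Monoid.CoprodI.ext_hom _ _ fun i => cyclicHom_ext (h₂ i)
  · exact Monoid.CoprodI.ext_hom _ _ fun i => cyclicHom_ext (h₃ i)
  · exact FreeGroup.ext_hom _ _ hF

/-- The universal property lifts the generators to a homomorphism into `R`. Its composite with the
inclusion fixes the generators, hence is the identity. -/
lemma eq_top_of_gen_mem {R : Subgroup (FreeProductOfType t)} (h₂ : ∀ i, gen₂ t i ∈ R)
    (h₃ : ∀ i, gen₃ t i ∈ R) (hF : ∀ i, genFree t i ∈ R) : R = ⊤ := by
  obtain ⟨f, hf₂, hf₃, hfF⟩ := exists_lift (K := R) (t := t) (fun i => ⟨_, h₂ i⟩)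
    (fun i => ⟨_, h₃ i⟩) (fun i => ⟨_, hF i⟩) (fun i => Subtype.ext (gen₂_sq i))
    (fun i => Subtype.ext (gen₃_cube i))
  have hid : R.subtype.comp f = MonoidHom.id _ :=
    freeProduct_hom_ext (fun i => by simp [hf₂]) (fun i => by simp [hf₃]) (fun i => by simp [hfF])
  rw [eq_top_iff]
  intro x _
  have : (f x : FreeProductOfType t) = x := DFunLike.congr_fun hid x
  exact this ▸ (f x).2

/-- Homomorphisms on the free product are determined by the images of the generators. -/
def homEquiv (t : ℕ × ℕ × ℕ) (K : Type*) [Group K] : (FreeProductOfType t →* K) ≃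
    (Fin t.1 → {k : K // k ^ 2 = 1}) × (Fin t.2.1 → {k : K // k ^ 3 = 1}) × (Fin t.2.2 → K) :=
  Equiv.ofBijective
    (fun f => (fun i => ⟨f (gen₂ t i), by rw [← map_pow, gen₂_sq, map_one]⟩,
      fun i => ⟨f (gen₃ t i), by rw [← map_pow, gen₃_cube, map_one]⟩, fun i => f (genFree t i)))
    ⟨fun f g h => by
      simp only [Prod.mk.injEq, funext_iff, Subtype.mk.injEq] at h
      exact freeProduct_hom_ext h.1 h.2.1 h.2.2, fun ⟨S, U, F⟩ => by
      obtain ⟨f, h₂, h₃, hF⟩ := exists_lift (t := t) (fun i => (S i).1) (fun i => (U i).1) F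
        (fun i => (S i).2) (fun i => (U i).2)
      exact ⟨f, Prod.ext (funext fun i => Subtype.ext (h₂ i))
        (Prod.ext (funext fun i => Subtype.ext (h₃ i)) (funext hF))⟩⟩

lemma card_hom (t : ℕ × ℕ × ℕ) (K : Type*) [Group K] : Nat.card (FreeProductOfType t →* K) =
    Nat.card {k : K // k ^ 2 = 1} ^ t.1 * (Nat.card {k : K // k ^ 3 = 1} ^ t.2.1 *
      Nat.card K ^ t.2.2) := by
  rw [Nat.card_congr (homEquiv t K)]
  simp [Nat.card_prod, Nat.card_pi]

/-- The numbers of homomorphisms to the cyclic groups of orders 2, 3 and 5 are `2^(ℓ₂ + r)`, `3^(ℓ₃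
+ r)` and `5^r`, and these determine the triple. -/
lemma HasIsoType.unique {H : Subgroup PSL2Z} {t t' : ℕ × ℕ × ℕ} (h : HasIsoType H t)
    (h' : HasIsoType H t') : t = t' := by
  obtain ⟨e⟩ := h
  obtain ⟨e'⟩ := h'
  have key : ∀ (K : Type) [Group K],
      Nat.card {k : K // k ^ 2 = 1} ^ t.1 * (Nat.card {k : K // k ^ 3 = 1} ^ t.2.1 *
        Nat.card K ^ t.2.2) =
      Nat.card {k : K // k ^ 2 = 1} ^ t'.1 * (Nat.card {k : K // k ^ 3 = 1} ^ t'.2.1 *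
        Nat.card K ^ t'.2.2) := by
    intro K _
    rw [← card_hom, ← card_hom]
    exact Nat.card_congr ((e.symm.trans e').monoidHomCongrLeftEquiv)
  have h2 := key (Multiplicative (ZMod 2))
  have h3 := key (Multiplicative (ZMod 3))
  have h5 := key (Multiplicative (ZMod 5))
  have c22 : Fintype.card {k : Multiplicative (ZMod 2) // k ^ 2 = 1} = 2 := by decide
  have c23 : Fintype.card {k : Multiplicative (ZMod 2) // k ^ 3 = 1} = 1 := by decide
  have c32 : Fintype.card {k : Multiplicative (ZMod 3) // k ^ 2 = 1} = 1 := by decide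
  have c33 : Fintype.card {k : Multiplicative (ZMod 3) // k ^ 3 = 1} = 3 := by decide
  have c52 : Fintype.card {k : Multiplicative (ZMod 5) // k ^ 2 = 1} = 1 := by decide
  have c53 : Fintype.card {k : Multiplicative (ZMod 5) // k ^ 3 = 1} = 1 := by decide
  have c2 : Fintype.card (Multiplicative (ZMod 2)) = 2 := by decide
  have c3 : Fintype.card (Multiplicative (ZMod 3)) = 3 := by decide
  have c5 : Fintype.card (Multiplicative (ZMod 5)) = 5 := by decide
  rw [Nat.card_eq_fintype_card, Nat.card_eq_fintype_card, Nat.card_eq_fintype_card] at h2 h3 h5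
  rw [c22, c23, c2, one_pow, one_mul, one_pow, one_mul, ← pow_add, ← pow_add] at h2
  rw [c32, c33, c3, one_pow, one_mul, one_pow, one_mul, ← pow_add, ← pow_add] at h3
  rw [c52, c53, c5, one_pow, one_mul, one_pow, one_mul, one_pow, one_mul, one_pow, one_mul] at h5
  have e2 := Nat.pow_right_injective le_rfl h2
  have e3 := Nat.pow_right_injective (by norm_num : 2 ≤ 3) h3
  have e5 := Nat.pow_right_injective (by norm_num : 2 ≤ 5) h5
  obtain ⟨a, b, c⟩ := t
  obtain ⟨a', b', c'⟩ := t'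
  simp only [Prod.mk.injEq] at *
  omega

lemma HasIsoType.isoType_eq {H : Subgroup PSL2Z} {t : ℕ × ℕ × ℕ} (h : HasIsoType H t) :
    isoType H = t := by
  have hex : ∃ t, HasIsoType H t := ⟨t, h⟩
  rw [isoType, dif_pos hex]
  exact hex.choose_spec.unique h

end FreeProduct

/-! ### Coverings by weighted edges. -/

section Cover

variable {V : Type*} {E : Gen → V → V → Prop} {P : Type*} [Group P] {c : Gen → V → V → P}

/-- The covering of a labeled graph given by weights on the edges. -/
def cover (E : Gen → V → V → Prop) (c : Gen → V → V → P) : Gen → P × V → P × V → Prop :=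
  fun x s t => E x s.2 t.2 ∧ t.1 = s.1 * c x s.2 t.2

/-- The weights have trivial product around the cycles imposed by `a² = 1` and `b³ = 1`, so these
cycles lift to cycles. -/
lemma good_cover (hE : Good E) (ha : ∀ p q, E Gen.a p q → c Gen.a p q * c Gen.a q p = 1)
    (hb : ∀ p q r, E Gen.b p q → E Gen.b q r →
      c Gen.b p q * c Gen.b q r * c Gen.b r p = 1) : Good (cover E c) where
  det := by
    rintro x ⟨k, p⟩ ⟨l, q⟩ ⟨m, r⟩ ⟨h1, h2⟩ ⟨h3, h4⟩
    dsimp only at *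
    obtain rfl := hE.det h1 h3
    rw [h2, h4]
  codet := by
    rintro x ⟨k, p⟩ ⟨l, q⟩ ⟨m, r⟩ ⟨h1, h2⟩ ⟨h3, h4⟩
    dsimp only at *
    obtain rfl := hE.codet h1 h3
    rw [mul_right_cancel (h2.symm.trans h4)]
  a_symm := by
    rintro ⟨k, p⟩ ⟨l, q⟩ ⟨h1, h2⟩
    dsimp only at *
    refine ⟨hE.a_symm h1, ?_⟩
    dsimp only
    rw [h2, mul_assoc, ha _ _ h1, mul_one]
  b_triangle := by
    rintro ⟨k, p⟩ ⟨l, q⟩ ⟨m, r⟩ ⟨h1, h2⟩ ⟨h3, h4⟩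
    dsimp only at *
    refine ⟨hE.b_triangle h1 h3, ?_⟩
    dsimp only
    rw [h4, h2, mul_assoc, mul_assoc, ← mul_assoc (c _ _ _), hb _ _ _ h1 h3, mul_one]

/-- Weights multiply on the right, so left translations are deck transformations. -/
lemma path_cover_mul_left {g : PSL2Z} {k l : P} {p q : V} (m : P)
    (h : Path (cover E c) g (k, p) (l, q)) : Path (cover E c) g (m * k, p) (m * l, q) := by
  obtain ⟨w, hw, h⟩ := h
  refine ⟨w, hw, ?_⟩
  clear hw
  induction w generalizing k p with
  | nil => cases h; rfl
  | cons y w ih =>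
    obtain ⟨⟨n, r⟩, h1, h2⟩ := h
    refine ⟨(m * n, r), ?_, ih h2⟩
    rcases y with ⟨x, _ | _⟩
    · rw [lStep_false] at h1 ⊢
      exact ⟨h1.1, by have := h1.2; dsimp only at this ⊢; rw [this, mul_assoc]⟩
    · rw [lStep_true] at h1 ⊢
      exact ⟨h1.1, by have := h1.2; dsimp only at this ⊢; rw [this, mul_assoc]⟩

lemma exists_path_cover {g : PSL2Z} {p q : V} (h : Path E g p q) (k : P) :
    ∃ l, Path (cover E c) g (k, p) (l, q) := by
  obtain ⟨w, hw, h⟩ := h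
  suffices h' : ∃ l, Reads (cover E c) w (k, p) (l, q) from h'.imp fun l hl => ⟨w, hw, hl⟩
  clear hw
  induction w generalizing k p with
  | nil => cases h; exact ⟨k, rfl⟩
  | cons y w ih =>
    obtain ⟨r, h1, h2⟩ := h
    rcases y with ⟨x, _ | _⟩
    · rw [lStep_false] at h1
      obtain ⟨l, hl⟩ := ih (k * (c x r p)⁻¹) h2
      exact ⟨l, _, (lStep_false _ _ _ _).2 ⟨h1, by simp⟩, hl⟩
    · rw [lStep_true] at h1
      obtain ⟨l, hl⟩ := ih (k * c x p r) h2
      exact ⟨l, _, (lStep_true _ _ _ _).2 ⟨h1, rfl⟩, hl⟩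

lemma path_of_path_cover {g : PSL2Z} {s t : P × V} (h : Path (cover E c) g s t) :
    Path E g s.2 t.2 := by
  obtain ⟨w, hw, h⟩ := h
  refine ⟨w, hw, ?_⟩
  clear hw
  induction w generalizing s with
  | nil => cases h; rfl
  | cons y w ih =>
    obtain ⟨r, h1, h2⟩ := h
    refine ⟨r.2, ?_, ih h2⟩
    rcases y with ⟨x, _ | _⟩
    · rw [lStep_false] at h1 ⊢; exact h1.1
    · rw [lStep_true] at h1 ⊢; exact h1.1

/-- The function `(k, p) ↦ ψ k * γ p` follows the group element read along a path of the cover. For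
loops at `v` with `γ v = 1`, it makes `ψ` a left inverse of the monodromy. -/
lemma map_mul_eq_of_path_cover (ψ : P →* PSL2Z) (γ : V → PSL2Z)
    (h : ∀ x p q, E x p q → ψ (c x p q) = γ p * genVal x * (γ q)⁻¹) {g : PSL2Z} {s t : P × V}
    (hst : Path (cover E c) g s t) : ψ s.1 * γ s.2 * g = ψ t.1 * γ t.2 := by
  obtain ⟨w, rfl, hst⟩ := hst
  induction w generalizing s with
  | nil => cases hst; simp
  | cons y w ih =>
    obtain ⟨r, h1, h2⟩ := hst
    rw [← ih h2, wordVal_cons, ← mul_assoc]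
    congr 1
    rcases y with ⟨x, _ | _⟩
    · rw [lStep_false] at h1
      rw [h1.2, map_mul, h _ _ _ h1.1]
      simp [letterVal, mul_assoc]
    · rw [lStep_true] at h1
      rw [h1.2, map_mul, h _ _ _ h1.1]
      simp [letterVal, mul_assoc]

/-- A criterion for a group to be isomorphic to the group of the loops of a labeled graph. -/
theorem nonempty_mulEquiv_of_cover (hc : Good (cover E c)) (v : V) (ψ : P →* PSL2Z)
    (γ : V → PSL2Z) (hγ : γ v = 1)
    (h : ∀ x p q, E x p q → ψ (c x p q) = γ p * genVal x * (γ q)⁻¹)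
    (hsurj : ∀ k, ∃ g, Path (cover E c) g (1, v) (k, v)) :
    Nonempty (loopSubgroup E v ≃* P) := by
  have hex : ∀ g : loopSubgroup E v, ∃ l, Path (cover E c) g.1 (1, v) (l, v) := fun g =>
    exists_path_cover g.2 1
  -- The map sends a loop to the end of its lift starting at `(1, v)`. It is well defined because
  -- the cover is `Good`, and multiplicative by left translation.
  choose φ hφ using hex
  have huniq : ∀ g l, Path (cover E c) g.1 (1, v) (l, v) → l = φ g := fun g l hl =>
    congrArg Prod.fst (hl.eq hc (hφ g))
  let Φ : loopSubgroup E v →* P := MonoidHom.mk' φ fun g g' => by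
    symm
    refine huniq _ _ ((hφ g).mul ?_)
    simpa using path_cover_mul_left (φ g) (hφ g')
  refine ⟨MulEquiv.ofBijective Φ ⟨?_, ?_⟩⟩
  · rw [injective_iff_map_eq_one]
    intro g hg
    have h1 := map_mul_eq_of_path_cover ψ γ h (hφ g)
    have hg' : φ g = 1 := hg
    simp only [hg', map_one, hγ, one_mul] at h1
    exact Subtype.ext h1
  · intro k
    obtain ⟨g, hg⟩ := hsurj k
    exact ⟨⟨g, path_of_path_cover hg⟩, (huniq ⟨g, path_of_path_cover hg⟩ k hg).symm⟩

end Cover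

/-! ### Spanning tree of the graph of components and the free product decomposition. -/

section Rank

variable {W : Type*} {R : W → W → Prop} {root : W}

/-- Reachability in a given number of steps. -/
def ReachIn (R : W → W → Prop) (root : W) : ℕ → W → Prop
  | 0, w => w = root
  | n + 1, w => ∃ w', ReachIn R root n w' ∧ R w' w

/-- The function is the distance from the root. Parents of smaller rank define a spanning tree. -/
lemma exists_rank (h : ∀ w, Relation.ReflTransGen R root w) :
    ∃ f : W → ℕ, ∀ w, w ≠ root → ∃ w', R w' w ∧ f w' < f w := by
  classical
  have hex : ∀ w, ∃ n, ReachIn R root n w := by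
    intro w
    induction h w with
    | refl => exact ⟨0, rfl⟩
    | tail _ h1 ih =>
      obtain ⟨n, hn⟩ := ih
      exact ⟨n + 1, _, hn, h1⟩
  refine ⟨fun w => Nat.find (hex w), fun w hw => ?_⟩
  have h1 := Nat.find_spec (hex w)
  obtain ⟨n, hn⟩ : ∃ n, Nat.find (hex w) = n + 1 := by
    refine Nat.exists_eq_succ_of_ne_zero fun h0 => hw ?_
    rw [h0] at h1
    exact h1
  rw [hn] at h1
  obtain ⟨w', h2, h3⟩ := h1
  refine ⟨w', h3, ?_⟩
  have := Nat.find_min' (hex w') h2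
  dsimp only
  omega

end Rank

section Components

variable {V : Type*} {E : Gen → V → V → Prop}

/-- The equivalence relation whose classes are the components of the `x`-labeled edges. -/
def compSetoid (hE : Good E) (x : Gen) : Setoid V where
  r p q := p = q ∨ E x p q ∨ E x q p
  iseqv := by
    refine ⟨fun p => Or.inl rfl, ?_, ?_⟩
    · rintro p q (rfl | h | h)
      · exact Or.inl rfl
      · exact Or.inr (Or.inr h)
      · exact Or.inr (Or.inl h)
    · rintro p q r (rfl | h | h) (rfl | h' | h')
      · exact Or.inl rfl
      · exact Or.inr (Or.inl h')
      · exact Or.inr (Or.inr h')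
      · exact Or.inr (Or.inl h)
      · cases x
        · exact Or.inl (hE.det (hE.a_symm h) h')
        · exact Or.inr (Or.inr (hE.b_triangle h h'))
      · exact Or.inl (hE.codet h h')
      · exact Or.inr (Or.inr h)
      · exact Or.inl (hE.det h h')
      · cases x
        · exact Or.inl (hE.det h (hE.a_symm h'))
        · exact Or.inr (Or.inl (hE.b_triangle h' h))

/-- The components of the edges of each label. -/
abbrev Component (hE : Good E) : Type _ := Σ x : Gen, Quotient (compSetoid hE x)

/-- The component of a vertex. -/
def comp (hE : Good E) (x : Gen) (p : V) : Component hE := ⟨x, Quotient.mk (compSetoid hE x) p⟩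

lemma comp_eq_iff {hE : Good E} {x : Gen} {p q : V} :
    comp hE x p = comp hE x q ↔ p = q ∨ E x p q ∨ E x q p := by
  unfold comp
  rw [Sigma.mk.injEq]
  simp only [heq_eq_eq, true_and]
  exact Quotient.eq

lemma exists_comp_eq (hE : Good E) (w : Component hE) : ∃ p, comp hE w.1 p = w := by
  obtain ⟨x, q⟩ := w
  induction q using Quotient.inductionOn with
  | h p => exact ⟨p, rfl⟩

/-- Components that share a vertex. -/
def CompAdj (hE : Good E) (w w' : Component hE) : Prop :=
  ∃ p, w = comp hE w.1 p ∧ w' = comp hE w.1.other p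

lemma Conn.reach_comp (hE : Good E) (hC : Conn E) (v : V) (w : Component hE) :
    Relation.ReflTransGen (CompAdj hE) (comp hE Gen.b v) w := by
  have hadj : ∀ x p, CompAdj hE (comp hE x p) (comp hE x.other p) := fun x p => ⟨p, rfl, rfl⟩
  have key : ∀ p, ∀ x, Relation.ReflTransGen (CompAdj hE) (comp hE Gen.b v) (comp hE x p) := by
    intro p
    induction hC v p with
    | refl =>
      rintro (_ | _)
      · exact .single (hadj Gen.b v)
      · exact .refl
    | @tail p q _ h ih =>
      obtain ⟨x, hx⟩ := h
      have h1 : Relation.ReflTransGen (CompAdj hE) (comp hE Gen.b v) (comp hE x q) := by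
        rw [← comp_eq_iff.2 (Or.inr hx)]; exact ih x
      intro y
      by_cases hy : y = x
      · rwa [hy]
      · rw [Gen.eq_other_of_ne hy]; exact h1.tail (hadj x q)
  obtain ⟨p, hp⟩ := exists_comp_eq hE w
  rw [← hp]
  exact key p w.1

open Classical in
/-- The element that leads from `p` to `q` inside a component. -/
def shift (E : Gen → V → V → Prop) (x : Gen) (p q : V) : PSL2Z :=
  if p = q then 1 else if E x p q then genVal x else (genVal x)⁻¹

@[simp] lemma shift_self (x : Gen) (p : V) : shift E x p p = 1 := by simp [shift]

/-- The only case that is not a cancellation or a single edge is two steps along a triangle, where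
`b * b = b⁻¹`. -/
lemma shift_mul (hE : Good E) {x : Gen} {p₀ p q : V} (h₀ : p₀ = p ∨ E x p₀ p ∨ E x p p₀)
    (h : E x p q) (hpq : p ≠ q) : shift E x p₀ q = shift E x p₀ p * genVal x := by
  by_cases h0 : p₀ = p
  · subst h0
    simp [shift, hpq, h]
  · by_cases h1 : E x p₀ p
    · have hp : shift E x p₀ p = genVal x := by simp [shift, h0, h1]
      rw [hp]
      cases x
      · obtain rfl := hE.det h (hE.a_symm h1)
        simp
      · have h2 := hE.b_triangle h1 h
        have h3 : p₀ ≠ q := by rintro rfl; exact h0 (hE.det h2 h1)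
        have h4 : ¬ E Gen.b p₀ q := fun h4 => hpq (hE.det h1 h4)
        simp only [shift, h3, h4, if_false]
        exact inv_eq_of_mul_eq_one_right genVal_b_mul_mul
    · have h2 : E x p p₀ := by tauto
      obtain rfl := hE.det h h2
      have hp : shift E x q p = (genVal x)⁻¹ := by simp [shift, h0, h1]
      rw [hp]; simp

/-- Transversals adapted to a spanning tree of the graph of components. -/
lemma exists_tree (hE : Good E) (hC : Conn E) (v : V) :
    ∃ (f : Component hE → ℕ) (par : Component hE → V) (γ : Gen → V → PSL2Z),
      (∀ w, w ≠ comp hE Gen.b v → comp hE w.1 (par w) = w ∧ f (comp hE w.1.other (par w)) < f w) ∧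
      γ Gen.b v = 1 ∧
      (∀ p, comp hE Gen.b p = comp hE Gen.b v → γ Gen.b p = shift E Gen.b v p) ∧
      (∀ x p, comp hE x p ≠ comp hE Gen.b v →
        γ x p = γ x.other (par (comp hE x p)) * shift E x (par (comp hE x p)) p) ∧
      (∀ x p q, E x p q → p ≠ q → γ x q = γ x p * genVal x) := by
  classical
  set root := comp hE Gen.b v with hroot
  obtain ⟨f, hf⟩ := exists_rank (hC.reach_comp hE v)
  have hpar : ∀ w, ∃ p, w ≠ root → comp hE w.1 p = w ∧ f (comp hE w.1.other p) < f w := by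
    intro w
    by_cases hw : w = root
    · exact ⟨v, fun h => absurd hw h⟩
    · obtain ⟨w', ⟨p, h1, h2⟩, h3⟩ := hf w hw
      refine ⟨p, fun _ => ?_⟩
      have h4 : w.1 = w'.1.other := by rw [h2]; rfl
      rw [h4, Gen.other_other, ← h1]
      exact ⟨h2.symm, h3⟩
  choose par hpar using hpar
  -- Each component has an entry point: the point through which the tree reaches it, or `v` for the
  -- root.
  set ent : Component hE → V := fun w => if w = root then v else par w with hent
  have hent' : ∀ w, comp hE w.1 (ent w) = w := by
    intro w
    by_cases hw : w = root
    · simp only [hent, hw, if_true]; rfl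
    · simp only [hent, hw, if_false]; exact (hpar w hw).1
  -- The element `g w` leads from `v` to the entry point of `w` along the tree. It is defined by
  -- recursion on the rank of the component.
  obtain ⟨g, hg⟩ : ∃ g : Component hE → PSL2Z, ∀ w, g w = if w = root then 1 else
      g (comp hE w.1.other (par w)) *
        shift E w.1.other (ent (comp hE w.1.other (par w))) (par w) := by
    let F : ∀ w, (∀ w', f w' < f w → PSL2Z) → PSL2Z := fun w rec =>
      if h : w = root then 1 else rec (comp hE w.1.other (par w)) (hpar w h).2 *
        shift E w.1.other (ent (comp hE w.1.other (par w))) (par w)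
    refine ⟨(measure f).wf.fix F, fun w => ?_⟩
    rw [WellFounded.fix_eq]
    by_cases h : w = root
    · simp [F, h]
    · simp [F, h]
  refine ⟨f, par, fun x p => g (comp hE x p) * shift E x (ent (comp hE x p)) p, hpar, ?_, ?_, ?_, ?_⟩
  · simp [hg root, ← hroot, hent]
  · intro p hp
    simp [hp, hg root, hent]
  · intro x p hp
    dsimp only
    rw [hg (comp hE x p), if_neg hp]
    congr 1
    simp only [hent, hp, if_false]
  · intro x p q h hpq
    dsimp only
    rw [← comp_eq_iff.2 (Or.inr (Or.inl h)), mul_assoc]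
    congr 1
    exact shift_mul hE (comp_eq_iff.1 (hent' (comp hE x p))) h hpq

end Components

section Kurosh

variable {V : Type*} {E : Gen → V → V → Prop}

/-- Points are the edges of the graph of components, and each non-root component contributes one
tree edge. Two components with the same parent point would be its `a`- and `b`-components, each of
smaller rank than the other, so `par` is injective off the root. -/
lemma card_parents [Fintype V] {hE : Good E} {v : V} {f : Component hE → ℕ}
    {par : Component hE → V}
    (hpar : ∀ w, w ≠ comp hE Gen.b v →
      comp hE w.1 (par w) = w ∧ f (comp hE w.1.other (par w)) < f w) :
    Nat.card {p // ¬ ∃ w, w ≠ comp hE Gen.b v ∧ par w = p} + Nat.card (Component hE) =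
      Fintype.card V + 1 := by
  classical
  have hfin : Finite (Component hE) := inferInstance
  have := Fintype.ofFinite (Component hE)
  have hinj : Set.InjOn par {w | w ≠ comp hE Gen.b v} := by
    intro w hw w' hw' h
    have h1 := hpar w hw
    have h2 := hpar w' hw'
    by_cases hx : w.1 = w'.1
    · rw [← h1.1, ← h2.1, hx, h]
    · exfalso
      have h3 := h1.2
      have h4 := h2.2
      rw [h, ← Gen.eq_other_of_ne (Ne.symm hx), h2.1] at h3
      rw [← h, ← Gen.eq_other_of_ne hx, h1.1] at h4
      omega
  have hcard : ((Finset.univ.erase (comp hE Gen.b v)).image par).card =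
      Fintype.card (Component hE) - 1 := by
    rw [Finset.card_image_of_injOn (hinj.mono (by intro w; simp)),
      Finset.card_erase_of_mem (Finset.mem_univ _), Finset.card_univ]
  have hpos : 0 < Fintype.card (Component hE) := Fintype.card_pos_iff.2 ⟨comp hE Gen.b v⟩
  have hsub : Nat.card {p // ¬ ∃ w, w ≠ comp hE Gen.b v ∧ par w = p} =
      ((Finset.univ.erase (comp hE Gen.b v)).image par)ᶜ.card := by
    rw [Nat.card_eq_fintype_card, Fintype.card_subtype]
    congr 1
    ext p
    simp
  have hle := Finset.card_le_univ ((Finset.univ.erase (comp hE Gen.b v)).image par)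
  rw [hsub, Finset.card_compl, hcard, Nat.card_eq_fintype_card]
  omega

/-- The group of the loops of a finite connected graph is a free product. -/
theorem Good.hasIsoType [Fintype V] (hE : Good E) (hC : Conn E) (v : V) :
    HasIsoType (loopSubgroup E v) (Nat.card {p // E Gen.a p p}, Nat.card {p // E Gen.b p p},
      Fintype.card V + 1 - Nat.card (Component hE)) := by
  classical
  obtain ⟨f, par, γ, hpar, hγv, hγb, hγpar, hγE⟩ := exists_tree hE hC v
  set T : V → Prop := fun p => ∃ w, w ≠ comp hE Gen.b v ∧ par w = p with hT
  have hcardT : Nat.card {p // ¬ T p} + Nat.card (Component hE) = Fintype.card V + 1 :=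
    card_parents hpar
  obtain ⟨t, ht⟩ : ∃ t : ℕ × ℕ × ℕ, t = (Nat.card {p // E Gen.a p p}, Nat.card {p // E Gen.b p p},
      Fintype.card V + 1 - Nat.card (Component hE)) := ⟨_, rfl⟩
  rw [← ht]
  have ia : {p // E Gen.a p p} ≃ Fin t.1 := by rw [ht]; exact Finite.equivFin _
  have ib : {p // E Gen.b p p} ≃ Fin t.2.1 := by rw [ht]; exact Finite.equivFin _
  have iF : {p // ¬ T p} ≃ Fin t.2.2 := by
    rw [ht]; exact Finite.equivFinOfCardEq (by dsimp only; omega)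
  -- At a tree edge the paths arriving through its `a`- and its `b`-component agree. At the other
  -- points the discrepancy gives a free generator.
  have hγT : ∀ p, T p → γ Gen.a p = γ Gen.b p := by
    rintro p ⟨w, hw, rfl⟩
    have h1 := hpar w hw
    have h2 := hγpar w.1 (par w) (by rwa [h1.1])
    rw [h1.1, shift_self, mul_one] at h2
    rcases gen_eq_a_or_b w.1 with h | h <;> rw [h] at h2
    · exact h2
    · exact h2.symm
  let τ : V → FreeProductOfType t := fun p => if h : T p then 1 else genFree t (iF ⟨p, h⟩)
  have hτ1 : ∀ p, T p → τ p = 1 := fun p h => dif_pos h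
  let tt : Gen → V → FreeProductOfType t := fun x p => match x with
    | Gen.a => τ p
    | Gen.b => 1
  let ss : Gen → V → FreeProductOfType t := fun x p => match x with
    | Gen.a => if h : E Gen.a p p then gen₂ t (ia ⟨p, h⟩) else 1
    | Gen.b => if h : E Gen.b p p then gen₃ t (ib ⟨p, h⟩) else 1
  have htt1 : ∀ x p, T p → tt x p = 1 := by
    rintro (_ | _) p h
    · exact hτ1 p h
    · rfl
  -- Passing between the `b`-side and the `a`-side of a point `p` costs `τ p`, which is trivial
  -- exactly on the tree edges as prescribed. Loops carry the torsion generators, and other edges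
  -- carry nothing inside their component.
  let c : Gen → V → V → FreeProductOfType t := fun x p q =>
    tt x p * (if p = q then ss x p else 1) * (tt x q)⁻¹
  have hsa : ∀ p, ss Gen.a p * ss Gen.a p = 1 := by
    intro p
    by_cases h : E Gen.a p p
    · simp only [ss, h, dif_pos]; rw [← sq]; exact gen₂_sq _
    · simp [ss, h]
  have hsb : ∀ p, ss Gen.b p * ss Gen.b p * ss Gen.b p = 1 := by
    intro p
    by_cases h : E Gen.b p p
    · simp only [ss, h, dif_pos]; rw [← sq, ← pow_succ]; exact gen₃_cube _
    · simp [ss, h]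
  have hcover : Good (cover E c) := by
    refine good_cover hE ?_ ?_
    · intro p q h
      by_cases hpq : p = q
      · subst hpq
        simp only [c, if_true]
        calc tt Gen.a p * ss Gen.a p * (tt Gen.a p)⁻¹ * (tt Gen.a p * ss Gen.a p * (tt Gen.a p)⁻¹)
            = tt Gen.a p * (ss Gen.a p * ss Gen.a p) * (tt Gen.a p)⁻¹ := by group
          _ = 1 := by rw [hsa]; group
      · simp [c, hpq, Ne.symm hpq]
    · intro p q r h1 h2
      have htb : ∀ p, tt Gen.b p = 1 := fun _ => rfl
      by_cases hpq : p = q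
      · subst hpq
        obtain rfl := hE.det h1 h2
        simpa [c, htb] using hsb p
      · have h3 := hE.b_triangle h1 h2
        have hqr : q ≠ r := by rintro rfl; exact hpq (hE.codet h1 h2)
        have hrp : r ≠ p := by rintro rfl; exact hpq (hE.det h3 h1)
        simp [c, htb, hpq, hqr, hrp]
  obtain ⟨ψ, hψ₂, hψ₃, hψF⟩ := exists_lift (t := t)
    (fun i => γ Gen.a (ia.symm i).1 * genVal Gen.a * (γ Gen.a (ia.symm i).1)⁻¹)
    (fun i => γ Gen.b (ib.symm i).1 * genVal Gen.b * (γ Gen.b (ib.symm i).1)⁻¹)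
    (fun i => γ Gen.b (iF.symm i).1 * (γ Gen.a (iF.symm i).1)⁻¹)
    (fun i => by rw [conj_pow, sq, genVal_a_mul_self]; group)
    (fun i => by
      have : genVal Gen.b ^ 3 = 1 := by
        rw [pow_succ, sq, mul_assoc]; exact genVal_b_mul_mul
      rw [conj_pow, this]; group)
  -- This change of transversal from `γ x` to `γ Gen.b` is what makes the weights compatible with
  -- the single function `γ Gen.b` in `hψc`.
  have hψt : ∀ x p, ψ (tt x p) = γ Gen.b p * (γ x p)⁻¹ := by
    rintro (_ | _) p
    · by_cases h : T p
      · rw [htt1 Gen.a p h, hγT p h]; simp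
      · have : tt Gen.a p = genFree t (iF ⟨p, h⟩) := dif_neg h
        rw [this, hψF]; simp
    · have : tt Gen.b p = 1 := rfl
      rw [this]; simp
  have hψs : ∀ x p q, E x p q → ψ (if p = q then ss x p else 1) =
      γ x p * genVal x * (γ x q)⁻¹ := by
    intro x p q h
    by_cases hpq : p = q
    · subst hpq
      rw [if_pos rfl]
      cases x
      · simp only [ss, h, dif_pos, hψ₂]; simp
      · simp only [ss, h, dif_pos, hψ₃]; simp
    · rw [if_neg hpq, hγE x p q h hpq]; simp
  have hψc : ∀ x p q, E x p q → ψ (c x p q) = γ Gen.b p * genVal x * (γ Gen.b q)⁻¹ := by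
    intro x p q h
    simp only [c]
    rw [map_mul, map_mul, hψs x p q h, map_inv, hψt, hψt]
    group
  have hshift : ∀ x p₀ p, comp hE x p₀ = comp hE x p →
      Path (cover E c) (shift E x p₀ p) ((tt x p₀)⁻¹, p₀) ((tt x p)⁻¹, p) := by
    intro x p₀ p h
    have hedge : ∀ p q, p ≠ q → E x p q →
        Path (cover E c) (genVal x) ((tt x p)⁻¹, p) ((tt x q)⁻¹, q) := by
      intro p q hpq h
      exact Path.of_edge ⟨h, by simp [c, hpq]⟩
    rw [comp_eq_iff] at h
    by_cases h0 : p₀ = p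
    · subst h0; rw [shift_self]; exact Path.refl _ _
    · by_cases h1 : E x p₀ p
      · simp only [shift, h0, h1, if_false, if_true]; exact hedge _ _ h0 h1
      · simp only [shift, h0, h1, if_false]
        exact (hedge _ _ (Ne.symm h0) (by tauto)).inv
  -- By induction on the rank, the tree path `γ x p` lifts to a path that meets no torsion generator
  -- and ends at the sheet `(tt x p)⁻¹`.
  have hpath : ∀ n x p, f (comp hE x p) < n →
      Path (cover E c) (γ x p) (1, v) ((tt x p)⁻¹, p) := by
    intro n
    induction n with
    | zero => intro x p h; omega
    | succ n ih =>
      intro x p h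
      by_cases hr : comp hE x p = comp hE Gen.b v
      · have hx : x = Gen.b := congrArg Sigma.fst hr
        subst hx
        rw [hγb p hr]
        simpa [tt] using hshift Gen.b v p hr.symm
      · have h1 := hpar _ hr
        have hTp : T (par (comp hE x p)) := ⟨_, hr, rfl⟩
        rw [hγpar x p hr]
        refine Path.mul (q := (1, par (comp hE x p))) ?_ ?_
        · have := ih x.other (par (comp hE x p)) (by have := h1.2; simp only [comp] at this h ⊢; omega)
          rwa [htt1 _ _ hTp, inv_one] at this
        · have := hshift x (par (comp hE x p)) p h1.1
          rwa [htt1 _ _ hTp, inv_one] at this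
  have hpath' : ∀ x p, Path (cover E c) (γ x p) (1, v) ((tt x p)⁻¹, p) := fun x p =>
    hpath _ x p (Nat.lt_succ_self _)
  refine nonempty_mulEquiv_of_cover hcover v ψ (γ Gen.b) hγv hψc ?_
  -- Surjectivity of the monodromy: the sheets over `v` that can be reached from `(1, v)` form a
  -- subgroup, and tree paths closed up by a loop or by a non-tree point produce all the generators.
  let R : Subgroup (FreeProductOfType t) :=
    { carrier := {k | ∃ g, Path (cover E c) g (1, v) (k, v)}
      mul_mem' := by
        rintro k l ⟨g, hg⟩ ⟨h, hh⟩
        have := path_cover_mul_left k hh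
        rw [mul_one] at this
        exact ⟨_, hg.mul this⟩
      one_mem' := ⟨1, Path.refl _ _⟩
      inv_mem' := by
        rintro k ⟨g, hg⟩
        have := path_cover_mul_left k⁻¹ hg.inv
        rw [mul_one, inv_mul_cancel] at this
        exact ⟨_, this⟩ }
  have hs : ∀ x p, E x p p → ss x p ∈ R := by
    intro x p h
    have h1 : Path (cover E c) (genVal x) ((tt x p)⁻¹, p) (ss x p * (tt x p)⁻¹, p) :=
      Path.of_edge ⟨h, by simp [c, mul_assoc]⟩
    have h2 := path_cover_mul_left (ss x p) (hpath' x p).inv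
    rw [mul_one] at h2
    exact ⟨_, ((hpath' x p).mul h1).mul h2⟩
  have htop : R = ⊤ := by
    refine eq_top_of_gen_mem (fun i => ?_) (fun i => ?_) (fun i => ?_)
    · have h := (ia.symm i).2
      have := hs _ _ h
      simp only [ss, h, dif_pos] at this
      simpa using this
    · have h := (ib.symm i).2
      have := hs _ _ h
      simp only [ss, h, dif_pos] at this
      simpa using this
    · have h := (iF.symm i).2
      have h1 : tt Gen.a (iF.symm i).1 = genFree t i := by
        have : tt Gen.a (iF.symm i).1 = genFree t (iF ⟨_, h⟩) := dif_neg h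
        rw [this]; simp
      rw [← h1]
      have h2 := path_cover_mul_left (tt Gen.a (iF.symm i).1) (hpath' Gen.a (iF.symm i).1).inv
      rw [mul_one, mul_inv_cancel] at h2
      have h3 := hpath' Gen.b (iF.symm i).1
      have h4 : tt Gen.b (iF.symm i).1 = 1 := rfl
      rw [h4, inv_one] at h3
      exact ⟨_, h3.mul h2⟩
  intro k
  have : k ∈ R := htop ▸ Subgroup.mem_top k
  exact this

lemma existsUnique_hasIsoType (n : ℕ) {H : Subgroup PSL2Z}
    (hH : H ∈ cyclicallyReducedSubgroups n) : ∃! t : ℕ × ℕ × ℕ, HasIsoType H t := by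
  have hn : n ≠ 0 := by
    rintro rfl
    have h1 := (Set.ncard_eq_zero hH.2.1).1 hH.2.2.1
    have h2 := root_mem_stallingsGraph H
    rw [h1] at h2
    exact h2
  have : NeZero n := ⟨hn⟩
  obtain ⟨E, e, h, h1, h2⟩ := exists_isStallings_of_mem hH
  have h3 := h1.hasIsoType h2 0
  rw [h.loopSubgroup_eq] at h3
  exact ⟨_, h3, fun t ht => ht.unique h3⟩

end Kurosh

/-! ### Parts with a single label and counting by patterns. -/

/-- The relations formed by the `x`-labeled edges of the structures on `V`. -/
structure IsPart {V : Type*} (x : Gen) (R : V → V → Prop) : Prop where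
  det : ∀ {p q r}, R p q → R p r → q = r
  codet : ∀ {p q r}, R q p → R r p → q = r
  a_symm : x = Gen.a → ∀ {p q}, R p q → R q p
  b_triangle : x = Gen.b → ∀ {p q r}, R p q → R q r → R r p
  touches : ∀ p, ∃ q, R p q ∨ R q p

/-- No condition other than connectedness links the two labels. Hence structures are counted by a
product, and the two parts of a uniform structure are independent. -/
lemma good_and_full_iff {V : Type*} {E : Gen → V → V → Prop} :
    Good E ∧ Full E ↔ IsPart Gen.a (E Gen.a) ∧ IsPart Gen.b (E Gen.b) := by
  constructor
  · rintro ⟨h, hF⟩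
    exact ⟨⟨h.det, h.codet, fun _ => h.a_symm, by simp, hF _⟩,
      ⟨h.det, h.codet, by simp, fun _ => h.b_triangle, hF _⟩⟩
  · rintro ⟨ha, hb⟩
    refine ⟨⟨?_, ?_, ha.a_symm rfl, hb.b_triangle rfl⟩, ?_⟩
    · rintro (_ | _)
      exacts [ha.det, hb.det]
    · rintro (_ | _)
      exacts [ha.codet, hb.codet]
    · rintro (_ | _)
      exacts [ha.touches, hb.touches]

lemma IsPart.comap {V W : Type*} {x : Gen} {R : V → V → Prop} (h : IsPart x R) (e : W ≃ V) :
    IsPart x fun p q => R (e p) (e q) where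
  det h1 h2 := e.injective (h.det h1 h2)
  codet h1 h2 := e.injective (h.codet h1 h2)
  a_symm hx _ _ h1 := h.a_symm hx h1
  b_triangle hx _ _ _ h1 h2 := h.b_triangle hx h1 h2
  touches p := by
    obtain ⟨q, hq⟩ := h.touches (e p)
    exact ⟨e.symm q, by simpa using hq⟩

/-- The number of the possible `x`-labeled parts of a structure on `n` points. -/
def partCount (x : Gen) (n : ℕ) : ℕ := Nat.card {R : Fin n → Fin n → Prop // IsPart x R}

lemma card_isPart (x : Gen) (V : Type*) [Fintype V] :
    Nat.card {R : V → V → Prop // IsPart x R} = partCount x (Fintype.card V) := by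
  let e := Fintype.equivFin V
  refine Nat.card_congr ⟨fun R => ⟨_, R.2.comap e.symm⟩, fun R => ⟨_, R.2.comap e⟩, ?_, ?_⟩
  · intro R; ext p q; simp
  · intro R; ext p q; simp

open Classical in
/-- The possible `x`-labeled parts of a structure on `V`. -/
def parts (x : Gen) (V : Type*) [Fintype V] : Finset (V → V → Prop) :=
  Finset.univ.filter fun R => IsPart x R

lemma mem_parts {x : Gen} {V : Type*} [Fintype V] {R : V → V → Prop} :
    R ∈ parts x V ↔ IsPart x R := by simp [parts]

lemma card_parts (x : Gen) (V : Type*) [Fintype V] :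
    (parts x V).card = partCount x (Fintype.card V) := by
  classical
  rw [← card_isPart, Nat.card_eq_fintype_card, Fintype.card_subtype, parts]

section Pattern

variable {V ι : Type*} {x : Gen} {R : V → V → Prop} {R₀ : ι → ι → Prop} {v : ι ↪ V}

/-- The points `v i` form a union of components of `R`, on which `R` is `R₀`. -/
def HasPattern (R₀ : ι → ι → Prop) (v : ι ↪ V) (R : V → V → Prop) : Prop :=
  ∀ i q, (R (v i) q ↔ ∃ j, v j = q ∧ R₀ i j) ∧ (R q (v i) ↔ ∃ j, v j = q ∧ R₀ j i)

/-- No edge crosses between the image of `v` and its complement, so a part with the given pattern is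
the same as an arbitrary part on the complement. -/
lemma card_hasPattern [Fintype V] [Fintype ι] (h₀ : IsPart x R₀) (v : ι ↪ V) :
    Nat.card {R : V → V → Prop // IsPart x R ∧ HasPattern R₀ v R} =
      partCount x (Fintype.card V - Fintype.card ι) := by
  classical
  have hcard : Fintype.card {p // p ∉ Set.range v} = Fintype.card V - Fintype.card ι := by
    rw [Fintype.card_subtype_compl, ← Set.card_range_of_injective v.injective]
  rw [← hcard, ← card_isPart]
  have hout : ∀ {R : V → V → Prop}, HasPattern R₀ v R → ∀ {p q}, R p q →
      (p ∈ Set.range v ↔ q ∈ Set.range v) := by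
    intro R hR p q hpq
    constructor
    · rintro ⟨i, rfl⟩
      obtain ⟨j, hj, -⟩ := (hR i q).1.1 hpq
      exact ⟨j, hj⟩
    · rintro ⟨i, rfl⟩
      obtain ⟨j, hj, -⟩ := (hR i p).2.1 hpq
      exact ⟨j, hj⟩
  refine Nat.card_congr (Equiv.ofBijective
    (fun R => ⟨fun p q => R.1 p.1 q.1, ?_⟩) ⟨?_, ?_⟩)
  · obtain ⟨R, hR, hp⟩ := R
    refine ⟨fun h1 h2 => Subtype.ext (hR.det h1 h2), fun h1 h2 => Subtype.ext (hR.codet h1 h2),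
      fun hx _ _ h1 => hR.a_symm hx h1, fun hx _ _ _ h1 h2 => hR.b_triangle hx h1 h2, ?_⟩
    rintro ⟨p, hp'⟩
    obtain ⟨q, hq⟩ := hR.touches p
    refine ⟨⟨q, fun hq' => hp' ?_⟩, hq⟩
    rcases hq with hq | hq
    · exact (hout hp hq).2 hq'
    · exact (hout hp hq).1 hq'
  · rintro ⟨R, hR, hp⟩ ⟨R', hR', hp'⟩ h
    simp only [Subtype.mk.injEq] at h ⊢
    funext p q
    by_cases hpv : p ∈ Set.range v
    · obtain ⟨i, rfl⟩ := hpv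
      rw [(hp i q).1.eq, (hp' i q).1.eq]
    · by_cases hqv : q ∈ Set.range v
      · obtain ⟨i, rfl⟩ := hqv
        rw [(hp i p).2.eq, (hp' i p).2.eq]
      · exact congrFun (congrFun h ⟨p, hpv⟩) ⟨q, hqv⟩
  · rintro ⟨R', hR'⟩
    have hinj := v.injective
    refine ⟨⟨fun p q => (∃ i j, v i = p ∧ v j = q ∧ R₀ i j) ∨
      ∃ hp hq, R' ⟨p, hp⟩ ⟨q, hq⟩, ⟨?_, ?_, ?_, ?_, ?_⟩, ?_⟩, ?_⟩
    · rintro p q r (⟨i, j, rfl, rfl, h1⟩ | ⟨hp, hq, h1⟩) (⟨i', j', h2, rfl, h3⟩ | ⟨hp', hr, h2⟩)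
      · obtain rfl := hinj h2
        rw [h₀.det h1 h3]
      · exact absurd ⟨i, rfl⟩ hp'
      · exact absurd ⟨i', h2⟩ hp
      · exact congrArg Subtype.val (hR'.det h1 h2)
    · rintro p q r (⟨i, j, rfl, rfl, h1⟩ | ⟨hp, hq, h1⟩) (⟨i', j', rfl, h2, h3⟩ | ⟨hp', hr, h2⟩)
      · obtain rfl := hinj h2
        rw [h₀.codet h1 h3]
      · exact absurd ⟨j, rfl⟩ hr
      · exact absurd ⟨j', h2⟩ hq
      · exact congrArg Subtype.val (hR'.codet h1 h2)
    · rintro hx p q (⟨i, j, rfl, rfl, h1⟩ | ⟨hp, hq, h1⟩)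
      · exact Or.inl ⟨j, i, rfl, rfl, h₀.a_symm hx h1⟩
      · exact Or.inr ⟨hq, hp, hR'.a_symm hx h1⟩
    · rintro hx p q r (⟨i, j, rfl, rfl, h1⟩ | ⟨hp, hq, h1⟩) (⟨i', j', h2, rfl, h3⟩ | ⟨hp', hr, h2⟩)
      · obtain rfl := hinj h2
        exact Or.inl ⟨_, _, rfl, rfl, h₀.b_triangle hx h1 h3⟩
      · exact absurd ⟨j, rfl⟩ hp'
      · exact absurd ⟨i', h2⟩ hq
      · exact Or.inr ⟨hr, hp, hR'.b_triangle hx h1 h2⟩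
    · intro p
      by_cases hp : p ∈ Set.range v
      · obtain ⟨i, rfl⟩ := hp
        obtain ⟨j, hj⟩ := h₀.touches i
        refine ⟨v j, ?_⟩
        rcases hj with hj | hj
        · exact Or.inl (Or.inl ⟨i, j, rfl, rfl, hj⟩)
        · exact Or.inr (Or.inl ⟨j, i, rfl, rfl, hj⟩)
      · obtain ⟨q, hq⟩ := hR'.touches ⟨p, hp⟩
        refine ⟨q, ?_⟩
        rcases hq with hq | hq
        · exact Or.inl (Or.inr ⟨hp, q.2, hq⟩)
        · exact Or.inr (Or.inr ⟨q.2, hp, hq⟩)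
    · intro i q
      constructor
      · constructor
        · rintro (⟨i', j, h1, rfl, h2⟩ | ⟨hp, -⟩)
          · obtain rfl := hinj h1
            exact ⟨j, rfl, h2⟩
          · exact absurd ⟨i, rfl⟩ hp
        · rintro ⟨j, rfl, h⟩
          exact Or.inl ⟨i, j, rfl, rfl, h⟩
      · constructor
        · rintro (⟨j, i', rfl, h1, h2⟩ | ⟨-, hp, -⟩)
          · obtain rfl := hinj h1
            exact ⟨j, rfl, h2⟩
          · exact absurd ⟨i, rfl⟩ hp
        · rintro ⟨j, rfl, h⟩
          exact Or.inl ⟨j, i, rfl, rfl, h⟩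
    · apply Subtype.ext
      funext p q
      refine propext ⟨?_, fun h => Or.inr ⟨p.2, q.2, h⟩⟩
      rintro (⟨i, j, h1, -, -⟩ | ⟨_, _, h⟩)
      · exact absurd ⟨i, h1⟩ p.2
      · exact h

-- Double counting of pairs of a part and a placed pattern. Every moment below is an instance, with
-- `ι` chosen as one or two loops or arrows, a matched pair, or a triangle.
open Classical in
lemma sum_card_hasPattern [Fintype V] [Fintype ι] (h₀ : IsPart x R₀) :
    ∑ R ∈ parts x V, (Finset.univ.filter fun v : ι ↪ V => HasPattern R₀ v R).card =
      (Fintype.card V).descFactorial (Fintype.card ι) *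
        partCount x (Fintype.card V - Fintype.card ι) := by
  have h1 : ∀ v : ι ↪ V, ((parts x V).filter fun R => HasPattern R₀ v R).card =
      partCount x (Fintype.card V - Fintype.card ι) := by
    intro v
    rw [← card_hasPattern h₀ v, Nat.card_eq_fintype_card, Fintype.card_subtype, parts,
      Finset.filter_filter]
  rw [← Fintype.card_embedding_eq]
  calc ∑ R ∈ parts x V, (Finset.univ.filter fun v : ι ↪ V => HasPattern R₀ v R).card
      = ∑ v : ι ↪ V, ((parts x V).filter fun R => HasPattern R₀ v R).card := by
        simp only [Finset.card_filter]
        exact Finset.sum_comm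
    _ = _ := by rw [Finset.sum_congr rfl fun v _ => h1 v]; simp

end Pattern

section Local

variable {V : Type*} {R : V → V → Prop}

open Classical in
/-- The vertices that carry a loop. -/
def loops [Fintype V] (R : V → V → Prop) : Finset V := Finset.univ.filter fun p => R p p

/-- The vertex `p` is the origin of an edge that is not part of a cycle. -/
def IsSource (R : V → V → Prop) (p : V) : Prop := ∃ q, q ≠ p ∧ R p q ∧ ¬ ∃ r, R q r

/-- The vertex `p` is the end of an edge that is not part of a cycle. -/
def IsTarget (R : V → V → Prop) (p : V) : Prop := ∃ q, q ≠ p ∧ R q p ∧ ¬ ∃ r, R p r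

/-- The vertex `p` is on a triangle. -/
def IsCorner (R : V → V → Prop) (p : V) : Prop :=
  ∃ q r, p ≠ q ∧ q ≠ r ∧ r ≠ p ∧ R p q ∧ R q r ∧ R r p

open Classical in
/-- The vertices that are the origin of an edge that is not part of a cycle. -/
def sources [Fintype V] (R : V → V → Prop) : Finset V := Finset.univ.filter (IsSource R)

/-- Two consecutive `b`-edges that are not loops form a triangle, so the `b`-components are loops,
isolated edges and triangles. -/
lemma IsPart.cases_b (h : IsPart Gen.b R) (p : V) :
    R p p ∨ IsSource R p ∨ IsTarget R p ∨ IsCorner R p := by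
  by_cases hp : R p p
  · exact Or.inl hp
  right
  have key : ∀ q r, R p q → R q r → IsCorner R p := by
    intro q r h1 h2
    have h3 := h.b_triangle rfl h1 h2
    refine ⟨q, r, ?_, ?_, ?_, h1, h2, h3⟩
    · rintro rfl; exact hp h1
    · rintro rfl; exact hp (h.codet h1 h2 ▸ h1)
    · rintro rfl; exact hp h3
  obtain ⟨q, hq | hq⟩ := h.touches p
  · by_cases hr : ∃ r, R q r
    · obtain ⟨r, hr⟩ := hr
      exact Or.inr (Or.inr (key q r hq hr))
    · exact Or.inl ⟨q, by rintro rfl; exact hp hq, hq, hr⟩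
  · by_cases hr : ∃ r, R p r
    · obtain ⟨r, hr⟩ := hr
      exact Or.inr (Or.inr (key r q hr (h.b_triangle rfl hq hr)))
    · exact Or.inr (Or.inl ⟨q, by rintro rfl; exact hp hq, hq, hr⟩)

open Classical in
lemma card_eq_of_b [Fintype V] (h : IsPart Gen.b R) : Fintype.card V =
    (loops R).card + 2 * (sources R).card + (Finset.univ.filter (IsCorner R)).card := by
  have hT : (Finset.univ.filter (IsTarget R)).card = (sources R).card := by
    symm
    refine Finset.card_bij' (fun p hp => (Finset.mem_filter.1 hp).2.choose)
      (fun p hp => (Finset.mem_filter.1 hp).2.choose) ?_ ?_ ?_ ?_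
    · intro p hp
      obtain ⟨h1, h2, h3⟩ := (Finset.mem_filter.1 hp).2.choose_spec
      exact Finset.mem_filter.2 ⟨Finset.mem_univ _, p, h1.symm, h2, h3⟩
    · intro p hp
      obtain ⟨h1, h2, h3⟩ := (Finset.mem_filter.1 hp).2.choose_spec
      exact Finset.mem_filter.2 ⟨Finset.mem_univ _, p, h1.symm, h2, h3⟩
    · intro p hp
      obtain ⟨h1, h2, h3⟩ := (Finset.mem_filter.1 hp).2.choose_spec
      generalize_proofs _ pf
      exact h.codet pf.choose_spec.2.1 h2
    · intro p hp
      obtain ⟨h1, h2, h3⟩ := (Finset.mem_filter.1 hp).2.choose_spec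
      generalize_proofs _ pf
      exact h.det pf.choose_spec.2.1 h2
  have hsum : ∀ p, 1 = (if R p p then 1 else 0) + (if IsSource R p then 1 else 0) +
      (if IsTarget R p then 1 else 0) + (if IsCorner R p then 1 else 0) := by
    intro p
    have h12 : R p p → ¬ IsSource R p := by
      rintro h1 ⟨q, hq, h2, -⟩; exact hq (h.det h2 h1)
    have h13 : R p p → ¬ IsTarget R p := by
      rintro h1 ⟨q, hq, h2, h3⟩; exact h3 ⟨p, h1⟩
    have h14 : R p p → ¬ IsCorner R p := by
      rintro h1 ⟨q, r, hq, -, -, h2, -⟩; exact hq (h.det h1 h2)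
    have h23 : IsSource R p → ¬ IsTarget R p := by
      rintro ⟨q, hq, h2, h3⟩ ⟨q', hq', h2', h3'⟩; exact h3' ⟨q, h2⟩
    have h24 : IsSource R p → ¬ IsCorner R p := by
      rintro ⟨q, hq, h2, h3⟩ ⟨q', r, hq', -, -, h2', h4, -⟩
      obtain rfl := h.det h2 h2'
      exact h3 ⟨r, h4⟩
    have h34 : IsTarget R p → ¬ IsCorner R p := by
      rintro ⟨q, hq, h2, h3⟩ ⟨q', r, hq', -, -, h2', h4, -⟩
      exact h3 ⟨q', h2'⟩
    rcases h.cases_b p with h1 | h1 | h1 | h1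
    · simp [h1, h12 h1, h13 h1, h14 h1]
    · have : ¬ R p p := fun h2 => h12 h2 h1
      simp [h1, this, h23 h1, h24 h1]
    · have : ¬ R p p := fun h2 => h13 h2 h1
      have h' : ¬ IsSource R p := fun h2 => h23 h2 h1
      simp [h1, this, h', h34 h1]
    · have : ¬ R p p := fun h2 => h14 h2 h1
      have h' : ¬ IsSource R p := fun h2 => h24 h2 h1
      have h'' : ¬ IsTarget R p := fun h2 => h34 h2 h1
      simp [h1, this, h', h'']
  have : Fintype.card V = (loops R).card + (sources R).card +
      (Finset.univ.filter (IsTarget R)).card + (Finset.univ.filter (IsCorner R)).card := by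
    rw [loops, sources, Finset.card_filter, Finset.card_filter, Finset.card_filter,
      Finset.card_filter, ← Finset.sum_add_distrib, ← Finset.sum_add_distrib,
      ← Finset.sum_add_distrib, ← Finset.sum_congr rfl fun p _ => hsum p]
    simp
  omega

end Local

/-! ### Loops, isolated edges and triangles: moments and recurrences. -/

section Patterns

variable {V : Type*} {R : V → V → Prop} {x : Gen}

lemma isPart_eq (x : Gen) (ι : Type*) : IsPart x (fun i j : ι => i = j) where
  det h1 h2 := h1.symm.trans h2
  codet h1 h2 := h1.trans h2.symm
  a_symm _ _ _ h := h.symm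
  b_triangle _ _ _ _ h1 h2 := (h1.trans h2).symm
  touches p := ⟨p, Or.inl rfl⟩

lemma hasPattern_eq_iff (h : IsPart x R) {ι : Type*} (v : ι ↪ V) :
    HasPattern (fun i j : ι => i = j) v R ↔ ∀ i, R (v i) (v i) := by
  constructor
  · intro hv i
    exact (hv i (v i)).1.2 ⟨i, rfl, rfl⟩
  · intro hv i q
    constructor
    · constructor
      · intro h1; exact ⟨i, h.det (hv i) h1, rfl⟩
      · rintro ⟨j, rfl, rfl⟩; exact hv i
    · constructor
      · intro h1; exact ⟨i, h.codet (hv i) h1, rfl⟩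
      · rintro ⟨j, rfl, rfl⟩; exact hv j

open Classical in
lemma card_loops_eq [Fintype V] (h : IsPart x R) : (loops R).card =
    (Finset.univ.filter fun v : Unit ↪ V => HasPattern (fun i j => i = j) v R).card := by
  symm
  refine Finset.card_bij' (fun v _ => v ()) (fun p _ => ⟨fun _ => p, fun _ _ _ => rfl⟩) ?_ ?_ ?_ ?_
  · intro v hv
    rw [Finset.mem_filter, hasPattern_eq_iff h] at hv
    exact Finset.mem_filter.2 ⟨Finset.mem_univ _, hv.2 ()⟩
  · intro p hp
    rw [Finset.mem_filter, hasPattern_eq_iff h]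
    exact ⟨Finset.mem_univ _, fun _ => (Finset.mem_filter.1 hp).2⟩
  · intro v _; ext; rfl
  · intro p _; rfl

/-- The number of loops, in all the possible parts. -/
theorem sum_card_loops [Fintype V] (x : Gen) : ∑ R ∈ parts x V, (loops R).card =
    Fintype.card V * partCount x (Fintype.card V - 1) := by
  have := sum_card_hasPattern (V := V) (isPart_eq x Unit)
  simp only [Fintype.card_unit, Nat.descFactorial_one] at this
  rw [← this]
  exact Finset.sum_congr rfl fun R hR => card_loops_eq (mem_parts.1 hR)

-- Ordered pairs of distinct loops are placements of the two-loop pattern. This is the second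
-- factorial moment.
open Classical in
lemma card_offDiag_loops_le [Fintype V] (h : IsPart x R) : (loops R).card * (loops R).card ≤ (loops R).card +
    (Finset.univ.filter fun v : Bool ↪ V => HasPattern (fun i j => i = j) v R).card := by
  have h1 : (loops R).offDiag.card ≤
      (Finset.univ.filter fun v : Bool ↪ V => HasPattern (fun i j => i = j) v R).card := by
    refine Finset.card_le_card_of_surjOn (fun v => (v false, v true)) ?_
    rintro ⟨p, q⟩ hpq
    simp only [Finset.mem_coe, Finset.mem_offDiag, loops, Finset.mem_filter, Finset.mem_univ,
      true_and] at hpq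
    have hf : Function.Injective fun i : Bool => if i then q else p := by
      rintro (_ | _) (_ | _) <;> simp [hpq.2.2, Ne.symm hpq.2.2]
    refine ⟨⟨_, hf⟩, ?_, rfl⟩
    rw [Finset.mem_coe, Finset.mem_filter, hasPattern_eq_iff h]
    refine ⟨Finset.mem_univ _, ?_⟩
    rintro (_ | _)
    exacts [hpq.1, hpq.2.1]
  rw [Finset.offDiag_card] at h1
  omega

theorem sum_card_loops_sq_le [Fintype V] (x : Gen) : ∑ R ∈ parts x V, (loops R).card * (loops R).card ≤
    Fintype.card V * partCount x (Fintype.card V - 1) +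
      Fintype.card V * (Fintype.card V - 1) * partCount x (Fintype.card V - 2) := by
  classical
  have := sum_card_hasPattern (V := V) (isPart_eq x Bool)
  have h2 : (Fintype.card V).descFactorial 2 = Fintype.card V * (Fintype.card V - 1) := by
    simp [Nat.descFactorial_succ, mul_comm]
  rw [Fintype.card_bool, h2] at this
  rw [← this, ← sum_card_loops, ← Finset.sum_add_distrib]
  exact Finset.sum_le_sum fun R hR => card_offDiag_loops_le (mem_parts.1 hR)

lemma isPart_ne : IsPart Gen.a (fun i j : Bool => i ≠ j) where
  det {p q r} := by revert p q r; decide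
  codet {p q r} := by revert p q r; decide
  a_symm _ _ _ h := h.symm
  b_triangle h := by cases h
  touches p := ⟨!p, by cases p <;> simp⟩

lemma hasPattern_ne_iff (h : IsPart Gen.a R) (v : Bool ↪ V) :
    HasPattern (fun i j : Bool => i ≠ j) v R ↔ R (v false) (v true) := by
  constructor
  · intro hv; exact (hv false (v true)).1.2 ⟨true, rfl, by simp⟩
  · intro hv
    have hv' := h.a_symm rfl hv
    have key : ∀ i, R (v i) (v !i) := by rintro (_ | _) <;> assumption
    have key' : ∀ i, R (v !i) (v i) := by rintro (_ | _) <;> assumption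
    intro i q
    constructor
    · constructor
      · intro h1; exact ⟨!i, h.det (key i) h1, by simp⟩
      · rintro ⟨j, rfl, hj⟩
        obtain rfl : j = !i := by revert hj; revert i j; decide
        exact key i
    · constructor
      · intro h1; exact ⟨!i, h.codet (key' i) h1, by simp⟩
      · rintro ⟨j, rfl, hj⟩
        obtain rfl : j = !i := by revert hj; revert i j; decide
        exact key' i

-- A point without a loop is the first point of exactly one ordered matched pair.
open Classical in
lemma card_eq_of_a [Fintype V] (h : IsPart Gen.a R) : Fintype.card V = (loops R).card +
    (Finset.univ.filter fun v : Bool ↪ V => HasPattern (fun i j => i ≠ j) v R).card := by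
  have h1 : (Finset.univ.filter fun p => ¬ R p p).card =
      (Finset.univ.filter fun v : Bool ↪ V => HasPattern (fun i j => i ≠ j) v R).card := by
    symm
    refine Finset.card_bij (fun v _ => v false) ?_ ?_ ?_
    · intro v hv
      rw [Finset.mem_filter, hasPattern_ne_iff h] at hv
      refine Finset.mem_filter.2 ⟨Finset.mem_univ _, fun h2 => ?_⟩
      exact absurd (v.injective (h.det h2 hv.2)) (by simp)
    · intro v hv w hw hvw
      rw [Finset.mem_filter, hasPattern_ne_iff h] at hv hw
      ext i
      cases i
      · exact hvw
      · have := hv.2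
        rw [hvw] at this
        exact h.det this hw.2
    · intro p hp
      have hp := (Finset.mem_filter.1 hp).2
      obtain ⟨q, hq⟩ := h.touches p
      have hq : R p q := hq.elim id (h.a_symm rfl)
      have hpq : p ≠ q := by rintro rfl; exact hp hq
      have hf : Function.Injective fun i : Bool => if i then q else p := by
        rintro (_ | _) (_ | _) <;> simp [hpq, Ne.symm hpq]
      refine ⟨⟨_, hf⟩, ?_, rfl⟩
      rw [Finset.mem_filter, hasPattern_ne_iff h]
      exact ⟨Finset.mem_univ _, hq⟩
  rw [← h1, loops, ← Finset.card_univ]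
  exact (Finset.card_filter_add_card_filter_not _).symm

/-- Marking a point in each `a`-part: the point is a loop or belongs to a matched pair. After
cancelling `n` this is the recurrence for the numbers of involutions. -/
theorem card_mul_partCount_a (n : ℕ) : n * partCount Gen.a n =
    n * partCount Gen.a (n - 1) + n * (n - 1) * partCount Gen.a (n - 2) := by
  classical
  have := sum_card_hasPattern (V := Fin n) isPart_ne
  have h2 : n.descFactorial 2 = n * (n - 1) := by
    simp [Nat.descFactorial_succ, mul_comm]
  rw [Fintype.card_bool, Fintype.card_fin, h2] at this
  have h3 := sum_card_loops (V := Fin n) Gen.a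
  rw [Fintype.card_fin] at h3
  rw [← this, ← h3, ← Finset.sum_add_distrib,
    ← Finset.sum_congr rfl fun R hR => card_eq_of_a (mem_parts.1 hR)]
  simp [card_parts, mul_comm]

/-- Arrows indexed by `ι`. -/
def arrows (ι : Type*) (i j : ι × Bool) : Prop := i.1 = j.1 ∧ i.2 = false ∧ j.2 = true

lemma isPart_arrows (ι : Type*) : IsPart Gen.b (arrows ι) where
  det := by
    rintro ⟨i, i'⟩ ⟨j, j'⟩ ⟨k, k'⟩ ⟨h1, h2, h3⟩ ⟨h4, h5, h6⟩
    simp_all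
  codet := by
    rintro ⟨i, i'⟩ ⟨j, j'⟩ ⟨k, k'⟩ ⟨h1, h2, h3⟩ ⟨h4, h5, h6⟩
    simp_all
  a_symm h := by cases h
  b_triangle := by
    rintro - ⟨i, i'⟩ ⟨j, j'⟩ ⟨k, k'⟩ ⟨h1, h2, h3⟩ ⟨h4, h5, h6⟩
    simp_all
  touches := by
    rintro ⟨i, _ | _⟩
    · exact ⟨(i, true), Or.inl ⟨rfl, rfl, rfl⟩⟩
    · exact ⟨(i, false), Or.inr ⟨rfl, rfl, rfl⟩⟩

/-- It is enough that no edge leaves the head of an arrow: an edge into the tail would close a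
triangle, hence leave the head. -/
lemma hasPattern_arrows_iff (h : IsPart Gen.b R) {ι : Type*} (v : ι × Bool ↪ V) :
    HasPattern (arrows ι) v R ↔
      ∀ i, R (v (i, false)) (v (i, true)) ∧ ¬ ∃ r, R (v (i, true)) r := by
  constructor
  · intro hv i
    refine ⟨(hv (i, false) (v (i, true))).1.2 ⟨_, rfl, rfl, rfl, rfl⟩, ?_⟩
    rintro ⟨r, hr⟩
    obtain ⟨j, -, -, h1, -⟩ := (hv (i, true) r).1.1 hr
    cases h1
  · rintro hv ⟨i, _ | _⟩ q
    · refine ⟨⟨fun h1 => ⟨(i, true), h.det (hv i).1 h1, rfl, rfl, rfl⟩, ?_⟩, ⟨fun h1 => ?_, ?_⟩⟩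
      · rintro ⟨⟨j, _⟩, rfl, h1, h2, h3⟩
        dsimp only at h1 h2 h3
        subst h1 h3
        exact (hv i).1
      · exact absurd ⟨_, h.b_triangle rfl h1 (hv i).1⟩ (hv i).2
      · rintro ⟨⟨j, _⟩, rfl, h1, h2, h3⟩
        cases h3
    · refine ⟨⟨fun h1 => absurd ⟨q, h1⟩ (hv i).2, ?_⟩,
        ⟨fun h1 => ⟨(i, false), h.codet (hv i).1 h1, rfl, rfl, rfl⟩, ?_⟩⟩
      · rintro ⟨⟨j, _⟩, rfl, h1, h2, h3⟩
        cases h2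
      · rintro ⟨⟨j, _⟩, rfl, h1, h2, h3⟩
        dsimp only at h1 h2 h3
        subst h1 h2
        exact (hv j).1

open Classical in
lemma card_sources_eq [Fintype V] (h : IsPart Gen.b R) : (sources R).card =
    (Finset.univ.filter fun v : Unit × Bool ↪ V => HasPattern (arrows Unit) v R).card := by
  symm
  refine Finset.card_bij (fun v _ => v ((), false)) ?_ ?_ ?_
  · intro v hv
    rw [Finset.mem_filter, hasPattern_arrows_iff h] at hv
    refine Finset.mem_filter.2 ⟨Finset.mem_univ _, v ((), true), ?_, hv.2 ()⟩
    exact fun h1 => absurd (v.injective h1) (by simp)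
  · intro v hv w hw hvw
    rw [Finset.mem_filter, hasPattern_arrows_iff h] at hv hw
    ext ⟨_, _ | _⟩
    · exact hvw
    · have := (hv.2 ()).1
      rw [hvw] at this
      exact h.det this (hw.2 ()).1
  · intro p hp
    obtain ⟨q, hpq, h1, h2⟩ := (Finset.mem_filter.1 hp).2
    have hf : Function.Injective fun i : Unit × Bool => if i.2 then q else p := by
      rintro ⟨_, _ | _⟩ ⟨_, _ | _⟩ <;> simp [hpq, Ne.symm hpq]
    refine ⟨⟨_, hf⟩, ?_, rfl⟩
    rw [Finset.mem_filter, hasPattern_arrows_iff h]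
    exact ⟨Finset.mem_univ _, fun _ => ⟨h1, h2⟩⟩

/-- The number of edges that are not part of a cycle, in all the possible parts. -/
theorem sum_card_sources [Fintype V] : ∑ R ∈ parts Gen.b V, (sources R).card =
    Fintype.card V * (Fintype.card V - 1) * partCount Gen.b (Fintype.card V - 2) := by
  classical
  have := sum_card_hasPattern (V := V) (isPart_arrows Unit)
  have h2 : (Fintype.card V).descFactorial 2 = Fintype.card V * (Fintype.card V - 1) := by
    simp [Nat.descFactorial_succ, mul_comm]
  simp only [Fintype.card_prod, Fintype.card_unit, Fintype.card_bool, one_mul, h2] at this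
  rw [← this]
  exact Finset.sum_congr rfl fun R hR => card_sources_eq (mem_parts.1 hR)

-- Two distinct isolated edges are disjoint, so ordered pairs of them are placements of the pattern
-- on four points.
open Classical in
lemma card_offDiag_sources_le [Fintype V] (h : IsPart Gen.b R) :
    (sources R).card * (sources R).card ≤ (sources R).card +
      (Finset.univ.filter fun v : Bool × Bool ↪ V => HasPattern (arrows Bool) v R).card := by
  have h1 : (sources R).offDiag.card ≤
      (Finset.univ.filter fun v : Bool × Bool ↪ V => HasPattern (arrows Bool) v R).card := by
    refine Finset.card_le_card_of_surjOn (fun v => (v (false, false), v (true, false))) ?_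
    rintro ⟨p, p'⟩ hpp
    simp only [Finset.mem_coe, Finset.mem_offDiag, sources, Finset.mem_filter, Finset.mem_univ,
      true_and] at hpp
    obtain ⟨⟨q, hq1, hq2, hq3⟩, ⟨q', hq1', hq2', hq3'⟩, hne⟩ := hpp
    have n1 : q ≠ q' := by rintro rfl; exact hne (h.codet hq2 hq2')
    have n2 : p ≠ q' := by rintro rfl; exact hq3' ⟨_, hq2⟩
    have n3 : p' ≠ q := by rintro rfl; exact hq3 ⟨_, hq2'⟩
    have hf : Function.Injective fun i : Bool × Bool =>
        if i.1 then (if i.2 then q' else p') else (if i.2 then q else p) := by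
      rintro ⟨_ | _, _ | _⟩ ⟨_ | _, _ | _⟩ <;>
        simp [n1, n2, n3, hne, hq1, hq1', Ne.symm n1, Ne.symm n2, Ne.symm n3, Ne.symm hne,
          Ne.symm hq1, Ne.symm hq1']
    refine ⟨⟨_, hf⟩, ?_, rfl⟩
    rw [Finset.mem_coe, Finset.mem_filter, hasPattern_arrows_iff h]
    refine ⟨Finset.mem_univ _, ?_⟩
    rintro (_ | _)
    exacts [⟨hq2, hq3⟩, ⟨hq2', hq3'⟩]
  rw [Finset.offDiag_card] at h1
  omega

theorem sum_card_sources_sq_le [Fintype V] : ∑ R ∈ parts Gen.b V, (sources R).card * (sources R).card ≤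
    Fintype.card V * (Fintype.card V - 1) * partCount Gen.b (Fintype.card V - 2) +
      (Fintype.card V).descFactorial 4 * partCount Gen.b (Fintype.card V - 4) := by
  classical
  have := sum_card_hasPattern (V := V) (isPart_arrows Bool)
  simp only [Fintype.card_prod, Fintype.card_bool] at this
  rw [show 2 * 2 = 4 from rfl] at this
  rw [← this, ← sum_card_sources, ← Finset.sum_add_distrib]
  exact Finset.sum_le_sum fun R hR => card_offDiag_sources_le (mem_parts.1 hR)

lemma isPart_triangle : IsPart Gen.b (fun i j : Fin 3 => j = i + 1) where
  det {p q r} := by revert p q r; decide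
  codet {p q r} := by revert p q r; decide
  a_symm h := by cases h
  b_triangle _ {p q r} := by revert p q r; decide
  touches p := ⟨p + 1, Or.inl rfl⟩

lemma hasPattern_triangle_iff (h : IsPart Gen.b R) (v : Fin 3 ↪ V) :
    HasPattern (fun i j : Fin 3 => j = i + 1) v R ↔ R (v 0) (v 1) ∧ R (v 1) (v 2) := by
  constructor
  · intro hv
    exact ⟨(hv 0 (v 1)).1.2 ⟨1, rfl, rfl⟩, (hv 1 (v 2)).1.2 ⟨2, rfl, rfl⟩⟩
  · rintro ⟨h1, h2⟩
    have h3 := h.b_triangle rfl h1 h2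
    have key : ∀ i, R (v i) (v (i + 1)) := by
      intro i; fin_cases i <;> assumption
    intro i q
    refine ⟨⟨fun h4 => ⟨i + 1, h.det (key i) h4, rfl⟩, ?_⟩,
      ⟨fun h4 => ⟨i + 2, ?_, ?_⟩, ?_⟩⟩
    · rintro ⟨j, rfl, rfl⟩; exact key i
    · refine h.codet (p := v i) ?_ h4
      have := key (i + 2)
      rwa [show i + 2 + 1 = i from (by decide : ∀ i : Fin 3, i + 2 + 1 = i) i] at this
    · exact (by decide : ∀ i : Fin 3, i = i + 2 + 1) i
    · rintro ⟨j, rfl, rfl⟩; exact key j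

open Classical in
lemma card_corners_eq [Fintype V] (h : IsPart Gen.b R) : (Finset.univ.filter (IsCorner R)).card =
    (Finset.univ.filter fun v : Fin 3 ↪ V => HasPattern (fun i j => j = i + 1) v R).card := by
  symm
  refine Finset.card_bij (fun v _ => v 0) ?_ ?_ ?_
  · intro v hv
    rw [Finset.mem_filter, hasPattern_triangle_iff h] at hv
    refine Finset.mem_filter.2 ⟨Finset.mem_univ _, v 1, v 2, ?_, ?_, ?_, hv.2.1, hv.2.2,
      h.b_triangle rfl hv.2.1 hv.2.2⟩
    all_goals exact fun h1 => absurd (v.injective h1) (by decide)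
  · intro v hv w hw hvw
    rw [Finset.mem_filter, hasPattern_triangle_iff h] at hv hw
    have h1 : v 1 = w 1 := by
      have := hv.2.1
      rw [hvw] at this
      exact h.det this hw.2.1
    have h2 : v 2 = w 2 := by
      have := hv.2.2
      rw [h1] at this
      exact h.det this hw.2.2
    ext i
    fin_cases i <;> assumption
  · intro p hp
    obtain ⟨q, r, n1, n2, n3, h1, h2, h3⟩ := (Finset.mem_filter.1 hp).2
    refine ⟨⟨![p, q, r], ?_⟩, ?_, rfl⟩
    · intro i j
      fin_cases i <;> fin_cases j <;>
        simp [n1, n2, n3, Ne.symm n1, Ne.symm n2, Ne.symm n3]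
    · rw [Finset.mem_filter, hasPattern_triangle_iff h]
      exact ⟨Finset.mem_univ _, h1, h2⟩

/-- Marking a point in each `b`-part: it carries a loop, is one of the two ends of an isolated edge,
or is a corner of a triangle. -/
theorem card_mul_partCount_b (n : ℕ) : n * partCount Gen.b n =
    n * partCount Gen.b (n - 1) + 2 * (n * (n - 1) * partCount Gen.b (n - 2)) +
      n * (n - 1) * (n - 2) * partCount Gen.b (n - 3) := by
  classical
  have := sum_card_hasPattern (V := Fin n) isPart_triangle
  have h2 : n.descFactorial 3 = n * (n - 1) * (n - 2) := by
    simp only [Nat.descFactorial_succ, Nat.descFactorial_zero, Nat.sub_zero]; ring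
  rw [Fintype.card_fin, Fintype.card_fin, h2] at this
  have h3 := sum_card_loops (V := Fin n) Gen.b
  have h4 := sum_card_sources (V := Fin n)
  rw [Fintype.card_fin] at h3 h4
  rw [← this, ← h3, ← h4, Finset.mul_sum, ← Finset.sum_add_distrib, ← Finset.sum_add_distrib]
  have h5 : ∀ R ∈ parts Gen.b (Fin n), (loops R).card + 2 * (sources R).card +
      (Finset.univ.filter fun v : Fin 3 ↪ Fin n =>
        HasPattern (fun i j => j = i + 1) v R).card = n := by
    intro R hR
    rw [← card_corners_eq (mem_parts.1 hR), ← card_eq_of_b (mem_parts.1 hR), Fintype.card_fin]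
  rw [Finset.sum_congr rfl h5]
  simp [card_parts, mul_comm]

end Patterns

/-! ### The isomorphism type in terms of loops and isolated edges. -/

section ComponentCount

variable {V : Type*} [Fintype V] {E : Gen → V → V → Prop}

open Classical in
lemma mul_card_quotient (s : Setoid V) (w : V → ℕ) (m : ℕ)
    (h : ∀ p, ∑ q ∈ Finset.univ.filter (fun q => s p q), w q = m) :
    m * Nat.card (Quotient s) = ∑ q, w q := by
  rw [← Finset.sum_fiberwise Finset.univ (Quotient.mk s) w]
  have h1 : ∀ c : Quotient s, ∑ q ∈ Finset.univ.filter (fun q => Quotient.mk s q = c), w q = m := by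
    intro c
    induction c using Quotient.inductionOn with
    | h p =>
      rw [← h p]
      refine Finset.sum_congr (Finset.filter_congr fun q _ => ?_) fun _ _ => rfl
      rw [Quotient.eq]
      exact ⟨s.symm', s.symm'⟩
  rw [Finset.sum_congr rfl fun c _ => h1 c]
  simp [mul_comm]

/-- Giving weight `2` to loops and `1` to the other points makes every component weigh `2`. -/
lemma two_mul_card_quotient (hE : Good E) (hF : Full E) :
    2 * Nat.card (Quotient (compSetoid hE Gen.a)) =
      Fintype.card V + (loops (E Gen.a)).card := by
  classical
  have hR := (good_and_full_iff.1 ⟨hE, hF⟩).1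
  rw [mul_card_quotient _ (fun q => 1 + if E Gen.a q q then 1 else 0) 2]
  · rw [Finset.sum_add_distrib, loops, Finset.card_filter]
    simp
  · intro p
    obtain ⟨q, hq⟩ := hR.touches p
    have hq : E Gen.a p q := hq.elim id (hR.a_symm rfl)
    have hq' := hR.a_symm rfl hq
    by_cases hpq : p = q
    · subst hpq
      have : Finset.univ.filter (fun q => compSetoid hE Gen.a p q) = {p} := by
        ext r
        simp only [Finset.mem_filter, Finset.mem_univ, true_and, Finset.mem_singleton]
        constructor
        · rintro (h | h | h)
          exacts [h.symm, hR.det h hq, hR.codet h hq]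
        · rintro rfl; exact Or.inl rfl
      rw [this]; simp [hq]
    · have : Finset.univ.filter (fun q => compSetoid hE Gen.a p q) = {p, q} := by
        ext r
        simp only [Finset.mem_filter, Finset.mem_univ, true_and, Finset.mem_singleton,
          Finset.mem_insert]
        constructor
        · rintro (h | h | h)
          exacts [Or.inl h.symm, Or.inr (hR.det h hq), Or.inr (hR.codet h hq')]
        · rintro (rfl | rfl)
          exacts [Or.inl rfl, Or.inr (Or.inl hq)]
      have h1 : ¬ E Gen.a p p := fun h => hpq (hR.det h hq)
      have h2 : ¬ E Gen.a q q := fun h => hpq (hR.det hq' h)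
      rw [this, Finset.sum_pair hpq]; simp [h1, h2]

/-- Weight `3` on loops, `2` on origins of isolated edges and `1` on the other points makes every
component weigh `3`. -/
lemma three_mul_card_quotient (hE : Good E) (hF : Full E) :
    3 * Nat.card (Quotient (compSetoid hE Gen.b)) =
      Fintype.card V + 2 * (loops (E Gen.b)).card + (sources (E Gen.b)).card := by
  classical
  have hR := (good_and_full_iff.1 ⟨hE, hF⟩).2
  set R := E Gen.b with hRdef
  rw [mul_card_quotient _ (fun q => 1 + 2 * (if R q q then 1 else 0) +
    if IsSource R q then 1 else 0) 3]
  · rw [Finset.sum_add_distrib, Finset.sum_add_distrib, loops, sources, Finset.card_filter,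
      Finset.card_filter, ← Finset.mul_sum]
    simp
  · have hedge : ∀ p q, q ≠ p → R p q → ¬ (∃ r, R q r) → (¬ R p p ∧ ¬ R q q ∧ IsSource R p ∧
        ¬ IsSource R q) ∧ ∀ r, (p = r ∨ R p r ∨ R r p) ∨ (q = r ∨ R q r ∨ R r q) →
          r = p ∨ r = q := by
      intro p q hpq h1 h2
      refine ⟨⟨fun h => hpq (hR.det h1 h), fun h => h2 ⟨_, h⟩, ⟨q, hpq, h1, h2⟩,
        fun ⟨r, _, h, _⟩ => h2 ⟨r, h⟩⟩, ?_⟩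
      rintro r ((h | h | h) | (h | h | h))
      · exact Or.inl h.symm
      · exact Or.inr (hR.det h h1)
      · exact absurd ⟨_, hR.b_triangle rfl h h1⟩ h2
      · exact Or.inr h.symm
      · exact absurd ⟨_, h⟩ h2
      · exact Or.inl (hR.codet h h1)
    intro p
    rcases hR.cases_b p with hp | ⟨q, hpq, h1, h2⟩ | ⟨q, hpq, h1, h2⟩ |
      ⟨q, r, hpq, hqr, hrp, h1, h2, h3⟩
    · have : Finset.univ.filter (fun q => compSetoid hE Gen.b p q) = {p} := by
        ext r
        simp only [Finset.mem_filter, Finset.mem_univ, true_and, Finset.mem_singleton]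
        constructor
        · rintro (h | h | h)
          exacts [h.symm, hR.det h hp, hR.codet h hp]
        · rintro rfl; exact Or.inl rfl
      have h' : ¬ IsSource R p := by
        rintro ⟨q, hq, h2, -⟩; exact hq (hR.det h2 hp)
      rw [this]; simp [hp, h']
    · obtain ⟨⟨g1, g2, g3, g4⟩, hall⟩ := hedge p q hpq h1 h2
      have : Finset.univ.filter (fun q => compSetoid hE Gen.b p q) = {p, q} := by
        ext r
        simp only [Finset.mem_filter, Finset.mem_univ, true_and, Finset.mem_singleton,
          Finset.mem_insert]
        refine ⟨fun h => hall r (Or.inl h), ?_⟩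
        rintro (rfl | rfl)
        exacts [Or.inl rfl, Or.inr (Or.inl h1)]
      rw [this, Finset.sum_pair hpq.symm]; simp [g1, g2, g3, g4]
    · obtain ⟨⟨g1, g2, g3, g4⟩, hall⟩ := hedge q p hpq.symm h1 h2
      have : Finset.univ.filter (fun q => compSetoid hE Gen.b p q) = {q, p} := by
        ext r
        simp only [Finset.mem_filter, Finset.mem_univ, true_and, Finset.mem_singleton,
          Finset.mem_insert]
        refine ⟨fun h => hall r (Or.inr h), ?_⟩
        rintro (rfl | rfl)
        exacts [Or.inr (Or.inr h1), Or.inl rfl]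
      rw [this, Finset.sum_pair hpq]; simp [g1, g2, g3, g4]
    · have : Finset.univ.filter (fun q => compSetoid hE Gen.b p q) = {p, q, r} := by
        ext s
        simp only [Finset.mem_filter, Finset.mem_univ, true_and, Finset.mem_singleton,
          Finset.mem_insert]
        constructor
        · rintro (h | h | h)
          exacts [Or.inl h.symm, Or.inr (Or.inl (hR.det h h1)), Or.inr (Or.inr (hR.codet h h3))]
        · rintro (rfl | rfl | rfl)
          exacts [Or.inl rfl, Or.inr (Or.inl h1), Or.inr (Or.inr h3)]
      have hns : ∀ p q r, R p q → R q r → ¬ IsSource R p := by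
        rintro p q r h1 h2 ⟨q', -, h3, h4⟩
        obtain rfl := hR.det h1 h3
        exact h4 ⟨r, h2⟩
      have g1 : ¬ R p p := fun h => hpq (hR.det h h1)
      have g2 : ¬ R q q := fun h => hqr (hR.det h h2)
      have g3 : ¬ R r r := fun h => hrp (hR.det h h3)
      rw [this, Finset.sum_insert (by simp [hpq, hrp.symm]), Finset.sum_pair hqr]
      simp [g1, g2, g3, hns p q r h1 h2, hns q r p h2 h3, hns r p q h3 h1]

lemma card_component (hE : Good E) : Nat.card (Component hE) =
    Nat.card (Quotient (compSetoid hE Gen.a)) + Nat.card (Quotient (compSetoid hE Gen.b)) := by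
  rw [Nat.card_sigma]
  change ∑ x ∈ ({Gen.a, Gen.b} : Finset Gen), _ = _
  rw [Finset.sum_pair (by simp)]

lemma card_component_le (hE : Good E) (hC : Conn E) (v : V) :
    Nat.card (Component hE) ≤ Fintype.card V + 1 := by
  obtain ⟨f, par, γ, hpar, -⟩ := exists_tree hE hC v
  have := card_parents hpar
  omega

lemma natCard_eq_card_loops (R : V → V → Prop) : Nat.card {p // R p p} = (loops R).card := by
  classical
  rw [Nat.card_eq_fintype_card, Fintype.card_subtype, loops]

/-- The isomorphism type of the group of the loops of a connected structure. -/
theorem isoType_loopSubgroup (hE : E ∈ connStructures V) (v : V) :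
    (isoType (loopSubgroup E v)).1 = (loops (E Gen.a)).card ∧
    (isoType (loopSubgroup E v)).2.1 = (loops (E Gen.b)).card ∧
    ((isoType (loopSubgroup E v)).2.2 : ℝ) = (Fintype.card V : ℝ) / 6 + 1 -
      ((loops (E Gen.a)).card : ℝ) / 2 - 2 * ((loops (E Gen.b)).card : ℝ) / 3 -
      ((sources (E Gen.b)).card : ℝ) / 3 := by
  obtain ⟨h1, h2, h3⟩ := mem_connStructures.1 hE
  rw [(h1.hasIsoType h3 v).isoType_eq]
  refine ⟨natCard_eq_card_loops _, natCard_eq_card_loops _, ?_⟩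
  have ha : (2 : ℝ) * (Nat.card (Quotient (compSetoid h1 Gen.a)) : ℝ) =
      Fintype.card V + (loops (E Gen.a)).card := by exact_mod_cast two_mul_card_quotient h1 h2
  have hb : (3 : ℝ) * (Nat.card (Quotient (compSetoid h1 Gen.b)) : ℝ) =
      Fintype.card V + 2 * (loops (E Gen.b)).card + (sources (E Gen.b)).card := by
    exact_mod_cast three_mul_card_quotient h1 h2
  rw [Nat.cast_sub (card_component_le h1 h3 v), card_component]
  push_cast
  linarith

end ComponentCount

/-! ### Counting disconnected structures. -/

section Structures

variable {V : Type*} [Fintype V]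

open Classical in
/-- The structures on a finite set. -/
def structures (V : Type*) [Fintype V] : Finset (Gen → V → V → Prop) :=
  Finset.univ.filter fun E => Good E ∧ Full E

lemma mem_structures {E : Gen → V → V → Prop} : E ∈ structures V ↔ Good E ∧ Full E := by
  simp [structures]

lemma connStructures_subset : connStructures V ⊆ structures V := fun _ hE =>
  mem_structures.2 ((mem_connStructures.1 hE).imp id And.left)

/-- The family of edges with given `a`- and `b`-labeled edges. -/
def joinParts (R : (V → V → Prop) × (V → V → Prop)) : Gen → V → V → Prop
  | Gen.a => R.1
  | Gen.b => R.2

lemma sum_structures (F : (V → V → Prop) → (V → V → Prop) → ℝ) :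
    ∑ E ∈ structures V, F (E Gen.a) (E Gen.b) =
      ∑ R ∈ parts Gen.a V, ∑ S ∈ parts Gen.b V, F R S := by
  rw [← Finset.sum_product']
  refine Finset.sum_bij' (fun E _ => (E Gen.a, E Gen.b)) (fun R _ => joinParts R) ?_ ?_ ?_ ?_ ?_
  · intro E hE
    rw [Finset.mem_product, mem_parts, mem_parts]
    exact good_and_full_iff.1 (mem_structures.1 hE)
  · intro R hR
    rw [Finset.mem_product, mem_parts, mem_parts] at hR
    exact mem_structures.2 (good_and_full_iff.2 hR)
  · intro E _; funext x; cases x <;> rfl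
  · intro R _; rfl
  · intro E _; rfl

/-- The number of structures on `n` points. -/
def structCount (n : ℕ) : ℕ := partCount Gen.a n * partCount Gen.b n

lemma card_structures (V : Type*) [Fintype V] :
    (structures V).card = structCount (Fintype.card V) := by
  have := sum_structures (V := V) fun _ _ => 1
  simp only [Finset.sum_const, nsmul_eq_mul, mul_one, card_parts] at this
  exact_mod_cast this

lemma good_restrict {V : Type*} {E : Gen → V → V → Prop} (hE : Good E) (S : Set V) :
    Good fun x (p q : S) => E x p q :=
  ⟨fun h1 h2 => Subtype.ext (hE.det h1 h2), fun h1 h2 => Subtype.ext (hE.codet h1 h2),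
    fun h => hE.a_symm h, fun h1 h2 => hE.b_triangle h1 h2⟩

lemma full_restrict {V : Type*} {E : Gen → V → V → Prop} (hF : Full E) {S : Set V}
    (hS : ∀ x p q, E x p q → (p ∈ S ↔ q ∈ S)) : Full fun x (p q : S) => E x p q := by
  rintro x ⟨p, hp⟩
  obtain ⟨q, hq⟩ := hF x p
  refine ⟨⟨q, ?_⟩, hq⟩
  rcases hq with hq | hq
  · exact (hS _ _ _ hq).1 hp
  · exact (hS _ _ _ hq).2 hp

-- A structure without edges between `S` and its complement is determined by its restrictions to the
-- two sets, and each restriction is a structure.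
open Classical in
lemma card_invariant_le (S : Finset V) :
    ((structures V).filter fun E => ∀ x p q, E x p q → (p ∈ S ↔ q ∈ S)).card ≤
      structCount S.card * structCount (Fintype.card V - S.card) := by
  have h1 : Fintype.card (S : Set V) = S.card := by simp
  have h2 : Fintype.card ((S : Set V)ᶜ : Set V) = Fintype.card V - S.card := by
    rw [Fintype.card_compl_set, h1]
  rw [← h2, ← h1, ← card_structures, ← card_structures, ← Finset.card_product]
  refine Finset.card_le_card_of_injOn
    (fun E => (fun x p q => E x p q, fun x p q => E x p q)) ?_ ?_
  · intro E hE
    obtain ⟨h3, h4⟩ := Finset.mem_filter.1 hE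
    obtain ⟨hG, hF⟩ := mem_structures.1 h3
    rw [Finset.mem_coe, Finset.mem_product, mem_structures, mem_structures]
    refine ⟨⟨good_restrict hG _, full_restrict hF ?_⟩, good_restrict hG _, full_restrict hF ?_⟩
    · intro x p q h; simpa using h4 x p q h
    · intro x p q h; simpa using not_congr (h4 x p q h)
  · intro E hE E' hE' h
    have h4 := (Finset.mem_filter.1 hE).2
    have h4' := (Finset.mem_filter.1 hE').2
    rw [Prod.mk.injEq] at h
    funext x p q
    by_cases hp : p ∈ S <;> by_cases hq : q ∈ S
    · exact congrFun (congrFun (congrFun h.1 x) ⟨p, hp⟩) ⟨q, hq⟩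
    · exact propext ⟨fun h => absurd ((h4 x p q h).1 hp) hq, fun h => absurd ((h4' x p q h).1 hp) hq⟩
    · exact propext ⟨fun h => absurd ((h4 x p q h).2 hq) hp, fun h => absurd ((h4' x p q h).2 hq) hp⟩
    · exact congrFun (congrFun (congrFun h.2 x) ⟨p, hp⟩) ⟨q, hq⟩

/-- Few structures are not connected. -/
theorem card_structures_sdiff_le [DecidableEq (Gen → V → V → Prop)] :
    (structures V \ connStructures V).card ≤ ∑ k ∈ Finset.Icc 1 (Fintype.card V / 2),
      (Fintype.card V).choose k * (structCount k * structCount (Fintype.card V - k)) := by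
  classical
  set n := Fintype.card V with hn
  have hsub : structures V \ connStructures V ⊆ (Finset.Icc 1 (n / 2)).biUnion fun k =>
      (Finset.powersetCard k Finset.univ).biUnion fun S =>
        (structures V).filter fun E => ∀ x p q, E x p q → (p ∈ S ↔ q ∈ S) := by
    intro E hE
    rw [Finset.mem_sdiff, mem_connStructures] at hE
    obtain ⟨hE, hC⟩ := hE
    have hC : ¬ Conn E := fun h =>
      hC ⟨(mem_structures.1 hE).1, (mem_structures.1 hE).2, h⟩
    suffices h : ∃ S : Finset V, 1 ≤ S.card ∧ S.card ≤ n / 2 ∧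
        ∀ x p q, E x p q → (p ∈ S ↔ q ∈ S) by
      obtain ⟨S, h1, h2, h3⟩ := h
      simp only [Finset.mem_biUnion, Finset.mem_Icc, Finset.mem_powersetCard, Finset.mem_filter]
      exact ⟨S.card, ⟨h1, h2⟩, S, ⟨Finset.subset_univ _, rfl⟩, hE, h3⟩
    unfold Conn at hC
    push Not at hC
    obtain ⟨p, q, hpq⟩ := hC
    -- A connected component is invariant, and so is its complement. One of the two has at most half
    -- of the points.
    set S : Finset V := Finset.univ.filter fun r => Relation.ReflTransGen (Adj E) p r with hS
    have hmem : ∀ r, r ∈ S ↔ Relation.ReflTransGen (Adj E) p r := by simp [hS]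
    have hinv : ∀ x r s, E x r s → (r ∈ S ↔ s ∈ S) := by
      intro x r s h
      rw [hmem, hmem]
      exact ⟨fun h1 => h1.tail ⟨x, Or.inl h⟩, fun h1 => h1.tail ⟨x, Or.inr h⟩⟩
    have h1 : 1 ≤ S.card := Finset.card_pos.2 ⟨p, (hmem p).2 .refl⟩
    have h2 : 1 ≤ Sᶜ.card := Finset.card_pos.2 ⟨q, by rw [Finset.mem_compl, hmem]; exact hpq⟩
    have h3 := Finset.card_add_card_compl S
    by_cases h4 : S.card ≤ n / 2
    · exact ⟨S, h1, h4, hinv⟩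
    · refine ⟨Sᶜ, h2, by omega, fun x r s h => ?_⟩
      rw [Finset.mem_compl, Finset.mem_compl]
      exact not_congr (hinv x r s h)
  refine (Finset.card_le_card hsub).trans (Finset.card_biUnion_le.trans ?_)
  refine Finset.sum_le_sum fun k _ => Finset.card_biUnion_le.trans ?_
  calc _ ≤ ∑ S ∈ Finset.powersetCard k (Finset.univ : Finset V),
        structCount k * structCount (n - k) := by
        refine Finset.sum_le_sum fun S hS => ?_
        have := card_invariant_le S
        rwa [(Finset.mem_powersetCard.1 hS).2] at this
    _ = _ := by rw [Finset.sum_const, Finset.card_powersetCard, smul_eq_mul, Finset.card_univ]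

end Structures

/-! ### Asymptotics of the recurrences. -/

section Sequences

open Topology

/-- The window of width `1` above `√(n + 1)` is preserved by the recurrence, each of the two bounds
yielding the other at the next index. -/
lemma sqrt_bounds {r : ℕ → ℝ} (h0 : r 0 = 1) (hr : ∀ n, r (n + 1) = 1 + (n + 1) / r n) (n : ℕ) :
    √(n + 1 : ℝ) ≤ r n ∧ r n ≤ √(n + 1 : ℝ) + 1 := by
  induction n with
  | zero => simp [h0]
  | succ n ih =>
    obtain ⟨h1, h2⟩ := ih
    set s := √(n + 1 : ℝ) with hs
    have hs2 : s ^ 2 = n + 1 := Real.sq_sqrt (by positivity)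
    have hs0 : 0 < s := Real.sqrt_pos.2 (by positivity)
    have hr0 : 0 < r n := hs0.trans_le h1
    rw [hr, ← hs2]
    have hcast : ((n + 1 : ℕ) : ℝ) + 1 = s ^ 2 + 1 := by push_cast; rw [hs2]
    rw [hcast]
    constructor
    · have h3 : s ^ 2 / (s + 1) ≤ s ^ 2 / r n := by gcongr
      refine (Real.sqrt_le_iff.2 ⟨by positivity, ?_⟩ : √(s ^ 2 + 1) ≤ 1 + s ^ 2 / (s + 1)).trans
        (by linarith)
      have h4 : 1 + s ^ 2 / (s + 1) = (s ^ 2 + s + 1) / (s + 1) := by field_simp; ring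
      rw [h4, div_pow, le_div_iff₀ (by positivity)]
      nlinarith [sq_nonneg s]
    · have h3 : s ^ 2 / r n ≤ s := by
        rw [div_le_iff₀ hr0, sq]; gcongr
      have h4 : s ≤ √(s ^ 2 + 1) := Real.le_sqrt_of_sq_le (by linarith)
      linarith

/-- For four consecutive terms, subtracting `hc` from `hd` gives `(d - c) * (1 + 2c + cb) = 1 - c *
(2(c - b) + b(c - a))`. So `hC` is the condition for `c ≤ d`, and the last conclusion is the same
condition one index later, which lets the induction continue. -/
lemma increment_step {a b c d N : ℝ} (h1 : 1 ≤ b) (hab : a ≤ b) (hbc : b ≤ c) (hcb : c - b ≤ 1)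
    (hC : c * (2 * (c - b) + b * (c - a)) ≤ 1) (hc : c * (1 + 2 * b + b * a) = N)
    (hd : d * (1 + 2 * c + c * b) = N + 1) :
    c ≤ d ∧ d - c ≤ 1 ∧ d * (2 * (d - c) + c * (d - b)) ≤ 1 := by
  have hK : (d - c) * (1 + 2 * c + c * b) = 1 - c * (2 * (c - b) + b * (c - a)) := by
    linear_combination hd - hc
  have hc1 : 1 ≤ c := h1.trans hbc
  have hb0 : 0 < b := by linarith
  have hc0 : 0 < c := by linarith
  have hpos : 0 < 1 + 2 * c + c * b := by positivity
  have he0 : 0 ≤ d - c := by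
    by_contra h
    push Not at h
    nlinarith
  have hle : (d - c) * (1 + 2 * c + c * b) ≤ 1 := by
    rw [hK]
    have : 0 ≤ c * (2 * (c - b) + b * (c - a)) := by
      have := sub_nonneg.2 hbc
      have := sub_nonneg.2 (hab.trans hbc)
      positivity
    linarith
  have hcb1 : 1 ≤ c * b := by nlinarith
  have he1 : (d - c) * (c + 2) ≤ 1 := by
    exact (mul_le_mul_of_nonneg_left (by linarith) he0).trans hle
  have he2 : (d - c) * 3 ≤ 1 := by
    exact (mul_le_mul_of_nonneg_left (by linarith) he0).trans he1
  refine ⟨by linarith, by linarith, ?_⟩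
  have key : d * (2 * (d - c) + c * (d - b)) = 1 - c * b * (b - a) +
      (d - c) * ((d - c) * (c + 2) - 1) + c * (c - b) * (2 * (d - c) + (c - b) - 2) := by
    linear_combination hK
  have e1 : 0 ≤ c * b * (b - a) := mul_nonneg (by positivity) (sub_nonneg.2 hab)
  have e2 : (d - c) * ((d - c) * (c + 2) - 1) ≤ 0 :=
    mul_nonpos_of_nonneg_of_nonpos he0 (by linarith)
  have e3 : c * (c - b) * (2 * (d - c) + (c - b) - 2) ≤ 0 :=
    mul_nonpos_of_nonneg_of_nonpos (mul_nonneg (by positivity) (sub_nonneg.2 hbc)) (by linarith)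
  rw [key]
  linarith

/-- Monotonicity starts only at index `2`, since `y 1 = 1` exceeds `y 2 = 2/3`. The invariant of
`increment_step` is checked on `y 2`, `y 3`, `y 4`. -/
lemma monotone_of_recurrence {y : ℕ → ℝ} (h0 : y 0 = 0) (h1 : y 1 = 1)
    (hy : ∀ n : ℕ, y (n + 2) * (1 + 2 * y (n + 1) + y (n + 1) * y n) = n + 2) (n : ℕ) :
    0 ≤ y (n + 2) ∧ y (n + 2) ≤ y (n + 3) := by
  have y2 : y 2 = 2 / 3 := by
    have := hy 0
    rw [h0, h1] at this; norm_num at this; linarith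
  have y3 : y 3 = 1 := by
    have := hy 1
    rw [h1, y2] at this; norm_num at this; linarith
  have y4 : y 4 = 12 / 11 := by
    have := hy 2
    rw [y3, y2] at this; norm_num at this; linarith
  have key : ∀ n, 1 ≤ y (n + 3) ∧ y (n + 2) ≤ y (n + 3) ∧ y (n + 3) ≤ y (n + 4) ∧
      y (n + 4) - y (n + 3) ≤ 1 ∧
      y (n + 4) * (2 * (y (n + 4) - y (n + 3)) + y (n + 3) * (y (n + 4) - y (n + 2))) ≤ 1 := by
    intro n
    induction n with
    | zero => rw [y2, y3, y4]; norm_num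
    | succ n ih =>
      obtain ⟨i1, i2, i3, i4, i5⟩ := ih
      have e1 := hy (n + 2)
      have e2 := hy (n + 3)
      push_cast at e1 e2
      obtain ⟨j1, j2, j3⟩ := increment_step (N := (n : ℝ) + 2 + 2) i1 i2 i3 i4 i5 e1
        (by rw [e2]; ring)
      exact ⟨i1.trans i3, i3, j1, j2, j3⟩
  refine ⟨?_, (key n).2.1⟩
  cases n with
  | zero => rw [y2]; norm_num
  | succ n => exact zero_le_one.trans (key n).1

/-- Monotonicity replaces neighbours by `y n` in the recurrence. At index `n` it gives `n ≤ y n * (1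
+ y n)² ≤ (1 + y n)³`, and at index `n + 2` it gives `(y n)³ ≤ n + 2`. The terms used start at index
`n - 2`, whence `4 ≤ n`. -/
lemma cube_bounds {y : ℕ → ℝ} (h0 : y 0 = 0) (h1 : y 1 = 1)
    (hy : ∀ n : ℕ, y (n + 2) * (1 + 2 * y (n + 1) + y (n + 1) * y n) = n + 2) {n : ℕ}
    (hn : 4 ≤ n) : (n : ℝ) ^ (1 / 3 : ℝ) - 1 ≤ y n ∧ y n ≤ ((n : ℝ) + 2) ^ (1 / 3 : ℝ) := by
  have hmono := monotone_of_recurrence h0 h1 hy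
  obtain ⟨k, rfl⟩ := Nat.exists_eq_add_of_le' hn
  have hcube : ∀ {x : ℝ}, 0 ≤ x → (x ^ 3) ^ (1 / 3 : ℝ) = x := by
    intro x hx
    rw [← Real.rpow_natCast, ← Real.rpow_mul hx]; norm_num
  obtain ⟨a0, a1⟩ := hmono k
  obtain ⟨b0, b1⟩ := hmono (k + 1)
  obtain ⟨c0, c1⟩ := hmono (k + 2)
  obtain ⟨d0, d1⟩ := hmono (k + 3)
  obtain ⟨e0, -⟩ := hmono (k + 4)
  have r1 := hy (k + 2)
  have r2 := hy (k + 4)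
  push_cast at *
  ring_nf at *
  set p := y (2 + k)
  set q := y (3 + k)
  set r := y (4 + k)
  set s := y (5 + k)
  set t := y (6 + k)
  constructor
  · have : (4 + (k : ℝ)) ≤ (r + 1) ^ 3 := by
      rw [← r1]
      have h1 : r * q ≤ r * r := by gcongr
      have h2 : r * q * p ≤ r * r * r := by gcongr; linarith
      nlinarith
    have := Real.rpow_le_rpow (by positivity) this (by norm_num : (0 : ℝ) ≤ 1 / 3)
    rw [hcube (by positivity)] at this
    linarith
  · have : r ^ 3 ≤ 6 + (k : ℝ) := by
      rw [← r2]
      have h2 : r * r * r ≤ t * s * r := by gcongr; linarith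
      have h3 : 0 ≤ t * s := by positivity
      nlinarith
    have := Real.rpow_le_rpow (by positivity) this (by norm_num : (0 : ℝ) ≤ 1 / 3)
    rwa [hcube (by positivity)] at this

lemma tendsto_natCast_rpow {s : ℝ} (hs : 0 < s) :
    Tendsto (fun n : ℕ => (n : ℝ) ^ s) atTop atTop :=
  (tendsto_rpow_atTop hs).comp tendsto_natCast_atTop_atTop

lemma tendsto_add_const_rpow_ratio (c s : ℝ) :
    Tendsto (fun n : ℕ => ((n : ℝ) + c) ^ s / (n : ℝ) ^ s) atTop (𝓝 1) := by
  have h1 : Tendsto (fun n : ℕ => (1 + c / (n : ℝ)) ^ s) atTop (𝓝 ((1 + 0 : ℝ) ^ s)) := by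
    refine Tendsto.rpow_const ?_ (Or.inl (by norm_num))
    exact tendsto_const_nhds.add (tendsto_const_nhds.div_atTop tendsto_natCast_atTop_atTop)
  rw [add_zero, Real.one_rpow] at h1
  refine h1.congr' ?_
  filter_upwards [eventually_gt_atTop ⌈|c|⌉₊] with n hn
  have hn' : |c| < n := (Nat.le_ceil _).trans_lt (by exact_mod_cast hn)
  have hpos : (0 : ℝ) < n := (abs_nonneg c).trans_lt hn'
  rw [← Real.div_rpow (by have := neg_abs_le c; linarith) hpos.le]
  congr 1
  field_simp

lemma tendsto_ratio_of_cube_bounds {y : ℕ → ℝ}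
    (h : ∀ n : ℕ, 4 ≤ n → (n : ℝ) ^ (1 / 3 : ℝ) - 1 ≤ y n ∧ y n ≤ ((n : ℝ) + 2) ^ (1 / 3 : ℝ)) :
    Tendsto (fun n : ℕ => y n / (n : ℝ) ^ (1 / 3 : ℝ)) atTop (𝓝 1) := by
  have hlow : Tendsto (fun n : ℕ => 1 - 1 / (n : ℝ) ^ (1 / 3 : ℝ)) atTop (𝓝 (1 - 0)) :=
    tendsto_const_nhds.sub (tendsto_const_nhds.div_atTop (tendsto_natCast_rpow (by norm_num)))
  rw [sub_zero] at hlow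
  refine tendsto_of_tendsto_of_tendsto_of_le_of_le' hlow
    (tendsto_add_const_rpow_ratio 2 (1 / 3)) ?_ ?_
  · filter_upwards [eventually_ge_atTop 4] with n hn
    have hpos : (0 : ℝ) < (n : ℝ) ^ (1 / 3 : ℝ) :=
      Real.rpow_pos_of_pos (by exact_mod_cast (by omega : 0 < n)) _
    rw [le_div_iff₀ hpos, sub_mul, one_mul, div_mul_cancel₀ _ hpos.ne']
    exact (h n hn).1
  · filter_upwards [eventually_ge_atTop 4] with n hn
    gcongr
    exact (h n hn).2

lemma tendsto_ratio_of_sqrt_bounds {r : ℕ → ℝ}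
    (h : ∀ n : ℕ, √(n + 1 : ℝ) ≤ r n ∧ r n ≤ √(n + 1 : ℝ) + 1) :
    Tendsto (fun n : ℕ => (n / r (n - 1)) / (n : ℝ) ^ (1 / 2 : ℝ)) atTop (𝓝 1) := by
  have hlow : Tendsto (fun n : ℕ => (1 + 1 / (n : ℝ) ^ (1 / 2 : ℝ))⁻¹) atTop (𝓝 (1 + 0)⁻¹) :=
    (tendsto_const_nhds.add (tendsto_const_nhds.div_atTop
      (tendsto_natCast_rpow (by norm_num)))).inv₀ (by norm_num)
  rw [add_zero, inv_one] at hlow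
  refine tendsto_of_tendsto_of_tendsto_of_le_of_le' hlow tendsto_const_nhds ?_ ?_
  all_goals
    filter_upwards [eventually_ge_atTop 1] with n hn
    obtain ⟨k, rfl⟩ := Nat.exists_eq_add_of_le' hn
    have hk := h k
    rw [Nat.add_sub_cancel, ← Real.sqrt_eq_rpow]
    push_cast
    set s := √(k + 1 : ℝ) with hs
    have hs2 : s * s = k + 1 := Real.mul_self_sqrt (by positivity)
    have hs0 : 0 < s := Real.sqrt_pos.2 (by positivity)
    have hr0 : 0 < r k := hs0.trans_le hk.1
    rw [← hs2, div_div, mul_div_mul_right _ _ hs0.ne']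
  · rw [inv_eq_one_div, div_le_div_iff₀ (by positivity) hr0]
    have : s * (1 + 1 / s) = s + 1 := by field_simp
    linarith [hk.2]
  · rw [div_le_one hr0]; exact hk.1

lemma tendsto_natCast_rpow_neg {s : ℝ} (hs : 0 < s) :
    Tendsto (fun n : ℕ => (n : ℝ) ^ (-s)) atTop (𝓝 0) :=
  (tendsto_rpow_neg_atTop hs).comp tendsto_natCast_atTop_atTop

variable {q : ℕ → ℝ}

/-- Doubling the index gains a factor `2^(-1/6)`, which absorbs the relative errors of the
asymptotics. For bounded `j`, it suffices that `q` tends to `0`. -/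
lemma eventually_le_of_two_mul_le (hpos : ∀ n, 1 ≤ n → 0 < q n)
    (hq : Tendsto (fun n : ℕ => q n / (n : ℝ) ^ (-(1 / 6) : ℝ)) atTop (𝓝 1)) :
    ∃ n₁ : ℕ, ∀ m j, n₁ ≤ m → 1 ≤ j → 2 * j ≤ m → q m ≤ q j := by
  -- The square root of the gain `2^(-1/6)`: one half is spent on the lower bound for `q j`, the
  -- other on the upper bound for `q m`.
  set c : ℝ := 2 ^ (-(1 / 12) : ℝ) with hc
  have hc0 : 0 < c := by positivity
  have hc1 : c < 1 := Real.rpow_lt_one_of_one_lt_of_neg (by norm_num) (by norm_num)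
  have hcc : c⁻¹ * 2 ^ (-(1 / 6) : ℝ) = c := by
    rw [hc, ← Real.rpow_neg (by norm_num), ← Real.rpow_add (by norm_num)]; norm_num
  have e1 := hq.eventually (lt_mem_nhds hc1)
  have e2 := hq.eventually (gt_mem_nhds (one_lt_inv_iff₀.2 ⟨hc0, hc1⟩))
  obtain ⟨J, hJ⟩ := eventually_atTop.1 ((e1.and e2).and (eventually_ge_atTop 1))
  have hq0 : Tendsto q atTop (𝓝 0) := by
    have := hq.mul (tendsto_natCast_rpow_neg (s := 1 / 6) (by norm_num))
    rw [mul_zero] at this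
    refine this.congr' ?_
    filter_upwards [eventually_ge_atTop 1] with n hn
    have : (0 : ℝ) < (n : ℝ) ^ (-(1 / 6) : ℝ) :=
      Real.rpow_pos_of_pos (by exact_mod_cast hn) _
    rw [div_mul_cancel₀ _ this.ne']
  obtain ⟨a, ha0, ha⟩ : ∃ a, 0 < a ∧ ∀ j, 1 ≤ j → j < J + 2 → a ≤ q j := by
    obtain ⟨i, hi, hmin⟩ := Finset.exists_min_image (Finset.Ico 1 (J + 2)) q ⟨1, by simp⟩
    exact ⟨q i, hpos i (Finset.mem_Ico.1 hi).1, fun j h1 h2 => hmin j (Finset.mem_Ico.2 ⟨h1, h2⟩)⟩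
  obtain ⟨M, hM⟩ := eventually_atTop.1 (hq0.eventually (gt_mem_nhds ha0))
  refine ⟨max M J, fun m j hm hj hjm => ?_⟩
  by_cases hjJ : j < J + 2
  · exact (hM m ((le_max_left _ _).trans hm)).le.trans (ha j hj hjJ)
  · have h1 := (hJ j (by omega)).1.1
    have h2 := (hJ m ((le_max_right _ _).trans hm)).1.2
    have hj0 : (0 : ℝ) < j := by exact_mod_cast hj
    have hm0 : (0 : ℝ) < m := by exact_mod_cast (by omega : 0 < m)
    rw [lt_div_iff₀ (Real.rpow_pos_of_pos hj0 _)] at h1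
    rw [div_lt_iff₀ (Real.rpow_pos_of_pos hm0 _)] at h2
    refine h2.le.trans (le_trans ?_ h1.le)
    calc c⁻¹ * (m : ℝ) ^ (-(1 / 6) : ℝ) ≤ c⁻¹ * (2 * j : ℝ) ^ (-(1 / 6) : ℝ) := by
          refine mul_le_mul_of_nonneg_left ?_ (by positivity)
          exact Real.rpow_le_rpow_of_nonpos (by positivity) (by exact_mod_cast hjm) (by norm_num)
      _ = c * (j : ℝ) ^ (-(1 / 6) : ℝ) := by
          rw [Real.mul_rpow (by norm_num) hj0.le, ← mul_assoc, hcc]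

lemma prod_range_le_of_le {a : ℕ → ℝ} {r k : ℕ} (hrk : r ≤ k) (h0 : ∀ j < k, 0 ≤ a j)
    (h1 : ∀ j < k, a j ≤ 1) : ∏ j ∈ Finset.range k, a j ≤ ∏ j ∈ Finset.range r, a j := by
  rw [← Finset.prod_range_mul_prod_Ico _ hrk]
  refine mul_le_of_le_one_right ?_ ?_
  · exact Finset.prod_nonneg fun j hj => h0 j ((Finset.mem_range.1 hj).trans_le hrk)
  · exact Finset.prod_le_one (fun j hj => h0 j (Finset.mem_Ico.1 hj).2)
      fun j hj => h1 j (Finset.mem_Ico.1 hj).2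

/-- All the factors are at most `1` for large `n`, so factors may be dropped. Each kept factor is
`O(n^(-1/6))`: one is kept when `k < 7`, and seven when `k ≥ 7`, where the at most `n` terms
contribute `O(n * n^(-7/6))`. -/
lemma tendsto_sum_prod_ratio (hpos : ∀ n, 1 ≤ n → 0 < q n)
    (hq : Tendsto (fun n : ℕ => q n / (n : ℝ) ^ (-(1 / 6) : ℝ)) atTop (𝓝 1)) :
    Tendsto (fun n : ℕ => ∑ k ∈ Finset.Icc 1 (n / 2),
      ∏ j ∈ Finset.range k, q (n - k + j + 1) / q (j + 1)) atTop (𝓝 0) := by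
  obtain ⟨n₁, hn₁⟩ := eventually_le_of_two_mul_le hpos hq
  obtain ⟨n₂, hn₂⟩ := eventually_atTop.1
    ((hq.eventually (gt_mem_nhds (by norm_num : (1 : ℝ) < 2))).and (eventually_ge_atTop 1))
  -- A common bound for `q m` for all large `m ≥ n / 2`; the factor `2` covers the error in `q m ~
  -- m^(-1/6)`.
  set ω : ℕ → ℝ := fun n => 2 * ((n : ℝ) / 2) ^ (-(1 / 6) : ℝ) with hω
  have hω0 : Tendsto ω atTop (𝓝 0) := by
    have h1 : Tendsto (fun n : ℕ => (n : ℝ) / 2) atTop atTop :=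
      tendsto_natCast_atTop_atTop.atTop_div_const (by norm_num)
    have := ((tendsto_rpow_neg_atTop (by norm_num : (0 : ℝ) < 1 / 6)).comp h1).const_mul 2
    rwa [mul_zero] at this
  have hωle : ∀ n m : ℕ, n₂ ≤ m → 1 ≤ n → n ≤ 2 * m → q m ≤ ω n := by
    intro n m hm hn1 hn
    have hn0 : (0 : ℝ) < n := by exact_mod_cast hn1
    have hm0 : (0 : ℝ) < m := by exact_mod_cast (by omega : 0 < m)
    have h1 := (hn₂ m hm).1
    rw [div_lt_iff₀ (Real.rpow_pos_of_pos hm0 _)] at h1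
    refine h1.le.trans (mul_le_mul_of_nonneg_left ?_ (by norm_num))
    refine Real.rpow_le_rpow_of_nonpos (by positivity) ?_ (by norm_num)
    have : (n : ℝ) ≤ 2 * m := by exact_mod_cast hn
    linarith
  set Q : ℝ := ∏ j ∈ Finset.range 7, q (j + 1) with hQ
  have hQ0 : 0 < Q := Finset.prod_pos fun j _ => hpos _ (by omega)
  have hq1 := hpos 1 le_rfl
  have hbound : Tendsto (fun n : ℕ => 6 * (ω n / q 1) + n * (ω n ^ 7 / Q)) atTop (𝓝 0) := by
    -- For `n ≥ 1` one has `n * (ω n)^6 = 128`, so the second term equals `128 / Q * ω n` and both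
    -- terms are multiples of `ω n`.
    have h1 : Tendsto (fun n : ℕ => 6 * (ω n / q 1)) atTop (𝓝 0) := by
      have := (hω0.div_const (q 1)).const_mul 6
      simpa using this
    have h2 : Tendsto (fun n : ℕ => 128 / Q * ω n) atTop (𝓝 0) := by
      have := hω0.const_mul (128 / Q)
      simpa using this
    have h3 := h1.add h2
    rw [add_zero] at h3
    refine h3.congr' ?_
    filter_upwards [eventually_ge_atTop 1] with n hn
    have hn0 : (0 : ℝ) < (n : ℝ) / 2 := by
      have : (0 : ℝ) < n := by exact_mod_cast hn
      positivity
    congr 1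
    simp only [hω]
    set z := (n : ℝ) / 2 with hz
    have hn' : (n : ℝ) = 2 * z := by rw [hz]; ring
    have h6 : z * (z ^ (-(1 / 6) : ℝ)) ^ 6 = 1 := by
      rw [← Real.rpow_natCast, ← Real.rpow_mul hn0.le]
      norm_num
      rw [Real.rpow_neg_one, mul_inv_cancel₀ hn0.ne']
    rw [hn']
    set w := z ^ (-(1 / 6) : ℝ)
    calc 128 / Q * (2 * w) = 256 * w / Q * (z * w ^ 6) := by rw [h6]; ring
      _ = _ := by ring
  refine squeeze_zero' ?_ ?_ hbound
  · filter_upwards with n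
    exact Finset.sum_nonneg fun k _ => Finset.prod_nonneg fun j _ =>
      div_nonneg (hpos _ (by omega)).le (hpos _ (by omega)).le
  · filter_upwards [eventually_ge_atTop (2 * n₁ + 2 * n₂ + 14)] with n hn
    have hfac : ∀ k, k ≤ n / 2 → ∀ j < k, q (n - k + j + 1) / q (j + 1) ≤ 1 := by
      intro k hk j hj
      rw [div_le_one (hpos _ (by omega))]
      exact hn₁ _ _ (by omega) (by omega) (by omega)
    have hnn : ∀ k j, 0 ≤ q (n - k + j + 1) / q (j + 1) := fun k j =>
      div_nonneg (hpos _ (by omega)).le (hpos _ (by omega)).le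
    have hω' : ∀ k j, k ≤ n / 2 → q (n - k + j + 1) / q (j + 1) ≤ ω n / q (j + 1) := by
      intro k j hk
      refine div_le_div_of_nonneg_right (hωle _ _ (by omega) (by omega) (by omega))
        (hpos _ (by omega)).le
    have hω1 : 0 ≤ ω n := by simp only [hω]; positivity
    have hsplit : Finset.Icc 1 (n / 2) = Finset.Ico 1 7 ∪ Finset.Icc 7 (n / 2) := by
      ext k; simp only [Finset.mem_union, Finset.mem_Icc, Finset.mem_Ico]; omega
    have hdisj : Disjoint (Finset.Ico 1 7) (Finset.Icc 7 (n / 2)) := by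
      rw [Finset.disjoint_left]
      intro k; simp only [Finset.mem_Icc, Finset.mem_Ico]; omega
    rw [hsplit, Finset.sum_union hdisj]
    refine add_le_add ?_ ?_
    · calc _ ≤ ∑ k ∈ Finset.Ico 1 7, ω n / q 1 := by
            refine Finset.sum_le_sum fun k hk => ?_
            rw [Finset.mem_Ico] at hk
            refine (prod_range_le_of_le hk.1 (fun j _ => hnn k j) (hfac k (by omega))).trans ?_
            rw [Finset.prod_range_one]
            exact hω' k 0 (by omega)
        _ = _ := by simp
    · calc _ ≤ ∑ k ∈ Finset.Icc 7 (n / 2), ω n ^ 7 / Q := by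
            refine Finset.sum_le_sum fun k hk => ?_
            rw [Finset.mem_Icc] at hk
            refine (prod_range_le_of_le hk.1 (fun j _ => hnn k j) (hfac k hk.2)).trans ?_
            calc _ ≤ ∏ j ∈ Finset.range 7, ω n / q (j + 1) :=
                  Finset.prod_le_prod (fun j _ => hnn k j) fun j _ => hω' k j hk.2
              _ = _ := by rw [Finset.prod_div_distrib, Finset.prod_const, Finset.card_range]
        _ ≤ _ := by
            rw [Finset.sum_const, nsmul_eq_mul]
            refine mul_le_mul_of_nonneg_right ?_ (by positivity)
            rw [Nat.card_Icc]
            exact_mod_cast (by omega)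

/-- Discarding a set of small measure does not change the order of magnitude of a mean value with
a controlled second moment. -/
lemma tendsto_conditional {A D δ : ℕ → ℝ} {C : ℝ} (hA : Tendsto A atTop (𝓝 1))
    (hδ : Tendsto δ atTop (𝓝 0)) (hD0 : ∀ᶠ n in atTop, 0 ≤ D n)
    (hD : ∀ᶠ n in atTop, D n ^ 2 ≤ C * δ n) :
    Tendsto (fun n => (A n - D n) / (1 - δ n)) atTop (𝓝 1) := by
  have hD' : Tendsto D atTop (𝓝 0) := by
    have h1 : Tendsto (fun n => √(C * δ n)) atTop (𝓝 0) := by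
      have := (hδ.const_mul C).sqrt
      simpa using this
    refine squeeze_zero' hD0 ?_ h1
    filter_upwards [hD] with n hn
    exact Real.le_sqrt_of_sq_le hn
  have := (hA.sub hD').div (tendsto_const_nhds.sub hδ) (by norm_num : (1 : ℝ) - 0 ≠ 0)
  rw [sub_zero, div_one] at this
  exact this

end Sequences

/-! ### Growth of the counts and rarity of disconnected structures. -/

section Counts

open Topology

lemma partCount_pos (x : Gen) (n : ℕ) : 0 < partCount x n :=
  have : Nonempty {R : Fin n → Fin n → Prop // IsPart x R} := ⟨⟨_, isPart_eq x (Fin n)⟩⟩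
  Nat.card_pos

lemma partCount_zero (x : Gen) : partCount x 0 = 1 := by
  have h1 : Subsingleton {R : Fin 0 → Fin 0 → Prop // IsPart x R} := inferInstance
  have h2 : Nonempty {R : Fin 0 → Fin 0 → Prop // IsPart x R} := ⟨⟨_, isPart_eq x (Fin 0)⟩⟩
  exact Nat.card_eq_one_iff_unique.2 ⟨h1, h2⟩

lemma partCount_cast_pos (x : Gen) (n : ℕ) : (0 : ℝ) < partCount x n := by
  exact_mod_cast partCount_pos x n

/-- The mean number of `x`-labeled loops. -/
def meanLoops (x : Gen) (n : ℕ) : ℝ := n * partCount x (n - 1) / partCount x n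

/-- The growth ratio of the numbers of involutions. -/
def ratioA (n : ℕ) : ℝ := partCount Gen.a (n + 1) / partCount Gen.a n

/-- Dividing the recurrence of `card_mul_partCount_a` by the previous count gives the hypothesis of
`sqrt_bounds`. -/
lemma ratioA_bounds (n : ℕ) : √(n + 1 : ℝ) ≤ ratioA n ∧ ratioA n ≤ √(n + 1 : ℝ) + 1 := by
  refine sqrt_bounds ?_ ?_ n
  · have := card_mul_partCount_a 1
    simp only [one_mul, Nat.sub_self, mul_zero, zero_mul, add_zero] at this
    rw [ratioA, zero_add, this]
    exact div_self (partCount_cast_pos _ _).ne'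
  · intro n
    have h : ((n + 2 : ℕ) : ℝ) * partCount Gen.a (n + 2) =
        ((n + 2 : ℕ) : ℝ) * partCount Gen.a (n + 1) +
          ((n + 2 : ℕ) : ℝ) * ((n + 1 : ℕ) : ℝ) * partCount Gen.a n := by
      exact_mod_cast card_mul_partCount_a (n + 2)
    have h0 := partCount_cast_pos Gen.a n
    have h1 := partCount_cast_pos Gen.a (n + 1)
    push_cast at h
    have h2 : (partCount Gen.a (n + 2) : ℝ) =
        partCount Gen.a (n + 1) + (n + 1) * partCount Gen.a n := by
      have h3 : ((n : ℝ) + 2) ≠ 0 := by positivity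
      refine mul_left_cancel₀ h3 ?_
      rw [h]; ring
    simp only [ratioA]
    rw [h2]
    field_simp

lemma meanLoops_a {n : ℕ} (hn : 1 ≤ n) : meanLoops Gen.a n = n / ratioA (n - 1) := by
  rw [meanLoops, ratioA, Nat.sub_add_cancel hn, div_div_eq_mul_div]

lemma meanLoops_nonneg (x : Gen) (n : ℕ) : 0 ≤ meanLoops x n := by
  unfold meanLoops; positivity

lemma meanLoops_a_le (n : ℕ) : meanLoops Gen.a n ≤ √n := by
  rcases Nat.eq_zero_or_pos n with rfl | hn
  · simp [meanLoops]
  · rw [meanLoops_a hn]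
    have h := (ratioA_bounds (n - 1)).1
    have hc : ((n - 1 : ℕ) : ℝ) + 1 = n := by exact_mod_cast Nat.sub_add_cancel hn
    rw [hc] at h
    have h0 : 0 < √(n : ℝ) := Real.sqrt_pos.2 (by exact_mod_cast hn)
    rw [div_le_iff₀ (h0.trans_le h)]
    calc (n : ℝ) = √n * √n := (Real.mul_self_sqrt (Nat.cast_nonneg n)).symm
      _ ≤ _ := by gcongr

lemma tendsto_meanLoops_a :
    Tendsto (fun n : ℕ => meanLoops Gen.a n / (n : ℝ) ^ (1 / 2 : ℝ)) atTop (𝓝 1) := by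
  refine (tendsto_ratio_of_sqrt_bounds ratioA_bounds).congr' ?_
  filter_upwards [eventually_ge_atTop 1] with n hn
  rw [meanLoops_a hn]

/-- Dividing `card_mul_partCount_b` by the count at the same index expresses it through products of
consecutive values of `meanLoops Gen.b`, which is the recurrence of `cube_bounds`. -/
lemma meanLoops_b_bounds {n : ℕ} (hn : 4 ≤ n) :
    (n : ℝ) ^ (1 / 3 : ℝ) - 1 ≤ meanLoops Gen.b n ∧
      meanLoops Gen.b n ≤ ((n : ℝ) + 2) ^ (1 / 3 : ℝ) := by
  refine cube_bounds ?_ ?_ ?_ hn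
  · simp [meanLoops]
  · have := card_mul_partCount_b 1
    simp only [one_mul, Nat.sub_self, mul_zero, zero_mul, add_zero] at this
    rw [meanLoops, Nat.sub_self, this, Nat.cast_one, one_mul]
    exact div_self (partCount_cast_pos _ _).ne'
  · intro n
    have h : ((n + 2 : ℕ) : ℝ) * partCount Gen.b (n + 2) =
        ((n + 2 : ℕ) : ℝ) * partCount Gen.b (n + 1) +
          2 * (((n + 2 : ℕ) : ℝ) * ((n + 1 : ℕ) : ℝ) * partCount Gen.b n) +
          ((n + 2 : ℕ) : ℝ) * ((n + 1 : ℕ) : ℝ) * (n : ℝ) * partCount Gen.b (n - 1) := by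
      have := card_mul_partCount_b (n + 2)
      rw [show n + 2 - 3 = n - 1 by omega] at this
      exact_mod_cast this
    have h0 := partCount_cast_pos Gen.b n
    have h1 := partCount_cast_pos Gen.b (n + 1)
    have h2 := partCount_cast_pos Gen.b (n + 2)
    push_cast at h
    simp only [meanLoops, Nat.add_sub_cancel, show n + 2 - 1 = n + 1 from rfl]
    push_cast
    have h3 : ((n : ℝ) + 2) ≠ 0 := by positivity
    have h4 : (partCount Gen.b (n + 2) : ℝ) = partCount Gen.b (n + 1) +
        2 * ((n + 1) * partCount Gen.b n) + (n + 1) * n * partCount Gen.b (n - 1) := by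
      refine mul_left_cancel₀ h3 ?_
      rw [h]; ring
    field_simp
    rw [h4]
    ring

lemma tendsto_meanLoops_b :
    Tendsto (fun n : ℕ => meanLoops Gen.b n / (n : ℝ) ^ (1 / 3 : ℝ)) atTop (𝓝 1) :=
  tendsto_ratio_of_cube_bounds fun _ hn => meanLoops_b_bounds hn

lemma meanLoops_b_le {n m : ℕ} (hm : 4 ≤ m) (hmn : m ≤ n) :
    meanLoops Gen.b m ≤ 2 * (n : ℝ) ^ (1 / 3 : ℝ) := by
  refine (meanLoops_b_bounds hm).2.trans ?_
  have h2 : (2 : ℝ) = 8 ^ (1 / 3 : ℝ) := by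
    rw [show (8 : ℝ) = 2 ^ (3 : ℝ) by norm_num, ← Real.rpow_mul (by norm_num)]; norm_num
  have h3 : (m : ℝ) ≤ n := by exact_mod_cast hmn
  have h4 : (4 : ℝ) ≤ m := by exact_mod_cast hm
  calc ((m : ℝ) + 2) ^ (1 / 3 : ℝ) ≤ (8 * n : ℝ) ^ (1 / 3 : ℝ) := by
        apply Real.rpow_le_rpow <;> linarith
    _ = _ := by rw [Real.mul_rpow (by norm_num) (by positivity), ← h2]

lemma structCount_cast_pos (n : ℕ) : (0 : ℝ) < structCount n := by
  rw [structCount, Nat.cast_mul]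
  exact mul_pos (partCount_cast_pos _ _) (partCount_cast_pos _ _)

/-- The normalized number of structures. -/
def weight (n : ℕ) : ℝ := structCount n / n.factorial

lemma weight_pos (n : ℕ) : 0 < weight n := by
  have := structCount_cast_pos n
  unfold weight
  positivity

lemma weight_zero : weight 0 = 1 := by simp [weight, structCount, partCount_zero]

/-- The ratio of consecutive normalized numbers of structures. -/
def weightRatio (n : ℕ) : ℝ := weight (n - 1) / weight n

lemma weightRatio_pos (n : ℕ) : 0 < weightRatio n := div_pos (weight_pos _) (weight_pos _)

lemma weightRatio_eq {n : ℕ} (hn : 1 ≤ n) :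
    weightRatio n = meanLoops Gen.a n * meanLoops Gen.b n / n := by
  obtain ⟨k, rfl⟩ := Nat.exists_eq_add_of_le' hn
  have h1 := partCount_cast_pos Gen.a (k + 1)
  have h2 := partCount_cast_pos Gen.b (k + 1)
  have h3 : ((k : ℝ) + 1) ≠ 0 := by positivity
  simp only [weightRatio, weight, meanLoops, structCount, Nat.add_sub_cancel, Nat.factorial_succ]
  push_cast
  have h4 : (k.factorial : ℝ) ≠ 0 := by positivity
  field_simp

/-- The exponent is `1/2 + 1/3 - 1`. Its being negative is what makes connected structures prevail.
-/
lemma tendsto_weightRatio :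
    Tendsto (fun n : ℕ => weightRatio n / (n : ℝ) ^ (-(1 / 6) : ℝ)) atTop (𝓝 1) := by
  have h := tendsto_meanLoops_a.mul tendsto_meanLoops_b
  rw [mul_one] at h
  refine h.congr' ?_
  filter_upwards [eventually_ge_atTop 1] with n hn
  have hn0 : (0 : ℝ) < n := by exact_mod_cast hn
  have h1 : (n : ℝ) ^ (1 / 2 : ℝ) * (n : ℝ) ^ (1 / 3 : ℝ) = n * (n : ℝ) ^ (-(1 / 6) : ℝ) := by
    rw [← Real.rpow_add hn0, ← Real.rpow_one_add' hn0.le (by norm_num)]; norm_num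
  rw [weightRatio_eq hn, div_mul_div_comm, h1, div_div]

lemma weight_eq_mul_prod (m k : ℕ) :
    weight m = weight (m + k) * ∏ j ∈ Finset.range k, weightRatio (m + j + 1) := by
  induction k with
  | zero => simp
  | succ k ih =>
    rw [Finset.prod_range_succ, ih, mul_comm (∏ j ∈ Finset.range k, _), ← mul_assoc]
    congr 1
    rw [weightRatio, Nat.add_sub_cancel, ← add_assoc, mul_div_cancel₀ _ (weight_pos _).ne']

/-- After division by factorials the left side is `weight k * weight (n - k) / weight n`, and both
`weight k` and `weight (n - k) / weight n` telescope into `k` consecutive ratios. -/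
lemma choose_mul_structCount {n k : ℕ} (hk : k ≤ n) :
    (n.choose k : ℝ) * (structCount k * structCount (n - k)) / structCount n =
      ∏ j ∈ Finset.range k, weightRatio (n - k + j + 1) / weightRatio (j + 1) := by
  have h1 := weight_eq_mul_prod 0 k
  have h2 := weight_eq_mul_prod (n - k) k
  rw [Nat.sub_add_cancel hk] at h2
  simp only [zero_add, weight_zero] at h1
  have hQ : (0 : ℝ) < ∏ j ∈ Finset.range k, weightRatio (j + 1) :=
    Finset.prod_pos fun j _ => weightRatio_pos _
  have h3 : (n.choose k : ℝ) * (structCount k * structCount (n - k)) / structCount n =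
      weight k * weight (n - k) / weight n := by
    have hn := structCount_cast_pos n
    rw [Nat.cast_choose ℝ hk]
    unfold weight
    field_simp
  rw [h3, Finset.prod_div_distrib, eq_div_iff hQ.ne', h2]
  have hn := weight_pos n
  field_simp
  rw [mul_right_comm, ← h1, one_mul]

open Classical in
/-- The proportion of structures that are not connected. -/
def disconnectedRatio (n : ℕ) : ℝ :=
  (structures (Fin n) \ connStructures (Fin n)).card / structCount n

theorem tendsto_disconnectedRatio : Tendsto disconnectedRatio atTop (𝓝 0) := by
  classical
  refine squeeze_zero (fun n => by unfold disconnectedRatio; positivity) (fun n => ?_)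
    (tendsto_sum_prod_ratio (fun n _ => weightRatio_pos n) tendsto_weightRatio)
  have h := card_structures_sdiff_le (V := Fin n)
  rw [Fintype.card_fin] at h
  rw [disconnectedRatio, div_le_iff₀ (structCount_cast_pos n), Finset.sum_mul]
  have h' : (((structures (Fin n) \ connStructures (Fin n)).card : ℕ) : ℝ) ≤
      ∑ k ∈ Finset.Icc 1 (n / 2), (n.choose k : ℝ) * (structCount k * structCount (n - k)) := by
    exact_mod_cast h
  refine le_trans (le_of_eq ?_) (h'.trans (Finset.sum_le_sum fun k hk => ?_))
  · congr
  · rw [← choose_mul_structCount (by have := (Finset.mem_Icc.1 hk).2; omega),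
      div_mul_cancel₀ _ (structCount_cast_pos n).ne']

/-- Averages over the connected structures are equivalent to averages over all the structures. -/
theorem tendsto_average {X : ∀ n, (Gen → Fin n → Fin n → Prop) → ℝ} {s : ℕ → ℝ} {C : ℝ}
    (hX : ∀ n E, 0 ≤ X n E) (hs : ∀ᶠ n in atTop, 0 < s n)
    (h1 : Tendsto (fun n => (∑ E ∈ structures (Fin n), X n E) / structCount n / s n) atTop (𝓝 1))
    (h2 : ∀ᶠ n in atTop, ∑ E ∈ structures (Fin n), X n E ^ 2 ≤ C * s n ^ 2 * structCount n) :
    Tendsto (fun n => (∑ E ∈ connStructures (Fin n), X n E) /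
      ((connStructures (Fin n)).card : ℝ) / s n) atTop (𝓝 1) := by
  classical
  set D : ℕ → ℝ := fun n => (∑ E ∈ structures (Fin n) \ connStructures (Fin n), X n E) /
    structCount n / s n with hD
  have hδ : ∀ n, disconnectedRatio n =
      ((structures (Fin n) \ connStructures (Fin n)).card : ℝ) / structCount n := by
    intro n; unfold disconnectedRatio; congr
  refine (tendsto_conditional (D := D) (C := C) h1 tendsto_disconnectedRatio ?_ ?_).congr' ?_
  · filter_upwards [hs] with n hn
    simp only [hD]
    have := Finset.sum_nonneg fun E (_ : E ∈ structures (Fin n) \ connStructures (Fin n)) => hX n E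
    positivity
  · filter_upwards [hs, h2] with n hn hn2
    have hT := structCount_cast_pos n
    -- Cauchy–Schwarz: the contribution of the disconnected structures is at most the square root of
    -- their proportion times the second moment over all structures.
    have h3 := sq_sum_le_card_mul_sum_sq (s := structures (Fin n) \ connStructures (Fin n))
      (f := X n)
    have h4 : ∑ E ∈ structures (Fin n) \ connStructures (Fin n), X n E ^ 2 ≤
        ∑ E ∈ structures (Fin n), X n E ^ 2 :=
      Finset.sum_le_sum_of_subset_of_nonneg Finset.sdiff_subset fun _ _ _ => sq_nonneg _
    rw [hδ]
    simp only [hD]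
    rw [div_pow, div_pow, div_div, div_le_iff₀ (by positivity)]
    calc _ ≤ ((structures (Fin n) \ connStructures (Fin n)).card : ℝ) *
          (C * s n ^ 2 * structCount n) := h3.trans (by gcongr; exact h4.trans hn2)
      _ = _ := by field_simp
  · filter_upwards [hs] with n hn
    have hT := structCount_cast_pos n
    have h3 : ∑ E ∈ connStructures (Fin n), X n E = ∑ E ∈ structures (Fin n), X n E -
        ∑ E ∈ structures (Fin n) \ connStructures (Fin n), X n E := by
      rw [← Finset.sum_sdiff (connStructures_subset (V := Fin n))]; ring
    have h4 : ((connStructures (Fin n)).card : ℝ) = structCount n -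
        ((structures (Fin n) \ connStructures (Fin n)).card : ℝ) := by
      have := Finset.card_sdiff_add_card_eq_card (connStructures_subset (V := Fin n))
      rw [card_structures, Fintype.card_fin] at this
      rw [← this]; push_cast; ring
    rw [hδ, h3, h4]
    simp only [hD]
    rw [one_sub_div hT.ne', ← sub_div, ← sub_div, div_right_comm _ (structCount n : ℝ),
      div_div_div_cancel_right₀ hT.ne', div_right_comm]

end Counts

/-! ### First and second moments of the statistics. -/

section Moments

open Topology

/-- Telescoping turns every pattern count into a product of values of `meanLoops`. An isolated edge
uses two points, so its mean number is `meanLoops x n * meanLoops x (n - 1)` with `x = Gen.b`. -/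
lemma descFactorial_mul_partCount (x : Gen) (n k : ℕ) :
    (n.descFactorial k * partCount x (n - k) : ℝ) =
      (∏ j ∈ Finset.range k, meanLoops x (n - j)) * partCount x n := by
  induction k with
  | zero => simp
  | succ k ih =>
    have h : ((n - k : ℕ) : ℝ) * partCount x (n - (k + 1)) =
        meanLoops x (n - k) * partCount x (n - k) := by
      rw [meanLoops, div_mul_cancel₀ _ (partCount_cast_pos _ _).ne', Nat.sub_sub]
    rw [Finset.prod_range_succ, Nat.descFactorial_succ, Nat.cast_mul]
    linear_combination (n.descFactorial k : ℝ) * h + meanLoops x (n - k) * ih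

lemma card_mul_partCount (x : Gen) (n : ℕ) :
    ((n * partCount x (n - 1) : ℕ) : ℝ) = meanLoops x n * partCount x n := by
  simpa using descFactorial_mul_partCount x n 1

lemma card_mul_card_mul_partCount (x : Gen) (n : ℕ) :
    ((n * (n - 1) * partCount x (n - 2) : ℕ) : ℝ) =
      meanLoops x n * meanLoops x (n - 1) * partCount x n := by
  have := descFactorial_mul_partCount x n 2
  simpa [Finset.prod_range_succ, Nat.descFactorial_succ, mul_comm (n - 1) n] using this

lemma sum_structures_a (n : ℕ) (f : (Fin n → Fin n → Prop) → ℝ) :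
    ∑ E ∈ structures (Fin n), f (E Gen.a) =
      (∑ R ∈ parts Gen.a (Fin n), f R) * partCount Gen.b n := by
  rw [sum_structures fun R _ => f R, Finset.sum_mul]
  simp [card_parts, mul_comm]

lemma sum_structures_b (n : ℕ) (f : (Fin n → Fin n → Prop) → ℝ) :
    ∑ E ∈ structures (Fin n), f (E Gen.b) =
      (∑ R ∈ parts Gen.b (Fin n), f R) * partCount Gen.a n := by
  rw [sum_structures fun _ R => f R]
  simp [card_parts, mul_comm]

lemma sum_loops (x : Gen) (n : ℕ) :
    ∑ R ∈ parts x (Fin n), ((loops R).card : ℝ) = meanLoops x n * partCount x n := by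
  rw [← card_mul_partCount]
  have := sum_card_loops (V := Fin n) x
  rw [Fintype.card_fin] at this
  exact_mod_cast this

lemma sum_loops_sq_le (x : Gen) (n : ℕ) :
    ∑ R ∈ parts x (Fin n), ((loops R).card : ℝ) ^ 2 ≤
      (meanLoops x n + meanLoops x n * meanLoops x (n - 1)) * partCount x n := by
  rw [add_mul, ← card_mul_partCount, ← card_mul_card_mul_partCount]
  have := sum_card_loops_sq_le (V := Fin n) x
  rw [Fintype.card_fin] at this
  simp only [pow_two]
  exact_mod_cast this

lemma sum_sources (n : ℕ) :
    ∑ R ∈ parts Gen.b (Fin n), ((sources R).card : ℝ) =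
      meanLoops Gen.b n * meanLoops Gen.b (n - 1) * partCount Gen.b n := by
  rw [← card_mul_card_mul_partCount]
  have := sum_card_sources (V := Fin n)
  rw [Fintype.card_fin] at this
  exact_mod_cast this

lemma sum_sources_sq_le (n : ℕ) :
    ∑ R ∈ parts Gen.b (Fin n), ((sources R).card : ℝ) ^ 2 ≤
      (meanLoops Gen.b n * meanLoops Gen.b (n - 1) +
        ∏ j ∈ Finset.range 4, meanLoops Gen.b (n - j)) * partCount Gen.b n := by
  rw [add_mul, ← descFactorial_mul_partCount, ← card_mul_card_mul_partCount]
  have := sum_card_sources_sq_le (V := Fin n)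
  rw [Fintype.card_fin] at this
  simp only [pow_two]
  exact_mod_cast this

lemma eventually_rpow_pos (s : ℝ) : ∀ᶠ n : ℕ in atTop, (0 : ℝ) < (n : ℝ) ^ s := by
  filter_upwards [eventually_ge_atTop 1] with n hn
  have : (0 : ℝ) < n := by exact_mod_cast hn
  positivity

lemma one_le_rpow {n : ℕ} (hn : 1 ≤ n) {s : ℝ} (hs : 0 ≤ s) : (1 : ℝ) ≤ (n : ℝ) ^ s :=
  Real.one_le_rpow (by exact_mod_cast hn) hs

/-- The mean number of `a`-labeled loops of a connected structure. -/
lemma tendsto_average_loops_a :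
    Tendsto (fun n : ℕ => (∑ E ∈ connStructures (Fin n), ((loops (E Gen.a)).card : ℝ)) /
      ((connStructures (Fin n)).card : ℝ) / (n : ℝ) ^ (1 / 2 : ℝ)) atTop (𝓝 1) := by
  -- With `z = n^(1/2) ≥ 1`, the second moment is at most `z + z² ≤ 2z²`.
  refine tendsto_average (X := fun n E => ((loops (E Gen.a)).card : ℝ)) (C := 2)
    (fun n E => by positivity) (eventually_rpow_pos _) ?_ ?_
  · refine tendsto_meanLoops_a.congr fun n => ?_
    rw [sum_structures_a n fun R => ((loops R).card : ℝ), sum_loops, structCount, Nat.cast_mul,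
      mul_assoc, mul_div_cancel_right₀]
    exact (mul_pos (partCount_cast_pos _ _) (partCount_cast_pos _ _)).ne'
  · filter_upwards [eventually_ge_atTop 1] with n hn
    rw [sum_structures_a n fun R => ((loops R).card : ℝ) ^ 2, structCount, Nat.cast_mul,
      ← mul_assoc]
    gcongr
    refine (sum_loops_sq_le _ _).trans ?_
    gcongr
    have h0 := one_le_rpow hn (s := 1 / 2) (by norm_num)
    have h1 := meanLoops_a_le n
    have h2 := (meanLoops_a_le (n - 1)).trans
      (Real.sqrt_le_sqrt (by exact_mod_cast Nat.sub_le n 1 : ((n - 1 : ℕ) : ℝ) ≤ n))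
    rw [Real.sqrt_eq_rpow] at h1 h2
    have h3 := mul_le_mul h1 h2 (meanLoops_nonneg _ _) (by positivity)
    nlinarith

/-- The mean number of `b`-labeled loops of a connected structure. -/
lemma tendsto_average_loops_b :
    Tendsto (fun n : ℕ => (∑ E ∈ connStructures (Fin n), ((loops (E Gen.b)).card : ℝ)) /
      ((connStructures (Fin n)).card : ℝ) / (n : ℝ) ^ (1 / 3 : ℝ)) atTop (𝓝 1) := by
  -- With `z = n^(1/3) ≥ 1` and means at most `2z`, the second moment is at most `2z + 4z² ≤ 6z²`.
  refine tendsto_average (X := fun n E => ((loops (E Gen.b)).card : ℝ)) (C := 6)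
    (fun n E => by positivity) (eventually_rpow_pos _) ?_ ?_
  · refine tendsto_meanLoops_b.congr fun n => ?_
    rw [sum_structures_b n fun R => ((loops R).card : ℝ), sum_loops, structCount, Nat.cast_mul,
      mul_assoc, mul_comm (partCount Gen.b n : ℝ), mul_div_cancel_right₀]
    exact (mul_pos (partCount_cast_pos _ _) (partCount_cast_pos _ _)).ne'
  · filter_upwards [eventually_ge_atTop 5] with n hn
    rw [sum_structures_b n fun R => ((loops R).card : ℝ) ^ 2, structCount, Nat.cast_mul,
      mul_comm (partCount Gen.a n : ℝ), ← mul_assoc]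
    gcongr
    refine (sum_loops_sq_le _ _).trans ?_
    gcongr
    have h0 := one_le_rpow (n := n) (by omega) (s := 1 / 3) (by norm_num)
    have h1 := meanLoops_b_le (n := n) (m := n) (by omega) le_rfl
    have h2 := meanLoops_b_le (n := n) (m := n - 1) (by omega) (by omega)
    have h3 := mul_le_mul h1 h2 (meanLoops_nonneg _ _) (by positivity)
    nlinarith

/-- The mean number of isolated `b`-labeled edges of a connected structure. -/
lemma tendsto_average_sources :
    Tendsto (fun n : ℕ => (∑ E ∈ connStructures (Fin n), ((sources (E Gen.b)).card : ℝ)) /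
      ((connStructures (Fin n)).card : ℝ) / (n : ℝ) ^ (2 / 3 : ℝ)) atTop (𝓝 1) := by
  -- With `z = n^(1/3)`, the second moment is at most `(2z)² + (2z)⁴ ≤ 20z⁴`, and `z⁴` is the square
  -- of the scale `n^(2/3)`. The bound needs `n - 3 ≥ 4`.
  refine tendsto_average (X := fun n E => ((sources (E Gen.b)).card : ℝ)) (C := 20)
    (fun n E => by positivity) (eventually_rpow_pos _) ?_ ?_
  · have hs : Tendsto (fun n : ℕ => meanLoops Gen.b (n - 1) / (n : ℝ) ^ (1 / 3 : ℝ)) atTop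
        (𝓝 1) := by
      have h := (tendsto_meanLoops_b.comp (tendsto_sub_atTop_nat 1)).mul
        (tendsto_add_const_rpow_ratio (-1) (1 / 3))
      rw [mul_one] at h
      refine h.congr' ?_
      filter_upwards [eventually_ge_atTop 2] with n hn
      have hc : ((n - 1 : ℕ) : ℝ) = n + -1 := by
        rw [Nat.cast_sub (by omega)]; push_cast; ring
      have hp : (0 : ℝ) < n + -1 := by
        rw [← hc]; exact_mod_cast (by omega)
      rw [Function.comp_apply, hc, div_mul_div_cancel₀]
      positivity
    have h := tendsto_meanLoops_b.mul hs
    rw [mul_one] at h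
    refine h.congr fun n => ?_
    rw [sum_structures_b n fun R => ((sources R).card : ℝ), sum_sources, structCount,
      Nat.cast_mul, mul_assoc, mul_comm (partCount Gen.b n : ℝ), mul_div_cancel_right₀,
      div_mul_div_comm]
    · rw [← pow_two, ← Real.rpow_mul_natCast (Nat.cast_nonneg n)]
      norm_num
    · exact (mul_pos (partCount_cast_pos _ _) (partCount_cast_pos _ _)).ne'
  · filter_upwards [eventually_ge_atTop 7] with n hn
    rw [sum_structures_b n fun R => ((sources R).card : ℝ) ^ 2, structCount, Nat.cast_mul,
      mul_comm (partCount Gen.a n : ℝ), ← mul_assoc]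
    gcongr
    refine (sum_sources_sq_le _).trans ?_
    gcongr
    have h0 := one_le_rpow (n := n) (by omega) (s := 1 / 3) (by norm_num)
    have hm : ∀ j ∈ Finset.range 4, meanLoops Gen.b (n - j) ≤ 2 * (n : ℝ) ^ (1 / 3 : ℝ) := by
      intro j hj
      rw [Finset.mem_range] at hj
      exact meanLoops_b_le (by omega) (by omega)
    have h1 := Finset.prod_le_prod (fun j _ => meanLoops_nonneg Gen.b (n - j)) hm
    rw [Finset.prod_const, Finset.card_range] at h1
    have h2 := mul_le_mul (meanLoops_b_le (n := n) (m := n) (by omega) le_rfl)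
      (meanLoops_b_le (n := n) (m := n - 1) (by omega) (by omega)) (meanLoops_nonneg _ _)
      (by positivity)
    have h3 : (n : ℝ) ^ (2 / 3 : ℝ) = ((n : ℝ) ^ (1 / 3 : ℝ)) ^ 2 := by
      rw [← Real.rpow_mul_natCast (Nat.cast_nonneg n)]
      norm_num
    rw [h3]
    set z := (n : ℝ) ^ (1 / 3 : ℝ)
    have h4 : z ^ 2 ≤ z ^ 4 := pow_le_pow_right₀ h0 (by norm_num)
    calc _ ≤ 2 * z * (2 * z) + (2 * z) ^ 4 := add_le_add h2 h1
      _ ≤ _ := by ring_nf; linarith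

end Moments

/-! ### Expected isomorphism types. -/

section IsoTypes

open Topology

lemma isLittleO_of_tendsto_div {f : ℕ → ℝ} {s : ℝ}
    (h : Tendsto (fun n : ℕ => f n / (n : ℝ) ^ s) atTop (𝓝 0)) :
    f =o[atTop] fun n : ℕ => (n : ℝ) ^ s := by
  refine (isLittleO_iff_tendsto' ?_).2 h
  filter_upwards [eventually_rpow_pos s] with n hn h0
  exact absurd h0 hn.ne'

lemma isLittleO_sub_of_tendsto_div {f : ℕ → ℝ} {s : ℝ}
    (h : Tendsto (fun n : ℕ => f n / (n : ℝ) ^ s) atTop (𝓝 1)) :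
    (fun n : ℕ => f n - (n : ℝ) ^ s) =o[atTop] fun n : ℕ => (n : ℝ) ^ s := by
  refine isLittleO_of_tendsto_div ?_
  have h' := h.sub_const 1
  rw [sub_self] at h'
  refine h'.congr' ?_
  filter_upwards [eventually_rpow_pos s] with n hn
  rw [sub_div, div_self hn.ne']

lemma expectedValue_isoType {n : ℕ} (hn : 2 ≤ n) :
    expectedValue n (fun H => (isoType H).1) =
        (∑ E ∈ connStructures (Fin n), ((loops (E Gen.a)).card : ℝ)) /
          ((connStructures (Fin n)).card : ℝ) ∧
      expectedValue n (fun H => (isoType H).2.1) =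
        (∑ E ∈ connStructures (Fin n), ((loops (E Gen.b)).card : ℝ)) /
          ((connStructures (Fin n)).card : ℝ) ∧
      expectedValue n (fun H => (isoType H).2.2) = n / 6 + 1 -
        (∑ E ∈ connStructures (Fin n), ((loops (E Gen.a)).card : ℝ)) /
          ((connStructures (Fin n)).card : ℝ) / 2 -
        2 * ((∑ E ∈ connStructures (Fin n), ((loops (E Gen.b)).card : ℝ)) /
          ((connStructures (Fin n)).card : ℝ)) / 3 -
        (∑ E ∈ connStructures (Fin n), ((sources (E Gen.b)).card : ℝ)) /
          ((connStructures (Fin n)).card : ℝ) / 3 := by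
  have : NeZero n := ⟨by omega⟩
  rw [expectedValue_eq hn, expectedValue_eq hn, expectedValue_eq hn]
  refine ⟨?_, ?_, ?_⟩
  · congr 1
    exact Finset.sum_congr rfl fun E hE => by rw [(isoType_loopSubgroup hE 0).1]
  · congr 1
    exact Finset.sum_congr rfl fun E hE => by rw [(isoType_loopSubgroup hE 0).2.1]
  · have hne : ((connStructures (Fin n)).card : ℝ) ≠ 0 := by
      exact_mod_cast (Finset.card_pos.2 ⟨_, segment_mem n⟩).ne'
    rw [Finset.sum_congr rfl fun E hE => (isoType_loopSubgroup hE 0).2.2]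
    simp only [Finset.sum_sub_distrib, Finset.sum_const, nsmul_eq_mul, ← Finset.sum_div,
      ← Finset.mul_sum, Fintype.card_fin]
    field_simp

/-- In the formula for `r`, the constant and the loops, of mean orders `n^(1/2)` and `n^(1/3)`, are
negligible against `n^(2/3)`. The whole second-order term comes from the isolated `b`-edges. -/
theorem isLittleO_expectedValue_rank :
    (fun n : ℕ => expectedValue n (fun H => (isoType H).2.2)
        - ((n : ℝ) / 6 - (1 / 3 : ℝ) * (n : ℝ) ^ (2 / 3 : ℝ)))
      =o[atTop] (fun n : ℕ => (n : ℝ) ^ (2 / 3 : ℝ)) := by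
  refine isLittleO_of_tendsto_div ?_
  have h1 := (tendsto_average_loops_a.mul
    (tendsto_natCast_rpow_neg (s := 1 / 6) (by norm_num))).div_const 2
  have h2 := ((tendsto_average_loops_b.mul
    (tendsto_natCast_rpow_neg (s := 1 / 3) (by norm_num))).const_mul 2).div_const 3
  have h3 := (tendsto_average_sources.sub_const 1).div_const 3
  have h := (((tendsto_natCast_rpow_neg (s := 2 / 3) (by norm_num)).sub h1).sub h2).sub h3
  norm_num only at h
  refine h.congr' ?_
  filter_upwards [eventually_ge_atTop 2] with n hn
  rw [(expectedValue_isoType hn).2.2]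
  have hn0 : (0 : ℝ) < n := by exact_mod_cast (by omega)
  have e1 : ((n : ℝ) ^ (1 / 2 : ℝ))⁻¹ * (n : ℝ) ^ (-(1 / 6) : ℝ) =
      ((n : ℝ) ^ (2 / 3 : ℝ))⁻¹ := by
    rw [← Real.rpow_neg hn0.le, ← Real.rpow_neg hn0.le, ← Real.rpow_add hn0]; norm_num
  have e2 : ((n : ℝ) ^ (1 / 3 : ℝ))⁻¹ * (n : ℝ) ^ (-(1 / 3) : ℝ) =
      ((n : ℝ) ^ (2 / 3 : ℝ))⁻¹ := by
    rw [← Real.rpow_neg hn0.le, ← Real.rpow_neg hn0.le, ← Real.rpow_add hn0]; norm_num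
  have e3 : (n : ℝ) ^ (2 / 3 : ℝ) * ((n : ℝ) ^ (2 / 3 : ℝ))⁻¹ = 1 :=
    mul_inv_cancel₀ (by positivity)
  have e4 : (n : ℝ) ^ (-(2 / 3) : ℝ) = ((n : ℝ) ^ (2 / 3 : ℝ))⁻¹ := Real.rpow_neg hn0.le _
  rw [e4]
  generalize (∑ E ∈ connStructures (Fin n), ((loops (E Gen.a)).card : ℝ)) /
    ((connStructures (Fin n)).card : ℝ) = A
  generalize (∑ E ∈ connStructures (Fin n), ((loops (E Gen.b)).card : ℝ)) /
    ((connStructures (Fin n)).card : ℝ) = B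
  generalize (∑ E ∈ connStructures (Fin n), ((sources (E Gen.b)).card : ℝ)) /
    ((connStructures (Fin n)).card : ℝ) = K
  simp only [div_eq_mul_inv A, div_eq_mul_inv B, div_eq_mul_inv _ ((n : ℝ) ^ (2 / 3 : ℝ)),
    mul_assoc, e1, e2]
  linear_combination (-(1 / 3) : ℝ) * e3

end IsoTypes

end ModularSubgroups

end

open ModularSubgroups in
theorem mainTheorem3 :
    (∀ n : ℕ, 1 ≤ n →
      (cyclicallyReducedSubgroups n).Finite ∧ (cyclicallyReducedSubgroups n).Nonempty) ∧
    (∀ n : ℕ, ∀ H ∈ cyclicallyReducedSubgroups n, ∃! t : ℕ × ℕ × ℕ, HasIsoType H t) ∧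
    (fun n : ℕ => expectedValue n (fun H => (isoType H).1) - (n : ℝ) ^ (1 / 2 : ℝ))
      =o[atTop] (fun n : ℕ => (n : ℝ) ^ (1 / 2 : ℝ)) ∧
    (fun n : ℕ => expectedValue n (fun H => (isoType H).2.1) - (n : ℝ) ^ (1 / 3 : ℝ))
      =o[atTop] (fun n : ℕ => (n : ℝ) ^ (1 / 3 : ℝ)) ∧
    (fun n : ℕ => expectedValue n (fun H => (isoType H).2.2)
        - ((n : ℝ) / 6 - (1 / 3 : ℝ) * (n : ℝ) ^ (2 / 3 : ℝ)))
      =o[atTop] (fun n : ℕ => (n : ℝ) ^ (2 / 3 : ℝ)) := by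
  refine ⟨fun n hn => ⟨finite_cyclicallyReducedSubgroups hn, nonempty_cyclicallyReducedSubgroups hn⟩,
    fun n H hH => existsUnique_hasIsoType n hH, ?_, ?_, isLittleO_expectedValue_rank⟩
  · refine isLittleO_sub_of_tendsto_div (tendsto_average_loops_a.congr' ?_)
    filter_upwards [eventually_ge_atTop 2] with n hn
    rw [(expectedValue_isoType hn).1]
  · refine isLittleO_sub_of_tendsto_div (tendsto_average_loops_b.congr' ?_)
    filter_upwards [eventually_ge_atTop 2] with n hn
    rw [(expectedValue_isoType hn).2.1]
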